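/- **Setting.** Let $\mathcal G$ be an undirected graph with nodes $1,\dots,N$ and graph distance $d_{\mathcal G}$ ($=\infty$ between different components). Node $i$ has a state $x_t[i]\in\mathbb R^{n_i}$ and an input $u_t[i]\in\mathbb R^{m_i}$, and the stacked vectors obey $x_{t+1}=Ax_t+Bu_t+w_t$, where the blocks $A[i,j],B[i,j]$ vanish for distinct non-adjacent $i,j$. For a matrix or vector $M$, $M^{(i,\kappa)}$ is obtained by setting to zero all block rows $j$ with $d_{\mathcal G}(i,j)>\kappa$. All norms are Euclidean or the induced operator norms. The pair $(A,B)$ is $(L,\gamma)$-stabilizable if $L>1$, $\gamma\in(0,1)$ and there is $K$ with $\|K\|\le L$ and $\|(A-BK)^t\|\le L\gamma^t$ for all $t\ge 0$. *System assumption* (parameters $L>1$, $\gamma\in(0,1)$, $\sigma>0$, $d\ge1$, $\kappa_0$): $\|A\|,\|B\|,\|B^\dagger\|\le L$; the matrix $[B,AB,\dots,A^{d-1}B]$ has full row rank and smallest singular value at least $\sigma$; $\kappa_0<\mathrm{diam}(\mathcal G)$, and $(A^{(i,\kappa)},B^{(i,\kappa)})$ is $(L,\gamma)$-stabilizable for all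 $i$ and all $\kappa\ge\kappa_0$. *Cost assumption* (parameters $\mu>0$ and the same $L$): the aggregated costs $f_t(x)=\sum_i f_t[i](x[i])$, $0\le t\le T$, and $c_t(u)=\sum_i c_t[i](u[i])$, $1\le t\le T$, are $\mu$-strongly convex, $L$-smooth, $C^2$, nonnegative and zero at $0$; the terminal cost $F$ is $\mu$-strongly convex, $L$-smooth, $C^2$ and of the form $F(x)=\beta(\|x\|)$ with $\beta$ strictly increasing on $[0,\infty)$ and $\beta(0)=0$. *Graph assumption*: $|\{j: d_{\mathcal G}(i,j)=r\}|\le p(r)$ for all $i$ and all $r\ge 0$, where $p>0$ and $\lim_{r\to\infty}(\log p(r))/r=0$. *Algorithm* $DTPC_k$ with truncation radius $\kappa$: at each time $t<T$ every node $i$ minimizes $\sum_{\tau=0}^{\ell-1}\bigl(f_{t+\tau}(y_\tau)+c_{t+\tau+1}(v_\tau)\bigr)+g(y_\ell)$ subject to $y_0=x_t^{(i,\kappa)}$ and $y_{\tau+1}=A^{(i,\kappa)}y_\tau+B^{(i,\kappa)}v_\tau+w_{t+\tau}^{(i,\kappa)}$, with $(\ell,g)=(k,F)$ if $t<T-k$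 and $(\ell,g)=(T-t,f_T)$ otherwise, and applies $u_t[i]=v_0[i]$. The cost of a trajectory is $\sum_{t=0}^Tf_t(x_t)+\sum_{t=0}^{T-1}c_{t+1}(u_t)$, and $OPT$ is the minimizing trajectory from the same $x_0$ with all $f_t,c_t,w_t$ known. *Constants*: $\mu_J=\frac{(1-\gamma)^2}{L^2(1+L)^2}$, $L_H=2L+1$, $\mu_H=\Bigl(\frac1\mu+\bigl(1+\frac{2L_H}{\mu}+\frac{L_H^2}{\mu^2}\bigr)\frac{L_H}{\mu_J}\Bigr)^{-1}$, $\rho=\Bigl(\frac{L_H^2-\mu_H^2}{L_H^2+\mu_H^2}\Bigr)^{1/2}$, $\alpha=\frac{L_H}{\mu_H^2\rho}$, $\delta_{\mathcal S}=\frac{1+\rho}2$, $\Gamma=\frac{4\alpha^2\delta_{\mathcal S}L}{(1-\delta_{\mathcal S})^2}\Bigl(\sup_{r\ge 0}(\rho/\delta_{\mathcal S})^rp(r)\Bigr)^2p(1)$. **Theorem.** Given $L,\mu,\gamma,\sigma,d$, there are constants $\Omega>0$ and $\delta_{\mathcal T}\in(0,1)$, depending only on these, with the following two properties. (Temporal decay.)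 Under the system assumption and the assumption on the stage costs $f_t,c_t$, let $\Psi_t^h(x,\zeta,z)$ be the minimizer of $\sum_{\tau=0}^{h}f_{t+\tau}(y_\tau)+\sum_{\tau=1}^hc_{t+\tau}(v_{\tau-1})$ subject to $y_{\tau+1}=Ay_\tau+Bv_\tau+\zeta_\tau$, $y_0=x$, $y_h=z$, where $h\ge d$ and $t+h\le T$. Then for $0\le m\le h$ the states $y_m,y_m'$ of $\Psi_t^h(x,\zeta,z)$ and $\Psi_t^h(x',\zeta',z')$ satisfy $$\|y_m-y_m'\|\le\Omega\Bigl(\delta_{\mathcal T}^m\|x-x'\|+\delta_{\mathcal T}^{h-m}\|z-z'\|+\sum_{l=0}^{h-1}\delta_{\mathcal T}^{|m-l|}\|\zeta_l-\zeta_l'\|\Bigr).$$ (Performance.) Let $p$ be subexponential and put $C=\max(\Omega,\Gamma)$, $\delta=\max(\delta_{\mathcal S},\delta_{\mathcal T})$, $\xi=1-\sqrt\delta$; then $\xi>0$. Under the system, cost and graph assumptions, let $k\le T$, let $D_k\ge\max_{0\le t\le T-k}\sum_{\tau=0}^{k-1}\|w_{t+\tau}\|$, put $W=\frac{10C^3LN}{(1-\delta)^2}D_k$,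 and suppose $$\kappa\ge\max\Bigl(\kappa_0,\frac{\log\frac{(1-\sqrt\delta)(1-\delta)}{2C^2LN}}{\log\delta}\Bigr),\qquad k\ge\frac{2\log\frac{\delta^{5/2}(1-\delta)}{4C^3}}{\log\delta}.$$ Then the trajectory of $DTPC_k$ satisfies, for $0\le t\le T$, $$\|x_t\|\le\begin{cases}\frac C\xi(1-\xi)^{\max(0,t-k)}\|x_0\|+\frac W\xi,&t\le T-k,\\[2pt]\frac{C^2}{\xi^2}(1-\xi)^{T-2k}\delta^{t+k-T}\|x_0\|+\frac{2CW}{\xi^2},&t>T-k,\end{cases}$$ and $$\mathrm{cost}(DTPC_k)-\mathrm{cost}(OPT)=O\Bigl(\Bigl[\bigl(D_k+\tfrac{\|x_0\|+D_k}{\xi^2}\bigr)^2\delta^\kappa+\bigl(D_k+\tfrac{\delta^k(\|x_0\|+D_k)}{\xi}\bigr)^2\delta^k\Bigr]T+\eta\|x_0\|^2\Bigr)$$ with $\eta=\Theta(\max(\delta^k,\delta^\kappa))$, where the constants hidden in $O$ and $\Theta$ depend only on $L,\mu,\gamma,\sigma,d,p,N$ and on the choice of $\Omega,\delta_{\mathcal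 T}$ (not on the system, the costs, $T$, $k$, $\kappa$, $w$, $D_k$ or $x_0$). -/

import Mathlib

open scoped Matrix.Norms.L2Operator Topology

noncomputable section

namespace DTPC

/-- Scalar coordinates of a stacked vector `(x[i])_i`, where `x[i]` has `n i` entries. -/
abbrev Idx {N : ℕ} (n : Fin N → ℕ) : Type := Σ i : Fin N, Fin (n i)

/-- Stacked vectors `(x[i])_i`, with the Euclidean norm. -/
abbrev Vec {N : ℕ} (n : Fin N → ℕ) : Type := EuclideanSpace ℝ (Idx n)

/-- The block `x[i]` of a stacked vector. -/
def block {N : ℕ} {n : Fin N → ℕ} (x : Vec n) (i : Fin N) : EuclideanSpace ℝ (Fin (n i)) :=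
  WithLp.toLp 2 fun a => x ⟨i, a⟩

/-- Matrix-vector product on Euclidean spaces. -/
def act {ι κ : Type} [Fintype ι] [Fintype κ] [DecidableEq κ] (M : Matrix ι κ ℝ)
    (x : EuclideanSpace ℝ κ) : EuclideanSpace ℝ ι :=
  Matrix.toEuclideanLin M x

/-- A block matrix is networked over `G` if `M[i,j] = 0` for distinct non-adjacent `i, j`. -/
def IsNetworked {N : ℕ} (G : SimpleGraph (Fin N)) {n m : Fin N → ℕ}
    (M : Matrix (Idx n) (Idx m) ℝ) : Prop :=
  ∀ p q, p.1 ≠ q.1 → ¬ G.Adj p.1 q.1 → M p q = 0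

/-- A networked linear time-invariant system `x⁺ = A x + B u + w` on a graph with `N` nodes. -/
structure Network (N : ℕ) where
  /-- the underlying graph -/
  graph : SimpleGraph (Fin N)
  /-- state dimensions of the nodes -/
  nx : Fin N → ℕ
  /-- input dimensions of the nodes -/
  nu : Fin N → ℕ
  /-- state matrix -/
  A : Matrix (Idx nx) (Idx nx) ℝ
  /-- input matrix -/
  B : Matrix (Idx nx) (Idx nu) ℝ
  networked_A : IsNetworked graph A
  networked_B : IsNetworked graph B

open Classical in
/-- The `(i,κ)`-truncation of a matrix: block rows outside the `κ`-hop neighbourhood of `i`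
are replaced by zero.  (`edist` is `⊤` between different components.) -/
def truncMat {N : ℕ} (G : SimpleGraph (Fin N)) (i : Fin N) (κ : ℕ) {n m : Fin N → ℕ}
    (M : Matrix (Idx n) (Idx m) ℝ) : Matrix (Idx n) (Idx m) ℝ :=
  Matrix.of fun p q => if G.edist i p.1 ≤ (κ : ℕ∞) then M p q else 0

open Classical in
/-- The `(i,κ)`-truncation of a stacked vector. -/
def truncVec {N : ℕ} (G : SimpleGraph (Fin N)) (i : Fin N) (κ : ℕ) {n : Fin N → ℕ}
    (x : Vec n) : Vec n :=
  WithLp.toLp 2 fun p => if G.edist i p.1 ≤ (κ : ℕ∞) then x p else 0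

/-- `(L,γ)`-stabilizability of a pair `(A,B)` (operator norms). -/
def Stabilizable {ι κ : Type} [Fintype ι] [DecidableEq ι] [Fintype κ] [DecidableEq κ]
    (A : Matrix ι ι ℝ) (B : Matrix ι κ ℝ) (L γ : ℝ) : Prop :=
  1 < L ∧ 0 < γ ∧ γ < 1 ∧
    ∃ K : Matrix κ ι ℝ, ‖K‖ ≤ L ∧ ∀ t : ℕ, ‖(A - B * K) ^ t‖ ≤ L * γ ^ t

/-- `P` is the Moore–Penrose pseudo-inverse of `B`. -/
def IsMoorePenrose {ι κ : Type} [Fintype ι] [Fintype κ]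
    (B : Matrix ι κ ℝ) (P : Matrix κ ι ℝ) : Prop :=
  B * P * B = B ∧ P * B * P = P ∧ (B * P).transpose = B * P ∧ (P * B).transpose = P * B

/-- The reduced controllability matrix `[B, AB, …, A^(d-1) B]`. -/
def ctrlMat {ι κ : Type} [Fintype ι] [DecidableEq ι] [Fintype κ]
    (A : Matrix ι ι ℝ) (B : Matrix ι κ ℝ) (d : ℕ) : Matrix ι (Fin d × κ) ℝ :=
  Matrix.of fun p q => (A ^ (q.1 : ℕ) * B) p q.2

/-- The matrix `M` has full row rank and its smallest singular value is at least `σ`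
(for `σ > 0`): `‖Mᵀ v‖ ≥ σ ‖v‖` for all `v`. -/
def MinSingularGe {ι κ : Type} [Fintype ι] [DecidableEq ι] [Fintype κ]
    (M : Matrix ι κ ℝ) (σ : ℝ) : Prop :=
  ∀ v : EuclideanSpace ℝ ι, σ * ‖v‖ ≤ ‖act M.transpose v‖

/-- Boundedness, controllability and local stabilizability of the networked system. -/
structure SystemAssumption {N : ℕ} (S : Network N) (L γ σ : ℝ) (d κ₀ : ℕ) : Prop where
  norm_A : ‖S.A‖ ≤ L
  norm_B : ‖S.B‖ ≤ L
  norm_pinv : ∃ P, IsMoorePenrose S.B P ∧ ‖P‖ ≤ L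
  controllable : MinSingularGe (ctrlMat S.A S.B d) σ
  kappa_lt_diam : (κ₀ : ℕ∞) < S.graph.ediam
  stabilizable : ∀ (i : Fin N) (κ : ℕ), κ₀ ≤ κ →
    Stabilizable (truncMat S.graph i κ S.A) (truncMat S.graph i κ S.B) L γ

/-- Aggregate `h(x) = ∑ᵢ h[i](x[i])` of local costs. -/
def aggregate {N : ℕ} {n : Fin N → ℕ} (h : ∀ i, EuclideanSpace ℝ (Fin (n i)) → ℝ)
    (x : Vec n) : ℝ :=
  ∑ i, h i (block x i)

/-- Strong convexity, smoothness (Lipschitz gradient) and `C²` regularity. -/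
structure WellConditioned {ι : Type} [Fintype ι] (h : EuclideanSpace ℝ ι → ℝ) (μ L : ℝ) :
    Prop where
  strongConvex : StrongConvexOn Set.univ μ h
  contDiff : ContDiff ℝ 2 h
  smooth : ∀ x y, ‖gradient h x - gradient h y‖ ≤ L * ‖x - y‖

/-- Local cost functions over time: `f t i` is the state cost of node `i` at time `t`
(used for `0 ≤ t ≤ T`), `c t i` its input cost (used for `1 ≤ t ≤ T`). -/
structure Costs {N : ℕ} (S : Network N) where
  /-- local state costs -/
  f : ℕ → ∀ i, EuclideanSpace ℝ (Fin (S.nx i)) → ℝ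
  /-- local input costs -/
  c : ℕ → ∀ i, EuclideanSpace ℝ (Fin (S.nu i)) → ℝ

/-- The aggregated state cost `f_t`. -/
def Costs.fSum {N : ℕ} {S : Network N} (Q : Costs S) (t : ℕ) : Vec S.nx → ℝ :=
  aggregate (Q.f t)

/-- The aggregated input cost `c_t`. -/
def Costs.cSum {N : ℕ} {S : Network N} (Q : Costs S) (t : ℕ) : Vec S.nu → ℝ :=
  aggregate (Q.c t)

/-- Assumption on the stage costs up to the time `T`. -/
structure StageCostAssumption {N : ℕ} {S : Network N} (Q : Costs S) (T : ℕ) (μ L : ℝ) :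
    Prop where
  wc_f : ∀ t ≤ T, WellConditioned (Q.fSum t) μ L
  wc_c : ∀ t, 1 ≤ t → t ≤ T → WellConditioned (Q.cSum t) μ L
  nonneg_f : ∀ t ≤ T, ∀ x, 0 ≤ Q.fSum t x
  nonneg_c : ∀ t, 1 ≤ t → t ≤ T → ∀ u, 0 ≤ Q.cSum t u
  zero_f : ∀ t ≤ T, Q.fSum t 0 = 0
  zero_c : ∀ t, 1 ≤ t → t ≤ T → Q.cSum t 0 = 0

/-- Assumption on the terminal cost: well-conditioned, and a strictly increasing function of
the norm that vanishes at zero. -/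
structure TerminalCostAssumption {N : ℕ} {n : Fin N → ℕ} (F : Vec n → ℝ) (μ L : ℝ) :
    Prop where
  wc : WellConditioned F μ L
  kFun : ∃ β : ℝ → ℝ, StrictMonoOn β (Set.Ici 0) ∧ β 0 = 0 ∧ ∀ x, F x = β ‖x‖

/-- Subexponential growth of a positive function. -/
def Subexponential (p : ℕ → ℝ) : Prop :=
  (∀ r, 0 < p r) ∧ Filter.Tendsto (fun r : ℕ => Real.log (p r) / (r : ℝ)) Filter.atTop (𝓝 0)

/-- Every distance shell of radius `r` has at most `p r` nodes. -/
def ShellBound {N : ℕ} (G : SimpleGraph (Fin N)) (p : ℕ → ℝ) : Prop :=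
  ∀ (i : Fin N) (r : ℕ), (({j : Fin N | G.edist i j = (r : ℕ∞)} : Set (Fin N)).ncard : ℝ) ≤ p r

/-- `(y_0,…,y_ℓ, v_0,…,v_(ℓ-1))` obeys `y_(τ+1) = A y_τ + B v_τ + ζ_τ`, `y_0 = x`.
(Values at later indices are irrelevant.) -/
def Feasible {N : ℕ} {nx nu : Fin N → ℕ} (A : Matrix (Idx nx) (Idx nx) ℝ)
    (B : Matrix (Idx nx) (Idx nu) ℝ) (ℓ : ℕ) (x : Vec nx) (ζ : ℕ → Vec nx)
    (y : ℕ → Vec nx) (v : ℕ → Vec nu) : Prop :=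
  y 0 = x ∧ ∀ τ < ℓ, y (τ + 1) = act A (y τ) + act B (v τ) + ζ τ

/-- Objective of the predictive control problem started at time `t` with horizon `ℓ`. -/
def objective {N : ℕ} {S : Network N} (Q : Costs S) (t ℓ : ℕ) (F : Vec S.nx → ℝ)
    (y : ℕ → Vec S.nx) (v : ℕ → Vec S.nu) : ℝ :=
  (∑ τ ∈ Finset.range ℓ, Q.fSum (t + τ) (y τ)) +
    (∑ τ ∈ Finset.range ℓ, Q.cSum (t + τ + 1) (v τ)) + F (y ℓ)

/-- `(y,v)` solves the finite-horizon optimal control problem from time `t` with horizon `ℓ`,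
dynamics `(A,B)`, initial state `x`, disturbances `ζ` and terminal cost `F`. -/
def IsSolution {N : ℕ} {S : Network N} (Q : Costs S)
    (A : Matrix (Idx S.nx) (Idx S.nx) ℝ) (B : Matrix (Idx S.nx) (Idx S.nu) ℝ)
    (t ℓ : ℕ) (x : Vec S.nx) (ζ : ℕ → Vec S.nx) (F : Vec S.nx → ℝ)
    (y : ℕ → Vec S.nx) (v : ℕ → Vec S.nu) : Prop :=
  Feasible A B ℓ x ζ y v ∧
    ∀ y' v', Feasible A B ℓ x ζ y' v' → objective Q t ℓ F y v ≤ objective Q t ℓ F y' v'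

/-- `(y,v)` solves the problem truncated to the `κ`-hop neighbourhood of node `i`. -/
def IsLocalSolution {N : ℕ} {S : Network N} (Q : Costs S) (i : Fin N) (κ t ℓ : ℕ)
    (x : Vec S.nx) (ζ : ℕ → Vec S.nx) (F : Vec S.nx → ℝ)
    (y : ℕ → Vec S.nx) (v : ℕ → Vec S.nu) : Prop :=
  IsSolution Q (truncMat S.graph i κ S.A) (truncMat S.graph i κ S.B) t ℓ
    (truncVec S.graph i κ x) (fun τ => truncVec S.graph i κ (ζ τ)) F y v

/-- `(y,v)` solves the centralized problem with prescribed terminal state `z`. -/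
def IsTerminalSolution {N : ℕ} {S : Network N} (Q : Costs S) (t ℓ : ℕ)
    (x : Vec S.nx) (ζ : ℕ → Vec S.nx) (z : Vec S.nx)
    (y : ℕ → Vec S.nx) (v : ℕ → Vec S.nu) : Prop :=
  Feasible S.A S.B ℓ x ζ y v ∧ y ℓ = z ∧
    ∀ y' v', Feasible S.A S.B ℓ x ζ y' v' → y' ℓ = z →
      objective Q t ℓ (Q.fSum (t + ℓ)) y v ≤ objective Q t ℓ (Q.fSum (t + ℓ)) y' v'

/-- `(x,u)` is the closed-loop trajectory over `0,…,T` from `x₀` under distributed truncated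
predictive control with prediction horizon `k`, truncation radius `κ` and exact forecasts. -/
def IsDTPCTrajectory {N : ℕ} {S : Network N} (Q : Costs S) (F : Vec S.nx → ℝ)
    (w : ℕ → Vec S.nx) (T k κ : ℕ) (x₀ : Vec S.nx)
    (x : ℕ → Vec S.nx) (u : ℕ → Vec S.nu) : Prop :=
  Feasible S.A S.B T x₀ w x u ∧
    ∀ t < T, ∀ i, ∃ y v,
      (if t + k < T then IsLocalSolution Q i κ t k (x t) (fun τ => w (t + τ)) F y v
        else IsLocalSolution Q i κ t (T - t) (x t) (fun τ => w (t + τ)) (Q.fSum T) y v) ∧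
      block (u t) i = block (v 0) i

/-- `(x,u)` is the offline optimal trajectory over `0,…,T` from `x₀`. -/
def IsOfflineOptimal {N : ℕ} {S : Network N} (Q : Costs S)
    (w : ℕ → Vec S.nx) (T : ℕ) (x₀ : Vec S.nx)
    (x : ℕ → Vec S.nx) (u : ℕ → Vec S.nu) : Prop :=
  IsSolution Q S.A S.B 0 T x₀ w (Q.fSum T) x u

/-- Total cost `∑_{t=0}^{T} f_t(x_t) + ∑_{t=0}^{T-1} c_{t+1}(u_t)` of a trajectory. -/
def cost {N : ℕ} {S : Network N} (Q : Costs S) (T : ℕ)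
    (x : ℕ → Vec S.nx) (u : ℕ → Vec S.nu) : ℝ :=
  (∑ t ∈ Finset.range (T + 1), Q.fSum t (x t)) + ∑ t ∈ Finset.range T, Q.cSum (t + 1) (u t)

/-- Exponentially decaying Lipschitz dependence of the solutions of the problems with
prescribed terminal state on the initial state, the terminal state and the disturbances. -/
def TemporalDecay {N : ℕ} {S : Network N} (Q : Costs S) (T d : ℕ) (Ω δT : ℝ) : Prop :=
  ∀ (t k : ℕ), d ≤ k → t + k ≤ T →
    ∀ (x x' z z' : Vec S.nx) (ζ ζ' : ℕ → Vec S.nx) (y y' : ℕ → Vec S.nx)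
      (v v' : ℕ → Vec S.nu),
      IsTerminalSolution Q t k x ζ z y v → IsTerminalSolution Q t k x' ζ' z' y' v' →
      ∀ m ≤ k, ‖y m - y' m‖ ≤ Ω * (δT ^ m * ‖x - x'‖ + δT ^ (k - m) * ‖z - z'‖ +
        ∑ l ∈ Finset.range k, δT ^ ((m : ℤ) - (l : ℤ)).natAbs * ‖ζ l - ζ' l‖)

/-- Lower bound `μ_J` for the constraint Jacobian. -/
def muJ (L γ : ℝ) : ℝ := (1 - γ) ^ 2 / (L ^ 2 * (1 + L) ^ 2)

/-- Upper bound `L_H` on the singular values of the KKT matrix. -/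
def LH (L : ℝ) : ℝ := 2 * L + 1

/-- Lower bound `μ_H` on the singular values of the KKT matrix. -/
def muH (L μ γ : ℝ) : ℝ :=
  (1 / μ + (1 + 2 * LH L / μ + LH L ^ 2 / μ ^ 2) * (LH L / muJ L γ))⁻¹

/-- The rate `ρ`. -/
def rho (L μ γ : ℝ) : ℝ :=
  Real.sqrt ((LH L ^ 2 - muH L μ γ ^ 2) / (LH L ^ 2 + muH L μ γ ^ 2))

/-- The constant `α`. -/
def alpha (L μ γ : ℝ) : ℝ := LH L / (muH L μ γ ^ 2 * rho L μ γ)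

/-- The spatial decay rate `δ_S`. -/
def deltaS (L μ γ : ℝ) : ℝ := (rho L μ γ + 1) / 2

/-- The spatial decay constant `Γ`. -/
def Gam (L μ γ : ℝ) (p : ℕ → ℝ) : ℝ :=
  4 * alpha L μ γ ^ 2 * deltaS L μ γ * L / (1 - deltaS L μ γ) ^ 2 *
    (⨆ r : ℕ, (rho L μ γ / deltaS L μ γ) ^ r * p r) ^ 2 * p 1

end DTPC

end

noncomputable section

namespace DTPC

section Energy

variable {E U : Type} [NormedAddCommGroup E] [InnerProductSpace ℝ E] [CompleteSpace E]
  [NormedAddCommGroup U] [InnerProductSpace ℝ U] [CompleteSpace U]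

/-- Summation by parts: the pairing of a costate with the dynamics of a trajectory. -/
theorem sum_costate_pairing (A : E →L[ℝ] E) (B : U →L[ℝ] E) (h : ℕ) (y p : ℕ → E) (v : ℕ → U) :
    ∑ τ ∈ Finset.range h, inner ℝ (p τ) (y (τ + 1) - A (y τ) - B (v τ)) =
      ∑ τ ∈ Finset.range h, (inner ℝ (p τ - A.adjoint (p (τ + 1))) (y (τ + 1))
        - inner ℝ (B.adjoint (p τ)) (v τ)) + (inner ℝ (p h) (A (y h)) - inner ℝ (p 0) (A (y 0))) := by
  rw [← Finset.sum_range_sub (fun τ => inner ℝ (p τ) (A (y τ))) h, ← Finset.sum_add_distrib]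
  refine Finset.sum_congr rfl fun τ _ => ?_
  simp only [inner_sub_left, inner_sub_right, ContinuousLinearMap.adjoint_inner_left]
  ring

/-- The defect of the homogeneous costate recursion; with a prescribed terminal state
(`con = true`) the terminal stationarity condition is absent. -/
def costateDefect (A : E →L[ℝ] E) (con : Bool) (h : ℕ) (p : ℕ → E) (τ : ℕ) : E :=
  if con = true ∧ τ + 1 = h then 0 else p τ - A.adjoint (p (τ + 1))

/-- Coercivity of the adjoint of the dynamics constraint. -/
def DualBound (A : E →L[ℝ] E) (B : U →L[ℝ] E) (con : Bool) (h : ℕ) (M : ℝ) : Prop :=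
  ∀ p : ℕ → E, p h = 0 → ∑ τ ∈ Finset.range h, ‖p τ‖ ^ 2 ≤
    M * ∑ τ ∈ Finset.range h, (‖costateDefect A con h p τ‖ ^ 2 + ‖B.adjoint (p τ)‖ ^ 2)

theorem inner_costateDefect {A : E →L[ℝ] E} {con : Bool} {h : ℕ} {y : ℕ → E}
    (hy : con = true → y h = 0) (p : ℕ → E) (τ : ℕ) :
    inner ℝ (costateDefect A con h p τ) (y (τ + 1)) =
      inner ℝ (p τ - A.adjoint (p (τ + 1))) (y (τ + 1)) := by
  unfold costateDefect
  split_ifs with hc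
  · rw [hc.2, hy hc.1]; simp
  · rfl

theorem sum_succ_le_of_zero {f : ℕ → ℝ} {h : ℕ} (h0 : ∀ τ, 0 ≤ f τ) (hh : f h = 0) :
    ∑ τ ∈ Finset.range h, f (τ + 1) ≤ ∑ τ ∈ Finset.range h, f τ := by
  have h1 := Finset.sum_range_succ f h
  have h2 := Finset.sum_range_succ' f h
  linarith [h0 0]

theorem sum_le_succ_of_zero {f : ℕ → ℝ} {h : ℕ} (h0 : ∀ τ, 0 ≤ f τ) (hh : f 0 = 0) :
    ∑ τ ∈ Finset.range h, f τ ≤ ∑ τ ∈ Finset.range h, f (τ + 1) := by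
  have h1 := Finset.sum_range_succ f h
  have h2 := Finset.sum_range_succ' f h
  linarith [h0 h]

end Energy

theorem sq_le_three_mul_sq_add {a x y z : ℝ} (ha : 0 ≤ a) (hle : a ≤ x + y + z) :
    a ^ 2 ≤ 3 * x ^ 2 + 3 * y ^ 2 + 3 * z ^ 2 := by
  nlinarith [sq_nonneg (x - y), sq_nonneg (y - z), sq_nonneg (x - z)]

theorem mul_le_half_sq_add {ε : ℝ} (hε : 0 ≤ ε) (a b : ℝ) :
    ε * (a * b) ≤ ε / 2 * (a ^ 2 + b ^ 2) := by
  nlinarith [sq_nonneg (a - b), mul_nonneg hε (sq_nonneg (a - b))]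

theorem mul_le_quarter_sq_add {μ : ℝ} (hμ : 0 < μ) (a b : ℝ) :
    a * b ≤ μ / 4 * b ^ 2 + a ^ 2 * (1 / μ) := by
  have : μ / 4 * b ^ 2 + a ^ 2 * (1 / μ) - a * b = (μ * b - 2 * a) ^ 2 / (4 * μ) := by
    field_simp; ring
  have : 0 ≤ (μ * b - 2 * a) ^ 2 / (4 * μ) := by positivity
  linarith

set_option maxHeartbeats 1000000 in
/-- Energy estimate for perturbed optimality systems with strongly monotone gradients. -/
theorem exists_energy_estimate (L μ M : ℝ) (hμ : 0 < μ) (hM : 0 < M) :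
    ∃ ε C : ℝ, 0 < ε ∧ 0 < C ∧ ∀ {E U : Type} [NormedAddCommGroup E] [InnerProductSpace ℝ E]
      [CompleteSpace E] [NormedAddCommGroup U] [InnerProductSpace ℝ U] [CompleteSpace U]
      (A : E →L[ℝ] E) (B : U →L[ℝ] E) (con : Bool) (h : ℕ) (y p g : ℕ → E) (v q : ℕ → U)
      (R α β : ℕ → ℝ),
      DualBound A B con h M →
      y 0 = 0 → (con = true → y h = 0) → p h = 0 →
      (∀ τ < h, ‖y (τ + 1) - A (y τ) - B (v τ)‖ ≤ ε * (‖y τ‖ + ‖v τ‖) + R τ) →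
      (∀ τ < h, ‖g τ + costateDefect A con h p τ‖ ≤ ε * ‖p (τ + 1)‖ + α τ) →
      (∀ τ < h, ‖q τ - B.adjoint (p τ)‖ ≤ ε * ‖p τ‖ + β τ) →
      (∀ τ < h, μ * ‖y (τ + 1)‖ ^ 2 ≤ inner ℝ (g τ) (y (τ + 1))) →
      (∀ τ < h, ‖g τ‖ ≤ L * ‖y (τ + 1)‖) →
      (∀ τ < h, μ * ‖v τ‖ ^ 2 ≤ inner ℝ (q τ) (v τ)) →
      (∀ τ < h, ‖q τ‖ ≤ L * ‖v τ‖) →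
      ∑ τ ∈ Finset.range h, (‖y (τ + 1)‖ ^ 2 + ‖v τ‖ ^ 2 + ‖p τ‖ ^ 2) ≤
        C * ∑ τ ∈ Finset.range h, (R τ ^ 2 + α τ ^ 2 + β τ ^ 2) := by
  set ε : ℝ := min (μ / (8 + 72 * M * L ^ 2)) (1 / (12 * M + 1)) with hε
  have hε0 : 0 < ε := by positivity
  have hε1 : ε * (8 + 72 * M * L ^ 2) ≤ μ := by
    have : ε ≤ μ / (8 + 72 * M * L ^ 2) := min_le_left _ _
    rwa [le_div_iff₀ (by positivity)] at this
  have hε2 : ε * (12 * M + 1) ≤ 1 := by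
    have : ε ≤ 1 / (12 * M + 1) := min_le_right _ _
    rwa [le_div_iff₀ (by positivity)] at this
  have hε3 : 12 * M * ε ^ 2 ≤ 1 := by
    have h1 : ε ≤ 1 := by nlinarith
    nlinarith
  clear_value ε
  set CS : ℝ := 2 / μ * (18 * ε * M + 1 / μ * 2 + 1 / ε) with hCS
  have hCS0 : 0 < CS := by positivity
  clear_value CS
  refine ⟨ε, CS + 6 * M * (L ^ 2 * CS + 1), hε0, by positivity, ?_⟩
  intro E U _ _ _ _ _ _ A B con h y p g v q R α β hdual hy0 hyh hph hdyn hg hq hmg hLg hmq hLq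
  set S := ∑ τ ∈ Finset.range h, (‖y (τ + 1)‖ ^ 2 + ‖v τ‖ ^ 2) with hS
  set P := ∑ τ ∈ Finset.range h, ‖p τ‖ ^ 2 with hP
  set Z := ∑ τ ∈ Finset.range h, (R τ ^ 2 + α τ ^ 2 + β τ ^ 2) with hZ
  have hS0 : 0 ≤ S := by positivity
  have hP0 : 0 ≤ P := by positivity
  have hZ0 : 0 ≤ Z := by positivity
  have hpshift : ∑ τ ∈ Finset.range h, ‖p (τ + 1)‖ ^ 2 ≤ P :=
    sum_succ_le_of_zero (f := fun τ => ‖p τ‖ ^ 2) (fun _ => by positivity) (by simp [hph])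
  have hyshift : ∑ τ ∈ Finset.range h, ‖y τ‖ ^ 2 ≤ ∑ τ ∈ Finset.range h, ‖y (τ + 1)‖ ^ 2 :=
    sum_le_succ_of_zero (f := fun τ => ‖y τ‖ ^ 2) (fun _ => by positivity) (by simp [hy0])
  have hP1 : P ≤ 6 * M * (L ^ 2 * S + Z) := by
    have h1 : ∑ τ ∈ Finset.range h, (‖costateDefect A con h p τ‖ ^ 2 + ‖B.adjoint (p τ)‖ ^ 2) ≤
        ∑ τ ∈ Finset.range h, (3 * L ^ 2 * (‖y (τ + 1)‖ ^ 2 + ‖v τ‖ ^ 2) +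
          3 * ε ^ 2 * (‖p (τ + 1)‖ ^ 2 + ‖p τ‖ ^ 2) + 3 * (R τ ^ 2 + α τ ^ 2 + β τ ^ 2)) := by
      refine Finset.sum_le_sum fun τ hτ => ?_
      have hτ := Finset.mem_range.1 hτ
      have e1 : ‖costateDefect A con h p τ‖ ≤ L * ‖y (τ + 1)‖ + ε * ‖p (τ + 1)‖ + α τ := by
        have := norm_sub_le (g τ + costateDefect A con h p τ) (g τ)
        rw [add_sub_cancel_left] at this
        linarith [hg τ hτ, hLg τ hτ]
      have e2 : ‖B.adjoint (p τ)‖ ≤ L * ‖v τ‖ + ε * ‖p τ‖ + β τ := by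
        have := norm_sub_le (q τ) (q τ - B.adjoint (p τ))
        rw [sub_sub_cancel] at this
        linarith [hq τ hτ, hLq τ hτ]
      have f1 := sq_le_three_mul_sq_add (norm_nonneg _) e1
      have f2 := sq_le_three_mul_sq_add (norm_nonneg _) e2
      simp only [mul_pow] at f1 f2
      linarith [sq_nonneg (R τ)]
    have h2 := hdual p hph
    have h3 : ∑ τ ∈ Finset.range h, (3 * L ^ 2 * (‖y (τ + 1)‖ ^ 2 + ‖v τ‖ ^ 2) +
          3 * ε ^ 2 * (‖p (τ + 1)‖ ^ 2 + ‖p τ‖ ^ 2) + 3 * (R τ ^ 2 + α τ ^ 2 + β τ ^ 2)) =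
        3 * L ^ 2 * S + 3 * ε ^ 2 * (∑ τ ∈ Finset.range h, ‖p (τ + 1)‖ ^ 2 + P) + 3 * Z := by
      rw [Finset.sum_add_distrib, Finset.sum_add_distrib, ← Finset.mul_sum, ← Finset.mul_sum,
        ← Finset.mul_sum, Finset.sum_add_distrib (f := fun τ => ‖p (τ + 1)‖ ^ 2)]
    have h4 : P ≤ M * (3 * L ^ 2 * S + 3 * ε ^ 2 * (P + P) + 3 * Z) := by
      refine h2.trans (mul_le_mul_of_nonneg_left (h1.trans ?_) hM.le)
      rw [h3]
      have := mul_le_mul_of_nonneg_left hpshift (by positivity : 0 ≤ 3 * ε ^ 2)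
      linarith
    have h5 : 6 * M * ε ^ 2 * P ≤ P / 2 := by nlinarith
    linarith
  have hS1 : μ * S ≤ 2 * ε * (P + S) + μ / 4 * S + ε * P + Z * (1 / μ * 2 + 1 / ε) := by
    have hpair := sum_costate_pairing A B h y p v
    rw [hph, hy0] at hpair
    simp only [inner_zero_left, map_zero, inner_zero_right, sub_zero, add_zero] at hpair
    have h1 : ∑ τ ∈ Finset.range h, (μ * (‖y (τ + 1)‖ ^ 2 + ‖v τ‖ ^ 2) +
        (inner ℝ (p τ - A.adjoint (p (τ + 1))) (y (τ + 1)) - inner ℝ (B.adjoint (p τ)) (v τ))) ≤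
        ∑ τ ∈ Finset.range h, (ε / 2 * (‖p (τ + 1)‖ ^ 2 + ‖y (τ + 1)‖ ^ 2) +
          ε / 2 * (‖p τ‖ ^ 2 + ‖v τ‖ ^ 2) + μ / 4 * (‖y (τ + 1)‖ ^ 2 + ‖v τ‖ ^ 2) +
          (R τ ^ 2 + α τ ^ 2 + β τ ^ 2) * (1 / μ)) := by
      refine Finset.sum_le_sum fun τ hτ => ?_
      have hτ := Finset.mem_range.1 hτ
      have e1 : inner ℝ (g τ) (y (τ + 1)) + inner ℝ (p τ - A.adjoint (p (τ + 1))) (y (τ + 1)) ≤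
          (ε * ‖p (τ + 1)‖ + α τ) * ‖y (τ + 1)‖ := by
        rw [← inner_costateDefect hyh, ← inner_add_left]
        exact (real_inner_le_norm _ _).trans
          (mul_le_mul_of_nonneg_right (hg τ hτ) (norm_nonneg _))
      have e2 : inner ℝ (q τ) (v τ) - inner ℝ (B.adjoint (p τ)) (v τ) ≤
          (ε * ‖p τ‖ + β τ) * ‖v τ‖ := by
        rw [← inner_sub_left]
        exact (real_inner_le_norm _ _).trans
          (mul_le_mul_of_nonneg_right (hq τ hτ) (norm_nonneg _))
      have a1 := mul_le_quarter_sq_add hμ (α τ) ‖y (τ + 1)‖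
      have a2 := mul_le_quarter_sq_add hμ (β τ) ‖v τ‖
      have a3 := mul_le_half_sq_add hε0.le ‖p (τ + 1)‖ ‖y (τ + 1)‖
      have a4 := mul_le_half_sq_add hε0.le ‖p τ‖ ‖v τ‖
      have a5 : 0 ≤ R τ ^ 2 * (1 / μ) := by positivity
      linarith [hmg τ hτ, hmq τ hτ]
    have h2 : -∑ τ ∈ Finset.range h, inner ℝ (p τ) (y (τ + 1) - A (y τ) - B (v τ)) ≤
        ∑ τ ∈ Finset.range h, (ε / 2 * (‖p τ‖ ^ 2 + ‖y τ‖ ^ 2) + ε / 2 * (‖p τ‖ ^ 2 + ‖v τ‖ ^ 2)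
          + ε * ‖p τ‖ ^ 2 + (R τ ^ 2 + α τ ^ 2 + β τ ^ 2) * (1 / ε)) := by
      rw [← Finset.sum_neg_distrib]
      refine Finset.sum_le_sum fun τ hτ => ?_
      have hτ := Finset.mem_range.1 hτ
      have e1 : -inner ℝ (p τ) (y (τ + 1) - A (y τ) - B (v τ)) ≤
          ‖p τ‖ * (ε * (‖y τ‖ + ‖v τ‖) + R τ) := by
        rw [← inner_neg_right]
        refine (real_inner_le_norm _ _).trans ?_
        rw [norm_neg]
        exact mul_le_mul_of_nonneg_left (hdyn τ hτ) (norm_nonneg _)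
      have a3 := mul_le_half_sq_add hε0.le ‖p τ‖ ‖y τ‖
      have a4 := mul_le_half_sq_add hε0.le ‖p τ‖ ‖v τ‖
      have a5 := mul_le_quarter_sq_add hε0 (R τ) ‖p τ‖
      have a7 : 0 ≤ ε * ‖p τ‖ ^ 2 := by positivity
      have a6 : 0 ≤ (α τ ^ 2 + β τ ^ 2) * (1 / ε) := by positivity
      linarith
    have h3 := add_le_add h1 h2
    rw [hpair] at h3
    simp only [Finset.sum_add_distrib, ← Finset.mul_sum, ← Finset.sum_mul] at h3 hS hZ hpshift hyshift
    rw [← hP] at h3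
    have hSy : ∑ τ ∈ Finset.range h, ‖v τ‖ ^ 2 = S - ∑ τ ∈ Finset.range h, ‖y (τ + 1)‖ ^ 2 := by
      linarith
    rw [hSy, ← hZ] at h3
    have b1 := mul_le_mul_of_nonneg_left hpshift (by positivity : 0 ≤ ε / 2)
    have b2 := mul_le_mul_of_nonneg_left hyshift (by positivity : 0 ≤ ε / 2)
    have b3 : 0 ≤ Z * (1 / μ) := by positivity
    have b4 : 0 ≤ ε * P := by positivity
    have b5 : 0 ≤ ε * S := by positivity
    linarith
  have hS2 : S ≤ CS * Z := by
    have h1 : μ / 2 * S ≤ (18 * ε * M + 1 / μ * 2 + 1 / ε) * Z := by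
      have h2 := mul_le_mul_of_nonneg_left hP1 (by positivity : 0 ≤ 3 * ε)
      have h3 : (2 * ε + 18 * ε * M * L ^ 2) * S ≤ μ / 4 * S :=
        mul_le_mul_of_nonneg_right (by linarith) hS0
      linarith
    have h4 : S = 2 / μ * (μ / 2 * S) := by field_simp
    rw [h4, hCS, mul_assoc]
    exact mul_le_mul_of_nonneg_left h1 (by positivity)
  have hsplit : ∑ τ ∈ Finset.range h, (‖y (τ + 1)‖ ^ 2 + ‖v τ‖ ^ 2 + ‖p τ‖ ^ 2) = S + P := by
    rw [hS, hP, ← Finset.sum_add_distrib]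
  rw [hsplit]
  have h5 : L ^ 2 * S ≤ L ^ 2 * (CS * Z) := mul_le_mul_of_nonneg_left hS2 (by positivity)
  have h6 : 6 * M * (L ^ 2 * S + Z) ≤ 6 * M * (L ^ 2 * (CS * Z) + Z) :=
    mul_le_mul_of_nonneg_left (by linarith) (by positivity)
  linarith

/-- Weights in time vary slowly. -/
structure SlowWeight (η : ℝ) (ω : ℕ → ℝ) : Prop where
  pos : ∀ τ, 0 < ω τ
  left : ∀ τ, |ω (τ + 1) - ω τ| ≤ η * ω τ
  right : ∀ τ, |ω (τ + 1) - ω τ| ≤ η * ω (τ + 1)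

/-- The weights `D₁, D₂` commute with the operator `A` up to `η`. -/
def AlmostCommute {E F : Type} [NormedAddCommGroup E] [InnerProductSpace ℝ E]
    [NormedAddCommGroup F] [InnerProductSpace ℝ F] (η : ℝ) (D₁ : E →L[ℝ] E) (D₂ : F →L[ℝ] F)
    (A : E →L[ℝ] F) : Prop :=
  ∀ z, ‖D₂ (A z) - A (D₁ z)‖ ≤ η * ‖D₁ z‖

theorem AlmostCommute.norm_smul_sub_le {E F : Type} [NormedAddCommGroup E] [InnerProductSpace ℝ E]
    [NormedAddCommGroup F] [InnerProductSpace ℝ F] {η L : ℝ} {D₁ : E →L[ℝ] E} {D₂ : F →L[ℝ] F}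
    {A : E →L[ℝ] F} (hA : AlmostCommute η D₁ D₂ A) (hη0 : 0 ≤ η) (hη1 : η ≤ 1) (hL : ‖A‖ ≤ L)
    {a b : ℝ} (hb : 0 < b) (ha : 0 < a) (hab : |a - b| ≤ η * b) (z : E) :
    ‖a • D₂ (A z) - A (b • D₁ z)‖ ≤ η * (2 + L) * ‖b • D₁ z‖ := by
  have h1 : a • D₂ (A z) - A (b • D₁ z) = a • (D₂ (A z) - A (D₁ z)) + (a - b) • A (D₁ z) := by
    rw [map_smul, smul_sub, sub_smul]; abel
  have h2 : ‖A (D₁ z)‖ ≤ L * ‖D₁ z‖ :=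
    (A.le_opNorm _).trans (mul_le_mul_of_nonneg_right hL (norm_nonneg _))
  have h3 : a ≤ 2 * b := by
    have := (abs_le.1 hab).2
    nlinarith
  have hL0 : 0 ≤ L := (norm_nonneg _).trans hL
  have h4 : a * ‖D₂ (A z) - A (D₁ z)‖ ≤ 2 * b * (η * ‖D₁ z‖) :=
    mul_le_mul h3 (hA z) (norm_nonneg _) (by positivity)
  have h5 : |a - b| * ‖A (D₁ z)‖ ≤ η * b * (L * ‖D₁ z‖) :=
    mul_le_mul hab h2 (norm_nonneg _) (by positivity)
  calc ‖a • D₂ (A z) - A (b • D₁ z)‖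
      ≤ a * ‖D₂ (A z) - A (D₁ z)‖ + |a - b| * ‖A (D₁ z)‖ := by
        rw [h1]
        refine (norm_add_le _ _).trans ?_
        rw [norm_smul, norm_smul, Real.norm_eq_abs, Real.norm_eq_abs, abs_of_pos ha]
    _ ≤ η * (2 + L) * ‖b • D₁ z‖ := by
        rw [norm_smul, Real.norm_eq_abs, abs_of_pos hb]
        linarith

/-- Weighted energy estimate for differences of solutions of optimality systems. -/
theorem exists_weighted_estimate (L μ M : ℝ) (hL : 0 ≤ L) (hμ : 0 < μ) (hM : 0 < M) :
    ∃ η C : ℝ, 0 < η ∧ η ≤ 1 ∧ 0 < C ∧ ∀ {E U : Type} [NormedAddCommGroup E]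
      [InnerProductSpace ℝ E] [CompleteSpace E] [NormedAddCommGroup U] [InnerProductSpace ℝ U]
      [CompleteSpace U] (A : E →L[ℝ] E) (B : U →L[ℝ] E) (con : Bool) (h : ℕ)
      (DE : E →L[ℝ] E) (DU : U →L[ℝ] U) (ω : ℕ → ℝ) (y p g r α : ℕ → E) (v q s : ℕ → U),
      DualBound A B con h M → ‖A‖ ≤ L → ‖B‖ ≤ L → SlowWeight η ω →
      AlmostCommute η DE DE A → AlmostCommute η DU DE B →
      AlmostCommute η DE DE A.adjoint → AlmostCommute η DE DU B.adjoint →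
      y 0 = 0 → (con = true → y h = 0) → p h = 0 →
      (∀ τ < h, y (τ + 1) = A (y τ) + B (v τ) + r τ) →
      (∀ τ < h, g τ + costateDefect A con h p τ = α τ) →
      (∀ τ < h, q τ = B.adjoint (p τ) + s τ) →
      (∀ τ < h, μ * ‖DE (y (τ + 1))‖ ^ 2 ≤ inner ℝ (DE (g τ)) (DE (y (τ + 1)))) →
      (∀ τ < h, ‖DE (g τ)‖ ≤ L * ‖DE (y (τ + 1))‖) →
      (∀ τ < h, μ * ‖DU (v τ)‖ ^ 2 ≤ inner ℝ (DU (q τ)) (DU (v τ))) →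
      (∀ τ < h, ‖DU (q τ)‖ ≤ L * ‖DU (v τ)‖) →
      ∑ τ ∈ Finset.range h, ω (τ + 1) ^ 2 *
          (‖DE (y (τ + 1))‖ ^ 2 + ‖DU (v τ)‖ ^ 2 + ‖DE (p τ)‖ ^ 2) ≤
        C * ∑ τ ∈ Finset.range h, ω (τ + 1) ^ 2 *
          (‖DE (r τ)‖ ^ 2 + ‖DE (α τ)‖ ^ 2 + ‖DU (s τ)‖ ^ 2) := by
  obtain ⟨ε, C, hε, hC, key⟩ := exists_energy_estimate L μ M hμ hM
  refine ⟨min 1 (ε / (2 + L)), C, by positivity, min_le_left _ _, hC, ?_⟩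
  intro E U _ _ _ _ _ _ A B con h DE DU ω y p g r α v q s hdual hA hB hω cA cB cA' cB' hy0 hyh hph
    hdyn hg hq hmg hLg hmq hLq
  set η := min 1 (ε / (2 + L)) with hη
  have hη0 : 0 < η := by positivity
  have hη1 : η ≤ 1 := min_le_left _ _
  have hηε : η * (2 + L) ≤ ε := by
    have : η ≤ ε / (2 + L) := min_le_right _ _
    rwa [le_div_iff₀ (by positivity)] at this
  have nA : ‖A.adjoint‖ ≤ L := by rwa [LinearIsometryEquiv.norm_map]
  have nB : ‖B.adjoint‖ ≤ L := by rwa [LinearIsometryEquiv.norm_map]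
  have hs : ∀ {F : Type} [NormedAddCommGroup F] [InnerProductSpace ℝ F] (τ : ℕ) (z : F),
      ‖ω τ • z‖ = ω τ * ‖z‖ := fun τ z => by
    rw [norm_smul, Real.norm_eq_abs, abs_of_pos (hω.pos τ)]
  have hself : ∀ τ, |ω τ - ω τ| ≤ η * ω τ := fun τ => by
    rw [sub_self, abs_zero]; exact mul_nonneg hη0.le (hω.pos τ).le
  have main := key A B con h (fun τ => ω τ • DE (y τ)) (fun τ => ω (τ + 1) • DE (p τ))
    (fun τ => ω (τ + 1) • DE (g τ)) (fun τ => ω (τ + 1) • DU (v τ)) (fun τ => ω (τ + 1) • DU (q τ))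
    (fun τ => ω (τ + 1) * ‖DE (r τ)‖) (fun τ => ω (τ + 1) * ‖DE (α τ)‖)
    (fun τ => ω (τ + 1) * ‖DU (s τ)‖) hdual (by simp [hy0]) (fun hc => by simp [hyh hc])
    (by simp [hph]) ?_ ?_ ?_ ?_ ?_ ?_ ?_
  · refine (le_of_eq ?_).trans (main.trans (le_of_eq ?_))
    · refine Finset.sum_congr rfl fun τ _ => ?_
      simp only [hs]; ring
    · congr 1
      refine Finset.sum_congr rfl fun τ _ => ?_
      ring
  · intro τ hτ
    have e1 := cA.norm_smul_sub_le hη0.le hη1 hA (hω.pos τ) (hω.pos (τ + 1)) (hω.left τ) (y τ)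
    have e2 := cB.norm_smul_sub_le hη0.le hη1 hB (hω.pos (τ + 1)) (hω.pos (τ + 1)) (hself _) (v τ)
    have e3 : ω (τ + 1) • DE (y (τ + 1)) - A (ω τ • DE (y τ)) - B (ω (τ + 1) • DU (v τ)) =
        (ω (τ + 1) • DE (A (y τ)) - A (ω τ • DE (y τ))) +
        (ω (τ + 1) • DE (B (v τ)) - B (ω (τ + 1) • DU (v τ))) + ω (τ + 1) • DE (r τ) := by
      rw [hdyn τ hτ]; simp only [map_add, smul_add]; abel
    simp only [e3]
    refine norm_add₃_le.trans ?_
    rw [hs (τ + 1) (DE (r τ))]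
    have f1 := mul_le_mul_of_nonneg_right hηε (norm_nonneg (ω τ • DE (y τ)))
    have f2 := mul_le_mul_of_nonneg_right hηε (norm_nonneg (ω (τ + 1) • DU (v τ)))
    linarith
  · intro τ hτ
    have hα := hg τ hτ
    unfold costateDefect at hα ⊢
    split_ifs at hα ⊢ with hc
    · rw [add_zero] at hα ⊢
      rw [hα, hs]
      have := mul_nonneg hε.le (norm_nonneg (ω (τ + 1 + 1) • DE (p (τ + 1))))
      linarith
    · have e1 := cA'.norm_smul_sub_le hη0.le hη1 nA (hω.pos (τ + 2)) (hω.pos (τ + 1))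
        (by rw [abs_sub_comm]; exact hω.right (τ + 1)) (p (τ + 1))
      have e3 : ω (τ + 1) • DE (g τ) + (ω (τ + 1) • DE (p τ)
            - A.adjoint (ω (τ + 2) • DE (p (τ + 1)))) =
          (ω (τ + 1) • DE (A.adjoint (p (τ + 1))) - A.adjoint (ω (τ + 2) • DE (p (τ + 1)))) +
            ω (τ + 1) • DE (α τ) := by
        rw [← hα]; simp only [map_add, map_sub, smul_add, smul_sub]; abel
      refine (congrArg norm e3).le.trans ((norm_add_le _ _).trans ?_)
      rw [hs (τ + 1) (DE (α τ))]
      have f1 := mul_le_mul_of_nonneg_right hηε (norm_nonneg (ω (τ + 2) • DE (p (τ + 1))))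
      linarith
  · intro τ hτ
    have e1 := cB'.norm_smul_sub_le hη0.le hη1 nB (hω.pos (τ + 1)) (hω.pos (τ + 1)) (hself _) (p τ)
    have e3 : ω (τ + 1) • DU (q τ) - B.adjoint (ω (τ + 1) • DE (p τ)) =
        (ω (τ + 1) • DU (B.adjoint (p τ)) - B.adjoint (ω (τ + 1) • DE (p τ))) +
          ω (τ + 1) • DU (s τ) := by
      rw [hq τ hτ]; simp only [map_add, smul_add]; abel
    simp only [e3]
    refine (norm_add_le _ _).trans ?_
    rw [hs (τ + 1) (DU (s τ))]
    have f1 := mul_le_mul_of_nonneg_right hηε (norm_nonneg (ω (τ + 1) • DE (p τ)))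
    linarith
  · intro τ hτ
    simp only [hs, real_inner_smul_left, real_inner_smul_right]
    have := mul_le_mul_of_nonneg_left (hmg τ hτ) (sq_nonneg (ω (τ + 1)))
    linarith
  · intro τ hτ
    simp only [hs]
    have := mul_le_mul_of_nonneg_left (hLg τ hτ) (hω.pos (τ + 1)).le
    linarith
  · intro τ hτ
    simp only [hs, real_inner_smul_left, real_inner_smul_right]
    have := mul_le_mul_of_nonneg_left (hmq τ hτ) (sq_nonneg (ω (τ + 1)))
    linarith
  · intro τ hτ
    simp only [hs]
    have := mul_le_mul_of_nonneg_left (hLq τ hτ) (hω.pos (τ + 1)).le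
    linarith

section Dual

variable {E U : Type} [NormedAddCommGroup E] [InnerProductSpace ℝ E] [CompleteSpace E]
  [NormedAddCommGroup U] [InnerProductSpace ℝ U] [CompleteSpace U]

/-- Discrete Young inequality for geometric kernels. -/
theorem sum_sq_geom_le {γ : ℝ} (hγ0 : 0 ≤ γ) (hγ1 : γ < 1) (h : ℕ) (c : ℕ → ℝ) :
    ∑ τ ∈ Finset.range h, (∑ j ∈ Finset.range (h - τ), γ ^ j * c (τ + j)) ^ 2 ≤
      (1 / (1 - γ)) ^ 2 * ∑ τ ∈ Finset.range h, c τ ^ 2 := by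
  set n : ℕ → ℝ := fun τ => ∑ j ∈ Finset.range (h - τ), γ ^ j * c (τ + j) with hn
  have hrec : ∀ τ < h, n τ = c τ + γ * n (τ + 1) := by
    intro τ hτ
    have e : h - τ = (h - (τ + 1)) + 1 := by omega
    simp only [hn]
    rw [e, Finset.sum_range_succ', Finset.mul_sum, pow_zero, one_mul, add_zero, add_comm]
    congr 1
    refine Finset.sum_congr rfl fun j _ => ?_
    rw [pow_succ, show τ + (j + 1) = τ + 1 + j by ring]; ring
  have hh : n h = 0 := by simp [hn]
  have hg : 0 < 1 - γ := by linarith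
  have hpt : ∀ τ < h, n τ ^ 2 ≤ 1 / (1 - γ) * c τ ^ 2 + γ * n (τ + 1) ^ 2 := by
    intro τ hτ
    rw [hrec τ hτ]
    have : 1 / (1 - γ) * c τ ^ 2 + γ * n (τ + 1) ^ 2 - (c τ + γ * n (τ + 1)) ^ 2 =
        γ / (1 - γ) * (c τ - (1 - γ) * n (τ + 1)) ^ 2 := by
      field_simp; ring
    have : 0 ≤ γ / (1 - γ) * (c τ - (1 - γ) * n (τ + 1)) ^ 2 := by positivity
    linarith
  have h1 := Finset.sum_le_sum fun τ hτ => hpt τ (Finset.mem_range.1 hτ)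
  rw [Finset.sum_add_distrib, ← Finset.mul_sum, ← Finset.mul_sum] at h1
  have h2 := sum_succ_le_of_zero (f := fun τ => n τ ^ 2) (h := h) (fun _ => by positivity)
    (by simp [hh])
  have h3 := mul_le_mul_of_nonneg_left h2 hγ0
  have h4 : (1 - γ) * ∑ τ ∈ Finset.range h, n τ ^ 2 ≤
      1 / (1 - γ) * ∑ τ ∈ Finset.range h, c τ ^ 2 := by linarith
  calc ∑ τ ∈ Finset.range h, n τ ^ 2
      = 1 / (1 - γ) * ((1 - γ) * ∑ τ ∈ Finset.range h, n τ ^ 2) := by field_simp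
    _ ≤ 1 / (1 - γ) * (1 / (1 - γ) * ∑ τ ∈ Finset.range h, c τ ^ 2) :=
        mul_le_mul_of_nonneg_left h4 (by positivity)
    _ = _ := by ring

theorem dualBound_of_stabilizing {A : E →L[ℝ] E} {B : U →L[ℝ] E} {K : E →L[ℝ] U} {L γ : ℝ}
    (hγ0 : 0 ≤ γ) (hγ1 : γ < 1) (hK : ‖K‖ ≤ L)
    (hstab : ∀ t : ℕ, ‖(A - B ∘L K) ^ t‖ ≤ L * γ ^ t) (h : ℕ) :
    DualBound A B false h (2 * L ^ 2 * (1 + L ^ 2) * (1 / (1 - γ)) ^ 2) := by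
  intro p hp
  have hL0 : 0 ≤ L := (norm_nonneg _).trans hK
  set Φ := (A - B ∘L K).adjoint with hΦ
  have hΦn : ∀ t : ℕ, ‖Φ ^ t‖ ≤ L * γ ^ t := by
    intro t
    rw [hΦ, ← ContinuousLinearMap.star_eq_adjoint, ← star_pow, ContinuousLinearMap.star_eq_adjoint,
      LinearIsometryEquiv.norm_map]
    exact hstab t
  set c : ℕ → E := fun τ => p τ - A.adjoint (p (τ + 1)) + K.adjoint (B.adjoint (p (τ + 1))) with hc
  have hrec : ∀ τ, p τ = c τ + Φ (p (τ + 1)) := by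
    intro τ
    simp only [hc, hΦ, map_sub, ContinuousLinearMap.adjoint_comp,
      sub_apply, ContinuousLinearMap.comp_apply]
    abel
  have hexp : ∀ n τ, p τ = ∑ j ∈ Finset.range n, (Φ ^ j) (c (τ + j)) + (Φ ^ n) (p (τ + n)) := by
    intro n
    induction n with
    | zero => intro τ; simp
    | succ n ih =>
      intro τ
      rw [Finset.sum_range_succ, ih τ, hrec (τ + n), map_add, pow_succ]
      simp only [mul_apply_eq_comp]
      exact (add_assoc _ _ _).symm
  have hpn : ∀ τ < h, ‖p τ‖ ≤ L * ∑ j ∈ Finset.range (h - τ), γ ^ j * ‖c (τ + j)‖ := by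
    intro τ hτ
    have e := hexp (h - τ) τ
    rw [show τ + (h - τ) = h by omega, hp, map_zero, add_zero] at e
    rw [e, Finset.mul_sum]
    refine norm_sum_le_of_le _ fun j _ => ?_
    calc ‖(Φ ^ j) (c (τ + j))‖ ≤ ‖Φ ^ j‖ * ‖c (τ + j)‖ := ContinuousLinearMap.le_opNorm _ _
      _ ≤ L * γ ^ j * ‖c (τ + j)‖ := mul_le_mul_of_nonneg_right (hΦn j) (norm_nonneg _)
      _ = _ := by ring
  have h1 : ∑ τ ∈ Finset.range h, ‖p τ‖ ^ 2 ≤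
      L ^ 2 * ((1 / (1 - γ)) ^ 2 * ∑ τ ∈ Finset.range h, ‖c τ‖ ^ 2) := by
    refine le_trans ?_ (mul_le_mul_of_nonneg_left
      (sum_sq_geom_le hγ0 hγ1 h fun τ => ‖c τ‖) (sq_nonneg L))
    rw [Finset.mul_sum]
    refine Finset.sum_le_sum fun τ hτ => ?_
    rw [← mul_pow]
    exact pow_le_pow_left₀ (norm_nonneg _) (hpn τ (Finset.mem_range.1 hτ)) 2
  have h2 : ∑ τ ∈ Finset.range h, ‖c τ‖ ^ 2 ≤
      2 * (1 + L ^ 2) * ∑ τ ∈ Finset.range h,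
        (‖costateDefect A false h p τ‖ ^ 2 + ‖B.adjoint (p τ)‖ ^ 2) := by
    have hpt : ∀ τ, ‖c τ‖ ^ 2 ≤
        2 * ‖p τ - A.adjoint (p (τ + 1))‖ ^ 2 + 2 * L ^ 2 * ‖B.adjoint (p (τ + 1))‖ ^ 2 := by
      intro τ
      have e1 : ‖c τ‖ ≤ ‖p τ - A.adjoint (p (τ + 1))‖ + L * ‖B.adjoint (p (τ + 1))‖ := by
        refine (norm_add_le _ _).trans (add_le_add le_rfl ?_)
        refine (ContinuousLinearMap.le_opNorm _ _).trans
          (mul_le_mul_of_nonneg_right ?_ (norm_nonneg _))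
        rwa [LinearIsometryEquiv.norm_map]
      have e2 := pow_le_pow_left₀ (norm_nonneg _) e1 2
      nlinarith [sq_nonneg (‖p τ - A.adjoint (p (τ + 1))‖ - L * ‖B.adjoint (p (τ + 1))‖)]
    have hsh := sum_succ_le_of_zero (f := fun τ => ‖B.adjoint (p τ)‖ ^ 2) (h := h)
      (fun _ => by positivity) (by simp [hp])
    have h3 := Finset.sum_le_sum fun τ (_ : τ ∈ Finset.range h) => hpt τ
    rw [Finset.sum_add_distrib, ← Finset.mul_sum, ← Finset.mul_sum] at h3
    have h4 := mul_le_mul_of_nonneg_left hsh (by positivity : 0 ≤ 2 * L ^ 2)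
    simp only [costateDefect, Bool.false_eq_true, false_and, if_false]
    rw [Finset.sum_add_distrib]
    have h5 : 0 ≤ ∑ τ ∈ Finset.range h, ‖p τ - A.adjoint (p (τ + 1))‖ ^ 2 := by positivity
    have h6 : 0 ≤ ∑ τ ∈ Finset.range h, ‖B.adjoint (p τ)‖ ^ 2 := by positivity
    have h7 := mul_nonneg (sq_nonneg L) h5
    linarith
  refine h1.trans ?_
  have h3 := mul_le_mul_of_nonneg_left h2 (by positivity : 0 ≤ L ^ 2 * (1 / (1 - γ)) ^ 2)
  linarith

/-- Quantitative controllability in `d` steps, in dual form. -/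
def DualControllable (A : E →L[ℝ] E) (B : U →L[ℝ] E) (σ : ℝ) (d : ℕ) : Prop :=
  ∀ z : E, σ * ‖z‖ ≤ ∑ j ∈ Finset.range d, ‖B.adjoint ((A.adjoint ^ j) z)‖

/-- The constant of the dual bound for controllable systems. -/
def ctrlDualConst (L σ : ℝ) (d : ℕ) : ℝ :=
  2 * (((1 + d * L ^ d) / σ) ^ 2 * d * d
    + d * ((2 * L ^ 2 + 2) ^ d * (((1 + d * L ^ d) / σ) ^ 2 * d * d + 1)))

theorem dualBound_of_controllable {A : E →L[ℝ] E} {B : U →L[ℝ] E} {L σ : ℝ} {d : ℕ}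
    (hL : 1 ≤ L) (hA : ‖A‖ ≤ L) (hB : ‖B‖ ≤ L) (hσ : 0 < σ) (hd : 1 ≤ d)
    (hc : DualControllable A B σ d) {h : ℕ} (hh : d ≤ h) :
    DualBound A B true h (ctrlDualConst L σ d) := by
  intro p _
  have hL0 : 0 ≤ L := by linarith
  have nA : ‖A.adjoint‖ ≤ L := by rwa [LinearIsometryEquiv.norm_map]
  have nB : ‖B.adjoint‖ ≤ L := by rwa [LinearIsometryEquiv.norm_map]
  set e : ℕ → ℝ := fun τ => ‖costateDefect A true h p τ‖ + ‖B.adjoint (p τ)‖ with he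
  have he0 : ∀ τ, 0 ≤ e τ := fun τ => by positivity
  have hdef : ∀ τ, τ + 1 < h → ‖A.adjoint (p (τ + 1)) - p τ‖ ≤ e τ := by
    intro τ hτ
    have : costateDefect A true h p τ = p τ - A.adjoint (p (τ + 1)) := by
      rw [costateDefect, if_neg (by omega)]
    rw [norm_sub_rev, ← this]
    exact le_add_of_nonneg_right (norm_nonneg _)
  have hBe : ∀ τ, ‖B.adjoint (p τ)‖ ≤ e τ := fun τ => le_add_of_nonneg_left (norm_nonneg _)
  set S := ∑ τ ∈ Finset.range h, e τ ^ 2 with hS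
  have hS0 : 0 ≤ S := by positivity
  have hback : ∀ τ < h, ∀ j ≤ τ, ‖(A.adjoint ^ j) (p τ) - p (τ - j)‖ ≤
      L ^ j * ∑ i ∈ Finset.range j, e (τ - (i + 1)) := by
    intro τ hτ j
    induction j with
    | zero => intro _; simp
    | succ j ih =>
      intro hj
      have ih := ih (by omega)
      have e1 : (A.adjoint ^ (j + 1)) (p τ) - p (τ - (j + 1)) =
          A.adjoint ((A.adjoint ^ j) (p τ) - p (τ - j)) +
            (A.adjoint (p (τ - (j + 1) + 1)) - p (τ - (j + 1))) := by
        rw [pow_succ', mul_apply_eq_comp, map_sub,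
          show τ - (j + 1) + 1 = τ - j by omega]
        abel
      rw [e1, Finset.sum_range_succ, mul_add]
      refine (norm_add_le _ _).trans (add_le_add ?_ ?_)
      · refine (ContinuousLinearMap.le_opNorm _ _).trans ?_
        rw [pow_succ', mul_assoc]
        exact mul_le_mul nA ih (norm_nonneg _) hL0
      · refine (hdef _ (by omega)).trans ?_
        exact le_mul_of_one_le_left (he0 _) (one_le_pow₀ hL)
  set c1 := (1 + d * L ^ d) / σ with hc1
  have hc10 : 0 ≤ c1 := by positivity
  have hwin : ∀ τ < h, d ≤ τ + 1 → ‖p τ‖ ≤ c1 * ∑ i ∈ Finset.range d, e (τ - i) := by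
    intro τ hτ hdτ
    set W := ∑ i ∈ Finset.range d, e (τ - i) with hW
    have h1 : ∀ j < d, ‖B.adjoint ((A.adjoint ^ j) (p τ))‖ ≤ e (τ - j) + L ^ d * W := by
      intro j hj
      have e1 : B.adjoint ((A.adjoint ^ j) (p τ)) = B.adjoint (p (τ - j)) +
          B.adjoint ((A.adjoint ^ j) (p τ) - p (τ - j)) := by
        rw [← map_add]; congr 1; abel
      rw [e1]
      refine (norm_add_le _ _).trans (add_le_add (hBe _) ?_)
      refine (ContinuousLinearMap.le_opNorm _ _).trans ?_
      have h2 : ∑ i ∈ Finset.range j, e (τ - (i + 1)) ≤ W := by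
        have h3 : ∑ i ∈ Finset.range (j + 1), e (τ - i) ≤ W :=
          Finset.sum_le_sum_of_subset_of_nonneg
            (Finset.range_subset_range.2 (by omega)) fun _ _ _ => he0 _
        rw [Finset.sum_range_succ'] at h3
        linarith [he0 (τ - 0)]
      have h0 : 0 ≤ ∑ i ∈ Finset.range j, e (τ - (i + 1)) := Finset.sum_nonneg fun _ _ => he0 _
      calc ‖B.adjoint‖ * ‖(A.adjoint ^ j) (p τ) - p (τ - j)‖
          ≤ L * (L ^ j * ∑ i ∈ Finset.range j, e (τ - (i + 1))) :=
            mul_le_mul nB (hback τ hτ j (by omega)) (norm_nonneg _) hL0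
        _ = L ^ (j + 1) * ∑ i ∈ Finset.range j, e (τ - (i + 1)) := by ring
        _ ≤ L ^ d * W := mul_le_mul (pow_le_pow_right₀ hL (by omega)) h2 h0 (by positivity)
    have h2 : σ * ‖p τ‖ ≤ (1 + d * L ^ d) * W := by
      refine (hc (p τ)).trans ((Finset.sum_le_sum fun j hj => h1 j (Finset.mem_range.1 hj)).trans ?_)
      rw [Finset.sum_add_distrib, Finset.sum_const, Finset.card_range, nsmul_eq_mul, ← hW]
      linarith
    rw [hc1, div_mul_eq_mul_div, le_div_iff₀ hσ]
    linarith
  have hsumwin : ∑ τ ∈ Finset.Ico (d - 1) h, ‖p τ‖ ^ 2 ≤ c1 ^ 2 * d * d * S := by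
    have h1 : ∀ τ ∈ Finset.Ico (d - 1) h, ‖p τ‖ ^ 2 ≤
        c1 ^ 2 * d * ∑ i ∈ Finset.range d, e (τ - i) ^ 2 := by
      intro τ hτ
      have hτ := Finset.mem_Ico.1 hτ
      have h2 := pow_le_pow_left₀ (norm_nonneg _) (hwin τ hτ.2 (by omega)) 2
      have h3 := sq_sum_le_card_mul_sum_sq (s := Finset.range d) (f := fun i => e (τ - i))
      rw [Finset.card_range] at h3
      rw [mul_pow] at h2
      have h4 := mul_le_mul_of_nonneg_left h3 (sq_nonneg c1)
      linarith
    refine (Finset.sum_le_sum h1).trans ?_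
    rw [← Finset.mul_sum, Finset.sum_comm, mul_assoc (c1 ^ 2 * d)]
    refine mul_le_mul_of_nonneg_left ?_ (by positivity)
    have h2 : ∀ i ∈ Finset.range d, ∑ τ ∈ Finset.Ico (d - 1) h, e (τ - i) ^ 2 ≤ S := by
      intro i hi
      have hi := Finset.mem_range.1 hi
      rw [← Finset.sum_image (s := Finset.Ico (d - 1) h) (g := fun τ => τ - i)
        (f := fun τ => e τ ^ 2)]
      · refine Finset.sum_le_sum_of_subset_of_nonneg ?_ fun _ _ _ => sq_nonneg _
        intro τ hτ
        obtain ⟨a, ha, rfl⟩ := Finset.mem_image.1 hτ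
        have := Finset.mem_Ico.1 ha
        exact Finset.mem_range.2 (by omega)
      · intro a ha b hb hab
        have := Finset.mem_Ico.1 ha
        have := Finset.mem_Ico.1 hb
        simp only at hab
        omega
    refine (Finset.sum_le_sum h2).trans ?_
    simp
  have hlow : ∀ j ≤ d - 1, ‖p (d - 1 - j)‖ ^ 2 ≤ (2 * L ^ 2 + 2) ^ j * (c1 ^ 2 * d * d + 1) * S := by
    intro j
    induction j with
    | zero =>
      intro _
      rw [pow_zero, one_mul, Nat.sub_zero]
      have h1 : ‖p (d - 1)‖ ^ 2 ≤ ∑ τ ∈ Finset.Ico (d - 1) h, ‖p τ‖ ^ 2 :=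
        Finset.single_le_sum (f := fun τ => ‖p τ‖ ^ 2) (fun _ _ => sq_nonneg _)
          (Finset.mem_Ico.2 ⟨le_rfl, by omega⟩)
      linarith
    | succ j ih =>
      intro hj
      have ih := ih (by omega)
      set τ := d - 1 - (j + 1) with hτ
      rw [show d - 1 - j = τ + 1 by omega] at ih
      have h1 : ‖p τ‖ ≤ L * ‖p (τ + 1)‖ + e τ := by
        have e1 : p τ = A.adjoint (p (τ + 1)) - (A.adjoint (p (τ + 1)) - p τ) := by abel
        rw [e1]
        refine (norm_sub_le _ _).trans (add_le_add ?_ (hdef τ (by omega)))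
        exact (ContinuousLinearMap.le_opNorm _ _).trans
          (mul_le_mul_of_nonneg_right nA (norm_nonneg _))
      have h2 := pow_le_pow_left₀ (norm_nonneg _) h1 2
      have h3 : e τ ^ 2 ≤ S := Finset.single_le_sum (f := fun τ => e τ ^ 2)
        (fun _ _ => sq_nonneg _) (Finset.mem_range.2 (by omega))
      have h4 : ‖p τ‖ ^ 2 ≤ 2 * L ^ 2 * ‖p (τ + 1)‖ ^ 2 + 2 * e τ ^ 2 := by
        nlinarith [sq_nonneg (L * ‖p (τ + 1)‖ - e τ)]
      set Q := (2 * L ^ 2 + 2) ^ j * (c1 ^ 2 * d * d + 1) with hQ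
      have hQ1 : 1 ≤ Q := by
        have a1 : 1 ≤ (2 * L ^ 2 + 2) ^ j := one_le_pow₀ (by nlinarith)
        have a2 : 1 ≤ c1 ^ 2 * d * d + 1 := by
          have : 0 ≤ c1 ^ 2 * d * d := by positivity
          linarith
        exact one_le_mul_of_one_le_of_one_le a1 a2
      have h5 : S ≤ Q * S := le_mul_of_one_le_left hS0 hQ1
      have h6 := mul_le_mul_of_nonneg_left ih (by positivity : 0 ≤ 2 * L ^ 2)
      have h7 : (2 * L ^ 2 + 2) ^ (j + 1) * (c1 ^ 2 * d * d + 1) * S =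
          2 * L ^ 2 * (Q * S) + 2 * (Q * S) := by rw [hQ]; ring
      rw [h7]
      linarith
  have hsumlow : ∑ τ ∈ Finset.range (d - 1), ‖p τ‖ ^ 2 ≤
      d * ((2 * L ^ 2 + 2) ^ d * (c1 ^ 2 * d * d + 1)) * S := by
    have h1 : ∀ τ ∈ Finset.range (d - 1), ‖p τ‖ ^ 2 ≤
        (2 * L ^ 2 + 2) ^ d * (c1 ^ 2 * d * d + 1) * S := by
      intro τ hτ
      have hτ := Finset.mem_range.1 hτ
      have h2 := hlow (d - 1 - τ) (by omega)
      rw [show d - 1 - (d - 1 - τ) = τ by omega] at h2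
      refine h2.trans ?_
      gcongr
      · nlinarith
      · omega
    refine (Finset.sum_le_sum h1).trans ?_
    rw [Finset.sum_const, Finset.card_range, nsmul_eq_mul, mul_assoc (d : ℝ)]
    exact mul_le_mul_of_nonneg_right (by exact_mod_cast Nat.sub_le d 1) (by positivity)
  have hSle : S ≤ 2 * ∑ τ ∈ Finset.range h,
      (‖costateDefect A true h p τ‖ ^ 2 + ‖B.adjoint (p τ)‖ ^ 2) := by
    rw [hS, Finset.mul_sum]
    refine Finset.sum_le_sum fun τ _ => ?_
    simp only [he]
    nlinarith [sq_nonneg (‖costateDefect A true h p τ‖ - ‖B.adjoint (p τ)‖)]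
  have hsplit : ∑ τ ∈ Finset.range h, ‖p τ‖ ^ 2 =
      ∑ τ ∈ Finset.range (d - 1), ‖p τ‖ ^ 2 + ∑ τ ∈ Finset.Ico (d - 1) h, ‖p τ‖ ^ 2 :=
    (Finset.sum_range_add_sum_Ico _ (by omega)).symm
  rw [hsplit]
  have hfin : ∑ τ ∈ Finset.range (d - 1), ‖p τ‖ ^ 2 + ∑ τ ∈ Finset.Ico (d - 1) h, ‖p τ‖ ^ 2 ≤
      (c1 ^ 2 * d * d + d * ((2 * L ^ 2 + 2) ^ d * (c1 ^ 2 * d * d + 1))) * S := by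
    rw [add_mul]; linarith
  refine hfin.trans ?_
  have := mul_le_mul_of_nonneg_left hSle (by positivity :
    0 ≤ c1 ^ 2 * d * d + d * ((2 * L ^ 2 + 2) ^ d * (c1 ^ 2 * d * d + 1)))
  rw [ctrlDualConst, ← hc1]
  linarith

/-- With a free terminal state the dual bound holds for every horizon. -/
theorem DualBound.free_of_constrained {A : E →L[ℝ] E} {B : U →L[ℝ] E} {M : ℝ} {d h : ℕ}
    (hd : 1 ≤ d) (H : DualBound A B true (h + d) M) : DualBound A B false h M := by
  intro p hp
  have h1 := H (fun τ => if τ < h then p τ else 0) (by simp)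
  have hge : ∀ (f : ℕ → ℝ), (∀ τ, h ≤ τ → f τ = 0) →
      ∑ τ ∈ Finset.range (h + d), f τ = ∑ τ ∈ Finset.range h, f τ := by
    intro f hf
    rw [← Finset.sum_range_add_sum_Ico f (Nat.le_add_right h d),
      Finset.sum_eq_zero (s := Finset.Ico h (h + d)), add_zero]
    intro τ hτ
    exact hf τ (Finset.mem_Ico.1 hτ).1
  rw [hge, hge] at h1
  · refine (le_of_eq ?_).trans (h1.trans (le_of_eq ?_))
    · refine Finset.sum_congr rfl fun τ hτ => ?_
      rw [if_pos (Finset.mem_range.1 hτ)]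
    · congr 1
      refine Finset.sum_congr rfl fun τ hτ => ?_
      have hτ := Finset.mem_range.1 hτ
      have e1 : (if τ + 1 < h then p (τ + 1) else 0) = p (τ + 1) := by
        split_ifs with hc
        · rfl
        · rw [show τ + 1 = h by omega, hp]
      simp only [costateDefect, if_pos hτ, e1, Bool.false_eq_true, false_and, if_false]
      rw [if_neg (by omega)]
  · intro τ hτ
    have h2 : ¬ τ < h := by omega
    have h3 : ¬ τ + 1 < h := by omega
    simp [costateDefect, h2, h3]
  · intro τ hτ
    rw [if_neg (by omega)]; simp

theorem DualBound.mono {A : E →L[ℝ] E} {B : U →L[ℝ] E} {con : Bool} {M M' : ℝ} {h : ℕ}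
    (H : DualBound A B con h M) (hM : M ≤ M') : DualBound A B con h M' := fun p hp =>
  (H p hp).trans (mul_le_mul_of_nonneg_right hM (by positivity))

end Dual

section Response

variable {E U : Type} [NormedAddCommGroup E] [InnerProductSpace ℝ E]
  [NormedAddCommGroup U] [InnerProductSpace ℝ U]

/-- The trajectory from the origin driven by the inputs `v`. -/
def response (A : E →L[ℝ] E) (B : U →L[ℝ] E) (v : ℕ → U) : ℕ → E
  | 0 => 0
  | τ + 1 => A (response A B v τ) + B (v τ)

theorem response_add (A : E →L[ℝ] E) (B : U →L[ℝ] E) (v w : ℕ → U) (τ : ℕ) :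
    response A B (fun τ => v τ + w τ) τ = response A B v τ + response A B w τ := by
  induction τ with
  | zero => simp [response]
  | succ τ ih => simp only [response, ih, map_add]; abel

theorem response_smul (A : E →L[ℝ] E) (B : U →L[ℝ] E) (a : ℝ) (v : ℕ → U) (τ : ℕ) :
    response A B (fun τ => a • v τ) τ = a • response A B v τ := by
  induction τ with
  | zero => simp [response]
  | succ τ ih => simp only [response, ih, map_smul, smul_add]

theorem eq_zero_of_sum_inner_self {v : ℕ → U} {h : ℕ}
    (hv : ∑ τ ∈ Finset.range h, inner ℝ (v τ) (v τ) = 0) : ∀ τ < h, v τ = 0 := by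
  intro τ hτ
  have := (Finset.sum_eq_zero_iff_of_nonneg fun τ _ => real_inner_self_nonneg).1 hv τ
    (Finset.mem_range.2 hτ)
  exact inner_self_eq_zero.1 this

end Response

section Optimality

variable {E U : Type} [NormedAddCommGroup E] [InnerProductSpace ℝ E] [CompleteSpace E]
  [NormedAddCommGroup U] [InnerProductSpace ℝ U] [CompleteSpace U]

/-- First-order optimality system of the linear-dynamics control problem with stage cost gradients
`G`, `H` and residuals `α`, `s` in the stationarity conditions; with `con = true` the terminal
stationarity condition is dropped. -/
structure KKT (A : E →L[ℝ] E) (B : U →L[ℝ] E) (con : Bool) (h : ℕ) (G : ℕ → E → E)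
    (H : ℕ → U → U) (x : E) (ζ α : ℕ → E) (s : ℕ → U) (y : ℕ → E) (v : ℕ → U) (p : ℕ → E) :
    Prop where
  init : y 0 = x
  dyn : ∀ τ < h, y (τ + 1) = A (y τ) + B (v τ) + ζ τ
  costate : ∀ τ < h, ¬ (con = true ∧ τ + 1 = h) →
    G (τ + 1) (y (τ + 1)) + (p τ - A.adjoint (p (τ + 1))) = α τ
  input : ∀ τ < h, H τ (v τ) = B.adjoint (p τ) + s τ
  final : p h = 0

theorem exists_costate (A : E →L[ℝ] E) (b : ℕ → E) (h : ℕ) :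
    ∃ p : ℕ → E, p h = 0 ∧ ∀ τ < h, b (τ + 1) + (p τ - A.adjoint (p (τ + 1))) = 0 := by
  let P : ℕ → E := fun j => Nat.rec 0 (fun j q => A.adjoint q - b (h - j)) j
  refine ⟨fun τ => P (h - τ), ?_, fun τ hτ => ?_⟩
  · simp [P]
  · have e : h - τ = (h - (τ + 1)) + 1 := by omega
    have e2 : P (h - τ) = A.adjoint (P (h - (τ + 1))) - b (h - (h - (τ + 1))) := by rw [e]
    rw [show h - (h - (τ + 1)) = τ + 1 by omega] at e2
    simp only [e2]
    abel

/-- Stationarity of a linear functional along the trajectories from the origin. -/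
def Stationary (A : E →L[ℝ] E) (B : U →L[ℝ] E) (con : Bool) (h : ℕ) (g : ℕ → E) (q : ℕ → U) :
    Prop :=
  ∀ v : ℕ → U, (con = true → response A B v h = 0) →
    ∑ τ ∈ Finset.range h, inner ℝ (g (τ + 1)) (response A B v (τ + 1)) +
      ∑ τ ∈ Finset.range h, inner ℝ (q τ) (v τ) = 0

theorem sum_costate_pairing_response (A : E →L[ℝ] E) (B : U →L[ℝ] E) (h : ℕ) (p : ℕ → E)
    (hp : p h = 0) (v : ℕ → U) :
    ∑ τ ∈ Finset.range h, inner ℝ (p τ - A.adjoint (p (τ + 1))) (response A B v (τ + 1)) =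
      ∑ τ ∈ Finset.range h, inner ℝ (B.adjoint (p τ)) (v τ) := by
  have h1 := sum_costate_pairing A B h (response A B v) p v
  simp only [response, hp, inner_zero_left, map_zero, inner_zero_right, add_zero,
    add_sub_cancel_left, sub_self, Finset.sum_const_zero, Finset.sum_sub_distrib] at h1
  simp only [response]
  simp only [inner_sub_left, Finset.sum_sub_distrib] at h1 ⊢
  linarith

theorem exists_multiplier_free {A : E →L[ℝ] E} {B : U →L[ℝ] E} {h : ℕ} {g : ℕ → E} {q : ℕ → U}
    (hs : Stationary A B false h g q) :
    ∃ p : ℕ → E, p h = 0 ∧ (∀ τ < h, g (τ + 1) + (p τ - A.adjoint (p (τ + 1))) = 0) ∧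
      ∀ τ < h, q τ = B.adjoint (p τ) := by
  obtain ⟨p, hp, hc⟩ := exists_costate A g h
  refine ⟨p, hp, hc, ?_⟩
  have h1 := hs (fun τ => q τ - B.adjoint (p τ)) (by simp)
  have h2 := sum_costate_pairing_response A B h p hp (fun τ => q τ - B.adjoint (p τ))
  have h3 : ∑ τ ∈ Finset.range h, inner ℝ (g (τ + 1))
      (response A B (fun τ => q τ - B.adjoint (p τ)) (τ + 1)) =
      -∑ τ ∈ Finset.range h, inner ℝ (p τ - A.adjoint (p (τ + 1)))
        (response A B (fun τ => q τ - B.adjoint (p τ)) (τ + 1)) := by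
    rw [← Finset.sum_neg_distrib]
    refine Finset.sum_congr rfl fun τ hτ => ?_
    rw [← inner_neg_left, eq_neg_of_add_eq_zero_left (hc τ (Finset.mem_range.1 hτ))]
  rw [h3, h2, ← Finset.sum_neg_distrib, ← Finset.sum_add_distrib] at h1
  have h4 := eq_zero_of_sum_inner_self (v := fun τ => q τ - B.adjoint (p τ)) (h := h) (by
    rw [← h1]
    refine Finset.sum_congr rfl fun τ _ => ?_
    simp only [inner_sub_left]; ring)
  intro τ hτ
  exact sub_eq_zero.1 (h4 τ hτ)

/-- The costate generated by the terminal multiplier `ν`. -/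
def terminalCostate (A : E →L[ℝ] E) (h : ℕ) (ν : E) (τ : ℕ) : E :=
  if τ < h then (A.adjoint ^ (h - 1 - τ)) ν else 0

theorem inner_response_eq (A : E →L[ℝ] E) (B : U →L[ℝ] E) {h : ℕ} (hh : 1 ≤ h) (ν : E)
    (v : ℕ → U) :
    inner ℝ ν (response A B v h) =
      ∑ τ ∈ Finset.range h, inner ℝ (B.adjoint (terminalCostate A h ν τ)) (v τ) := by
  rw [← sum_costate_pairing_response A B h (terminalCostate A h ν) (by simp [terminalCostate]) v]
  obtain ⟨n, rfl⟩ : ∃ n, h = n + 1 := ⟨h - 1, by omega⟩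
  rw [Finset.sum_range_succ, Finset.sum_eq_zero]
  · simp [terminalCostate]
  · intro τ hτ
    have hτ := Finset.mem_range.1 hτ
    have : terminalCostate A (n + 1) ν τ = A.adjoint (terminalCostate A (n + 1) ν (τ + 1)) := by
      rw [terminalCostate, terminalCostate, if_pos (by omega), if_pos (by omega),
        show n + 1 - 1 - τ = (n + 1 - 1 - (τ + 1)) + 1 by omega, pow_succ']
      rfl
    rw [this, sub_self, inner_zero_left]

theorem exists_multiplier_constrained [FiniteDimensional ℝ E] {A : E →L[ℝ] E} {B : U →L[ℝ] E}
    {h d : ℕ} {σ : ℝ} (hσ : 0 < σ) (hd : 1 ≤ d) (hh : d ≤ h) (hc : DualControllable A B σ d)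
    {g : ℕ → E} {q : ℕ → U} (hs : Stationary A B true h g q) :
    ∃ p : ℕ → E, p h = 0 ∧
      (∀ τ < h, τ + 1 ≠ h → g (τ + 1) + (p τ - A.adjoint (p (τ + 1))) = 0) ∧
      ∀ τ < h, q τ = B.adjoint (p τ) := by
  have h1h : 1 ≤ h := hd.trans hh
  obtain ⟨p, hp, hcs⟩ := exists_costate A g h
  let W : E →ₗ[ℝ] E :=
    { toFun := fun ν => response A B (fun τ => B.adjoint (terminalCostate A h ν τ)) h
      map_add' := fun ν ν' => by
        rw [← response_add]; congr 1; funext τ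
        simp only [terminalCostate]; split_ifs <;> simp
      map_smul' := fun a ν => by
        rw [RingHom.id_apply, ← response_smul]; congr 1; funext τ
        simp only [terminalCostate]; split_ifs <;> simp }
  have hinj : Function.Injective W := by
    rw [← LinearMap.ker_eq_bot, LinearMap.ker_eq_bot']
    intro ν hν
    have h1 := inner_response_eq A B h1h ν (fun τ => B.adjoint (terminalCostate A h ν τ))
    have hν' : response A B (fun τ => B.adjoint (terminalCostate A h ν τ)) h = 0 := hν
    rw [hν', inner_zero_right] at h1
    have h2 := eq_zero_of_sum_inner_self h1.symm
    have h3 := hc ν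
    rw [Finset.sum_eq_zero] at h3
    · have := norm_nonneg ν
      exact norm_eq_zero.1 (le_antisymm (by nlinarith) this)
    · intro j hj
      have hj := Finset.mem_range.1 hj
      have h4 := h2 (h - 1 - j) (by omega)
      rw [terminalCostate, if_pos (by omega), show h - 1 - (h - 1 - j) = j by omega] at h4
      rw [h4, norm_zero]
  have hsurj := LinearMap.injective_iff_surjective.1 hinj
  obtain ⟨ν, hν⟩ := hsurj (response A B (fun τ => q τ - B.adjoint (p τ)) h)
  set w : ℕ → U := fun τ => (q τ - B.adjoint (p τ)) +
    (-1 : ℝ) • B.adjoint (terminalCostate A h ν τ) with hw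
  have hw0 : response A B w h = 0 := by
    have hν' : response A B (fun τ => B.adjoint (terminalCostate A h ν τ)) h =
      response A B (fun τ => q τ - B.adjoint (p τ)) h := hν
    rw [hw, response_add, response_smul, hν']
    simp
  have h1 := hs w fun _ => hw0
  have h2 := sum_costate_pairing_response A B h p hp w
  have h3 := inner_response_eq A B h1h ν w
  rw [hw0, inner_zero_right] at h3
  have h4 : ∑ τ ∈ Finset.range h, inner ℝ (g (τ + 1)) (response A B w (τ + 1)) =
      -∑ τ ∈ Finset.range h, inner ℝ (p τ - A.adjoint (p (τ + 1))) (response A B w (τ + 1)) := by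
    rw [← Finset.sum_neg_distrib]
    refine Finset.sum_congr rfl fun τ hτ => ?_
    rw [← inner_neg_left, eq_neg_of_add_eq_zero_left (hcs τ (Finset.mem_range.1 hτ))]
  rw [h4, h2] at h1
  have h5 := eq_zero_of_sum_inner_self (v := w) (h := h) (by
    have : ∀ τ, inner ℝ (w τ) (w τ) = -inner ℝ (B.adjoint (p τ)) (w τ) + inner ℝ (q τ) (w τ)
        - inner ℝ (B.adjoint (terminalCostate A h ν τ)) (w τ) := by
      intro τ
      conv_lhs => rw [hw]
      simp only [inner_add_left, inner_sub_left, real_inner_smul_left]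
      ring
    simp only [this, Finset.sum_sub_distrib, Finset.sum_add_distrib, Finset.sum_neg_distrib]
    linarith)
  refine ⟨fun τ => p τ + terminalCostate A h ν τ, ?_, ?_, ?_⟩
  · simp [hp, terminalCostate]
  · intro τ hτ hne
    have : terminalCostate A h ν τ = A.adjoint (terminalCostate A h ν (τ + 1)) := by
      rw [terminalCostate, terminalCostate, if_pos (by omega), if_pos (by omega),
        show h - 1 - τ = (h - 1 - (τ + 1)) + 1 by omega, pow_succ']
      rfl
    simp only [this, map_add]
    rw [← hcs τ hτ]
    abel
  · intro τ hτ
    have := h5 τ hτ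
    simp only [hw, neg_smul, one_smul] at this
    rw [map_add]
    exact sub_eq_zero.1 (by rw [← this]; abel)

theorem hasDerivAt_line {F : Type} [NormedAddCommGroup F] [InnerProductSpace ℝ F] [CompleteSpace F]
    {f : F → ℝ} (a b : F) (hf : Differentiable ℝ f) :
    HasDerivAt (fun s : ℝ => f (a + s • b)) (inner ℝ (gradient f a) b) 0 := by
  have h1 : HasDerivAt (fun s : ℝ => a + s • b) b 0 := by
    simpa using ((hasDerivAt_id (0 : ℝ)).smul_const b).const_add a
  have h2 : HasFDerivAt f (InnerProductSpace.toDual ℝ F (gradient f a)) (a + (0 : ℝ) • b) := by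
    rw [zero_smul, add_zero]
    exact (hf a).hasGradientAt.hasFDerivAt
  have h3 := h2.comp_hasDerivAt (0 : ℝ) h1
  rw [InnerProductSpace.toDual_apply_apply] at h3
  exact h3

/-- First-order condition at a minimizer of a separable objective over feasible trajectories. -/
theorem stationary_of_minimizer {A : E →L[ℝ] E} {B : U →L[ℝ] E} {con : Bool} {h : ℕ}
    {φ : ℕ → E → ℝ} {ψ : ℕ → U → ℝ} (hφ : ∀ τ ≤ h, Differentiable ℝ (φ τ))
    (hψ : ∀ τ < h, Differentiable ℝ (ψ τ)) {x : E} {ζ y : ℕ → E} {v : ℕ → U}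
    (h0 : y 0 = x) (hdyn : ∀ τ < h, y (τ + 1) = A (y τ) + B (v τ) + ζ τ)
    (hmin : ∀ (y' : ℕ → E) (v' : ℕ → U), y' 0 = x →
      (∀ τ < h, y' (τ + 1) = A (y' τ) + B (v' τ) + ζ τ) → (con = true → y' h = y h) →
      ∑ τ ∈ Finset.range (h + 1), φ τ (y τ) + ∑ τ ∈ Finset.range h, ψ τ (v τ) ≤
        ∑ τ ∈ Finset.range (h + 1), φ τ (y' τ) + ∑ τ ∈ Finset.range h, ψ τ (v' τ)) :
    Stationary A B con h (fun τ => gradient (φ τ) (y τ)) (fun τ => gradient (ψ τ) (v τ)) := by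
  intro w hw
  set z := response A B w with hz
  have hder : HasDerivAt (fun s : ℝ => ∑ τ ∈ Finset.range (h + 1), φ τ (y τ + s • z τ) +
      ∑ τ ∈ Finset.range h, ψ τ (v τ + s • w τ))
      (∑ τ ∈ Finset.range (h + 1), inner ℝ (gradient (φ τ) (y τ)) (z τ) +
        ∑ τ ∈ Finset.range h, inner ℝ (gradient (ψ τ) (v τ)) (w τ)) 0 := by
    refine HasDerivAt.add ?_ ?_
    · refine HasDerivAt.fun_sum fun τ hτ => ?_
      exact hasDerivAt_line _ _ (hφ τ (Nat.lt_succ_iff.1 (Finset.mem_range.1 hτ)))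
    · refine HasDerivAt.fun_sum fun τ hτ => ?_
      exact hasDerivAt_line _ _ (hψ τ (Finset.mem_range.1 hτ))
  have hloc : IsLocalMin (fun s : ℝ => ∑ τ ∈ Finset.range (h + 1), φ τ (y τ + s • z τ) +
      ∑ τ ∈ Finset.range h, ψ τ (v τ + s • w τ)) 0 := by
    refine Filter.Eventually.of_forall fun s => ?_
    simp only [zero_smul, add_zero]
    refine hmin (fun τ => y τ + s • z τ) (fun τ => v τ + s • w τ) ?_ ?_ ?_
    · simp [hz, response, h0]
    · intro τ hτ
      simp only [hz, response, hdyn τ hτ, map_add, map_smul, smul_add]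
      abel
    · intro hcon
      simp [hw hcon]
  have hzero := hloc.hasDerivAt_eq_zero hder
  rw [Finset.sum_range_succ'] at hzero
  have z0 : z 0 = 0 := by rw [hz]; rfl
  rw [z0, inner_zero_right, add_zero] at hzero
  exact hzero

end Optimality

theorem exists_minimizer {E U : Type} [NormedAddCommGroup E] [NormedSpace ℝ E]
    [NormedAddCommGroup U] [NormedSpace ℝ U] [FiniteDimensional ℝ U] (A : E →L[ℝ] E) (B : U →L[ℝ] E) (h : ℕ)
    {φ : ℕ → E → ℝ} {ψ : ℕ → U → ℝ} (hφ : ∀ τ ≤ h, Continuous (φ τ))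
    (hφ0 : ∀ τ ≤ h, ∀ z, 0 ≤ φ τ z) (hψ : ∀ τ < h, Continuous (ψ τ)) {c : ℝ} (hc : 0 < c)
    (hψc : ∀ τ < h, ∀ u, c * ‖u‖ ^ 2 ≤ ψ τ u) (x : E) (ζ : ℕ → E) :
    ∃ (y : ℕ → E) (v : ℕ → U), y 0 = x ∧ (∀ τ < h, y (τ + 1) = A (y τ) + B (v τ) + ζ τ) ∧
      ∀ (y' : ℕ → E) (v' : ℕ → U), y' 0 = x →
      (∀ τ < h, y' (τ + 1) = A (y' τ) + B (v' τ) + ζ τ) →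
      ∑ τ ∈ Finset.range (h + 1), φ τ (y τ) + ∑ τ ∈ Finset.range h, ψ τ (v τ) ≤
        ∑ τ ∈ Finset.range (h + 1), φ τ (y' τ) + ∑ τ ∈ Finset.range h, ψ τ (v' τ) := by
  let ext : (Fin h → U) → ℕ → U := fun V τ => if hτ : τ < h then V ⟨τ, hτ⟩ else 0
  let traj : (Fin h → U) → ℕ → E := fun V τ =>
    Nat.rec x (fun τ z => A z + B (ext V τ) + ζ τ) τ
  have htraj : ∀ V τ, traj V (τ + 1) = A (traj V τ) + B (ext V τ) + ζ τ := fun V τ => rfl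
  have cext : ∀ τ, Continuous fun V => ext V τ := by
    intro τ
    by_cases hτ : τ < h
    · simp only [ext, hτ, dif_pos]; exact continuous_apply _
    · simp only [ext, hτ, dif_neg, not_false_eq_true]; exact continuous_const
  have ctraj : ∀ τ, Continuous fun V => traj V τ := by
    intro τ
    induction τ with
    | zero => exact continuous_const
    | succ τ ih =>
      simp only [htraj]
      exact ((A.continuous.comp ih).add (B.continuous.comp (cext τ))).add continuous_const
  let J : (Fin h → U) → ℝ := fun V => ∑ τ ∈ Finset.range (h + 1), φ τ (traj V τ) +
    ∑ τ ∈ Finset.range h, ψ τ (ext V τ)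
  have cJ : Continuous J := by
    refine Continuous.add ?_ ?_
    · refine continuous_finsetSum _ fun τ hτ => ?_
      exact (hφ τ (Nat.lt_succ_iff.1 (Finset.mem_range.1 hτ))).comp (ctraj τ)
    · refine continuous_finsetSum _ fun τ hτ => ?_
      exact (hψ τ (Finset.mem_range.1 hτ)).comp (cext τ)
  have hJ : ∀ V, c * ‖V‖ ^ 2 ≤ J V := by
    intro V
    have h1 : 0 ≤ ∑ τ ∈ Finset.range (h + 1), φ τ (traj V τ) :=
      Finset.sum_nonneg fun τ hτ => hφ0 τ (Nat.lt_succ_iff.1 (Finset.mem_range.1 hτ)) _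
    have h2 : ∑ τ ∈ Finset.range h, c * ‖ext V τ‖ ^ 2 ≤ ∑ τ ∈ Finset.range h, ψ τ (ext V τ) :=
      Finset.sum_le_sum fun τ hτ => hψc τ (Finset.mem_range.1 hτ) _
    have h3 : ‖V‖ ^ 2 ≤ ∑ τ ∈ Finset.range h, ‖ext V τ‖ ^ 2 := by
      have h0 : 0 ≤ ∑ τ ∈ Finset.range h, ‖ext V τ‖ ^ 2 := by positivity
      have h4 : ‖V‖ ≤ Real.sqrt (∑ τ ∈ Finset.range h, ‖ext V τ‖ ^ 2) := by
        refine (pi_norm_le_iff_of_nonneg (Real.sqrt_nonneg _)).2 fun i => ?_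
        refine Real.le_sqrt_of_sq_le ?_
        have h5 : ext V i = V i := by simp [ext]
        rw [← h5]
        exact Finset.single_le_sum (f := fun τ => ‖ext V τ‖ ^ 2) (fun _ _ => sq_nonneg _)
          (Finset.mem_range.2 i.2)
      calc ‖V‖ ^ 2 ≤ Real.sqrt (∑ τ ∈ Finset.range h, ‖ext V τ‖ ^ 2) ^ 2 :=
            pow_le_pow_left₀ (norm_nonneg _) h4 2
        _ = _ := Real.sq_sqrt h0
    rw [← Finset.mul_sum] at h2
    have h4 := mul_le_mul_of_nonneg_left h3 hc.le
    simp only [J]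
    linarith
  have hlim : Filter.Tendsto J (Filter.cocompact _) Filter.atTop := by
    refine Filter.tendsto_atTop_mono hJ ?_
    exact Filter.Tendsto.const_mul_atTop hc
      ((Filter.tendsto_pow_atTop two_ne_zero).comp tendsto_norm_cocompact_atTop)
  obtain ⟨V, hV⟩ := cJ.exists_forall_le hlim
  refine ⟨traj V, ext V, rfl, fun τ _ => htraj V τ, ?_⟩
  intro y' v' h0 hdyn
  have e1 : ∀ τ < h, ext (fun i => v' i) τ = v' τ := by
    intro τ hτ; simp [ext, hτ]
  have e2 : ∀ τ ≤ h, traj (fun i => v' i) τ = y' τ := by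
    intro τ
    induction τ with
    | zero => intro _; exact h0.symm
    | succ τ ih =>
      intro hτ
      change A (traj (fun i : Fin h => v' i) τ) + B (ext (fun i : Fin h => v' i) τ) + ζ τ = _
      rw [ih (by omega), e1 τ (by omega), hdyn τ (by omega)]
  refine (hV fun i => v' i).trans (le_of_eq ?_)
  simp only [J]
  congr 1
  · refine Finset.sum_congr rfl fun τ hτ => ?_
    rw [e2 τ (Nat.lt_succ_iff.1 (Finset.mem_range.1 hτ))]
  · refine Finset.sum_congr rfl fun τ hτ => ?_
    rw [e1 τ (Finset.mem_range.1 hτ)]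

section Gradients

variable {ι : Type} [Fintype ι] {f : EuclideanSpace ℝ ι → ℝ} {μ L : ℝ}

theorem WellConditioned.differentiable (hf : WellConditioned f μ L) : Differentiable ℝ f :=
  hf.contDiff.differentiable (by norm_num)

theorem WellConditioned.first_order (hf : WellConditioned f μ L) (x y : EuclideanSpace ℝ ι) :
    f x + inner ℝ (gradient f x) (y - x) + μ / 2 * ‖y - x‖ ^ 2 ≤ f y := by
  have hd := hasDerivAt_line x (y - x) hf.differentiable
  have h1 : Filter.Tendsto (fun s : ℝ => s⁻¹ * (f (x + s • (y - x)) - f x)) (𝓝[>] 0)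
      (𝓝 (inner ℝ (gradient f x) (y - x))) := by
    have := hd.tendsto_slope_zero_right
    simpa using this
  have h2 : Filter.Tendsto (fun s : ℝ => f y - f x - (1 - s) * (μ / 2 * ‖y - x‖ ^ 2)) (𝓝[>] 0)
      (𝓝 (f y - f x - (1 - 0) * (μ / 2 * ‖y - x‖ ^ 2))) := by
    refine Filter.Tendsto.mono_left ?_ nhdsWithin_le_nhds
    exact (Continuous.tendsto (by fun_prop) 0)
  have h3 : ∀ᶠ s : ℝ in 𝓝[>] 0, s⁻¹ * (f (x + s • (y - x)) - f x) ≤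
      f y - f x - (1 - s) * (μ / 2 * ‖y - x‖ ^ 2) := by
    filter_upwards [Ioo_mem_nhdsGT (zero_lt_one' ℝ)] with s hs
    have h4 := hf.strongConvex.2 (Set.mem_univ x) (Set.mem_univ y) (by linarith [hs.2] : 0 ≤ 1 - s)
      hs.1.le (by ring)
    have e : (1 - s) • x + s • y = x + s • (y - x) := by
      rw [sub_smul, one_smul, smul_sub]; abel
    rw [e] at h4
    simp only [smul_eq_mul, norm_sub_rev x y] at h4
    rw [inv_mul_le_iff₀ hs.1]
    linarith
  have := le_of_tendsto_of_tendsto h1 h2 h3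
  linarith

theorem WellConditioned.monotone (hf : WellConditioned f μ L) (x y : EuclideanSpace ℝ ι) :
    μ * ‖x - y‖ ^ 2 ≤ inner ℝ (gradient f x - gradient f y) (x - y) := by
  have h1 := hf.first_order x y
  have h2 := hf.first_order y x
  rw [norm_sub_rev y x, ← neg_sub x y, inner_neg_right] at h1
  rw [inner_sub_left]
  linarith

theorem gradient_zero_of_nonneg (h0 : f 0 = 0)
    (hpos : ∀ x, 0 ≤ f x) : gradient f 0 = 0 := by
  have h1 : IsLocalMin f 0 := Filter.Eventually.of_forall fun x => by rw [h0]; exact hpos x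
  rw [gradient, h1.fderiv_eq_zero, map_zero]

theorem WellConditioned.lower_bound (hf : WellConditioned f μ L) (h0 : f 0 = 0)
    (hpos : ∀ x, 0 ≤ f x) (x : EuclideanSpace ℝ ι) : μ / 2 * ‖x‖ ^ 2 ≤ f x := by
  have h1 := hf.first_order 0 x
  rw [gradient_zero_of_nonneg h0 hpos, h0, inner_zero_left, sub_zero] at h1
  linarith

/-- Quadratic upper bound (with a suboptimal constant). -/
theorem WellConditioned.upper_bound (hf : WellConditioned f μ L) (hμ : 0 ≤ μ)
    (x y : EuclideanSpace ℝ ι) :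
    f y ≤ f x + inner ℝ (gradient f x) (y - x) + L * ‖y - x‖ ^ 2 := by
  have h1 := hf.first_order y x
  rw [← neg_sub y x, inner_neg_right, norm_neg] at h1
  have h2 := real_inner_le_norm (gradient f y - gradient f x) (y - x)
  have h3 := mul_le_mul_of_nonneg_right (hf.smooth y x) (norm_nonneg (y - x))
  rw [inner_sub_left] at h2
  have h4 : 0 ≤ μ / 2 * ‖y - x‖ ^ 2 := by positivity
  nlinarith

end Gradients

section Blocks

variable {N : ℕ} {n : Fin N → ℕ}

theorem block_add (x y : Vec n) (j : Fin N) : block (x + y) j = block x j + block y j := rfl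

theorem block_sub (x y : Vec n) (j : Fin N) : block (x - y) j = block x j - block y j := rfl

theorem block_smul (a : ℝ) (x : Vec n) (j : Fin N) : block (a • x) j = a • block x j := rfl

theorem inner_eq_sum_block (x y : Vec n) : inner ℝ x y = ∑ j, inner ℝ (block x j) (block y j) := by
  simp only [PiLp.inner_apply, block]
  exact Fintype.sum_sigma _

theorem norm_sq_eq_sum_block (x : Vec n) : ‖x‖ ^ 2 = ∑ j, ‖block x j‖ ^ 2 := by
  simp only [← real_inner_self_eq_norm_sq]
  exact inner_eq_sum_block x x

theorem norm_block_le (x : Vec n) (j : Fin N) : ‖block x j‖ ≤ ‖x‖ := by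
  refine le_of_sq_le_sq ?_ (norm_nonneg _)
  rw [norm_sq_eq_sum_block x]
  exact Finset.single_le_sum (f := fun j => ‖block x j‖ ^ 2) (fun _ _ => sq_nonneg _)
    (Finset.mem_univ j)

/-- Multiplication of the block `j` by the scalar `w j`. -/
def blockScale (w : Fin N → ℝ) : Vec n →L[ℝ] Vec n :=
  LinearMap.toContinuousLinearMap
    { toFun := fun x => WithLp.toLp 2 fun p => w p.1 * x p
      map_add' := fun x y => by ext p; simp [mul_add]
      map_smul' := fun a x => by ext p; simp [mul_left_comm] }

theorem blockScale_apply (w : Fin N → ℝ) (x : Vec n) (p : Idx n) :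
    blockScale w x p = w p.1 * x p := rfl

theorem block_blockScale (w : Fin N → ℝ) (x : Vec n) (j : Fin N) :
    block (blockScale w x) j = w j • block x j := by
  ext a; simp [block, blockScale_apply]

/-- Strong monotonicity and Lipschitz continuity of a vector field, block by block. -/
def BlockMonotone (μ L : ℝ) (G : Vec n → Vec n) : Prop :=
  ∀ y y' j, μ * ‖block (y - y') j‖ ^ 2 ≤ inner ℝ (block (G y - G y') j) (block (y - y') j) ∧
    ‖block (G y - G y') j‖ ≤ L * ‖block (y - y') j‖

theorem BlockMonotone.scale_monotone {μ L : ℝ} {G : Vec n → Vec n} (hG : BlockMonotone μ L G)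
    (w : Fin N → ℝ) (y y' : Vec n) :
    μ * ‖blockScale w (y - y')‖ ^ 2 ≤
      inner ℝ (blockScale w (G y - G y')) (blockScale w (y - y')) := by
  rw [norm_sq_eq_sum_block, inner_eq_sum_block, Finset.mul_sum]
  refine Finset.sum_le_sum fun j _ => ?_
  rw [block_blockScale, block_blockScale, real_inner_smul_left, real_inner_smul_right, norm_smul,
    mul_pow, Real.norm_eq_abs, sq_abs]
  have := mul_le_mul_of_nonneg_left (hG y y' j).1 (sq_nonneg (w j))
  linarith

theorem BlockMonotone.scale_lipschitz {μ L : ℝ} {G : Vec n → Vec n} (hG : BlockMonotone μ L G)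
    (hL : 0 ≤ L) (w : Fin N → ℝ) (y y' : Vec n) :
    ‖blockScale w (G y - G y')‖ ≤ L * ‖blockScale w (y - y')‖ := by
  refine le_of_sq_le_sq ?_ (by positivity)
  rw [mul_pow, norm_sq_eq_sum_block, norm_sq_eq_sum_block, Finset.mul_sum]
  refine Finset.sum_le_sum fun j _ => ?_
  rw [block_blockScale, block_blockScale, norm_smul, norm_smul]
  have := mul_le_mul_of_nonneg_left (hG y y' j).2 (norm_nonneg (w j))
  rw [← mul_pow]
  exact pow_le_pow_left₀ (by positivity) (by linarith) 2

theorem BlockMonotone.mono {μ L L' : ℝ} {G : Vec n → Vec n} (hG : BlockMonotone μ L G)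
    (hL : L ≤ L') : BlockMonotone μ L' G := fun y y' j =>
  ⟨(hG y y' j).1, (hG y y' j).2.trans (mul_le_mul_of_nonneg_right hL (norm_nonneg _))⟩

theorem blockMonotone_smul {μ L φ : ℝ} (h0 : 0 ≤ μ) (h1 : μ ≤ φ) (h2 : φ ≤ L) :
    BlockMonotone μ L (fun z : Vec n => φ • z) := by
  intro y y' j
  have e : block (φ • y - φ • y') j = φ • block (y - y') j := by
    rw [← smul_sub, block_smul]
  constructor
  · simp only [e, real_inner_smul_left, real_inner_self_eq_norm_sq]
    exact mul_le_mul_of_nonneg_right h1 (sq_nonneg _)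
  · simp only [e, norm_smul, Real.norm_eq_abs, abs_of_nonneg (h0.trans h1)]
    exact mul_le_mul_of_nonneg_right h2 (norm_nonneg _)

/-- The projection to the block `j`. -/
def keepBlock (j : Fin N) : Vec n →L[ℝ] Vec n := blockScale fun i => if i = j then 1 else 0

theorem block_keepBlock_self (x : Vec n) (j : Fin N) : block (keepBlock j x) j = block x j := by
  rw [keepBlock, block_blockScale, if_pos rfl, one_smul]

theorem block_keepBlock_ne (x : Vec n) {i j : Fin N} (hij : i ≠ j) :
    block (keepBlock j x) i = 0 := by
  rw [keepBlock, block_blockScale, if_neg hij, zero_smul]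

theorem inner_keepBlock (x y : Vec n) (j : Fin N) :
    inner ℝ x (keepBlock j y) = inner ℝ (block x j) (block y j) := by
  rw [inner_eq_sum_block, Finset.sum_eq_single j, block_keepBlock_self]
  · intro i _ hij
    rw [block_keepBlock_ne y hij, inner_zero_right]
  · simp

variable {f : ∀ i, EuclideanSpace ℝ (Fin (n i)) → ℝ}

/-- The block `j` of the gradient of a separable function depends on the block `j` only. -/
theorem block_gradient_aggregate_congr (hf : Differentiable ℝ (aggregate f)) {x x' : Vec n}
    {j : Fin N} (hx : block x j = block x' j) :
    block (gradient (aggregate f) x) j = block (gradient (aggregate f) x') j := by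
  have key : ∀ e : Vec n, inner ℝ (gradient (aggregate f) x) (keepBlock j e) =
      inner ℝ (gradient (aggregate f) x') (keepBlock j e) := by
    intro e
    have h1 := hasDerivAt_line x (keepBlock j e) hf
    have h2 := (hasDerivAt_line x' (keepBlock j e) hf).const_add
      (aggregate f x - aggregate f x')
    refine h1.unique (h2.congr_of_eventuallyEq (Filter.Eventually.of_forall fun s => ?_))
    have h3 : ∀ z : Vec n, aggregate f (z + s • keepBlock j e) - aggregate f z =
        f j (block z j + s • block e j) - f j (block z j) := by
      intro z
      simp only [aggregate]
      rw [← Finset.sum_sub_distrib, Finset.sum_eq_single j]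
      · rw [block_add, block_smul, block_keepBlock_self]
      · intro i _ hij
        rw [block_add, block_smul, block_keepBlock_ne e hij, smul_zero, add_zero, sub_self]
      · simp
    have h4 := h3 x
    have h5 := h3 x'
    rw [hx] at h4
    simp only
    linarith
  have h1 := key (gradient (aggregate f) x - gradient (aggregate f) x')
  rw [inner_keepBlock, inner_keepBlock, ← sub_eq_zero, ← inner_sub_left, block_sub,
    inner_self_eq_zero] at h1
  exact sub_eq_zero.1 h1

theorem blockMonotone_gradient {μ L : ℝ} (hf : WellConditioned (aggregate f) μ L) :
    BlockMonotone μ L (gradient (aggregate f)) := by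
  intro y y' j
  set g := gradient (aggregate f) with hg
  have hself : ∀ z, block (g (keepBlock j z)) j = block (g z) j := fun z =>
    block_gradient_aggregate_congr hf.differentiable (block_keepBlock_self z j)
  have hnorm : ‖keepBlock j y - keepBlock j y'‖ = ‖block (y - y') j‖ := by
    have h1 : ‖keepBlock j y - keepBlock j y'‖ ^ 2 = ‖block (y - y') j‖ ^ 2 := by
      rw [norm_sq_eq_sum_block, Finset.sum_eq_single j]
      · rw [block_sub, block_keepBlock_self, block_keepBlock_self, block_sub]
      · intro i _ hij
        rw [block_sub, block_keepBlock_ne y hij, block_keepBlock_ne y' hij]; simp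
      · simp
    exact (pow_left_inj₀ (norm_nonneg _) (norm_nonneg _) two_ne_zero).1 h1
  constructor
  · have h1 := hf.monotone (keepBlock j y) (keepBlock j y')
    rw [hnorm, ← map_sub, inner_keepBlock, ← hg, block_sub (g _) (g _), hself,
      hself, ← block_sub] at h1
    exact h1
  · have h1 := hf.smooth (keepBlock j y) (keepBlock j y')
    rw [hnorm] at h1
    refine le_trans ?_ h1
    rw [block_sub, ← hself y, ← hself y', ← block_sub]
    exact norm_block_le _ j

/-- The gradient of a radial well-conditioned function is a scalar multiple of the position. -/
theorem TerminalCostAssumption.gradient_eq_smul {F : Vec n → ℝ} {μ L L' : ℝ}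
    (hF : TerminalCostAssumption F μ L) (hL : L ≤ L') (hμ : μ ≤ L') (x : Vec n) :
    ∃ φ, μ ≤ φ ∧ φ ≤ L' ∧ gradient F x = φ • x := by
  obtain ⟨β, -, -, hβ⟩ := hF.kFun
  have horth : ∀ z e : Vec n, inner ℝ z e = 0 → inner ℝ (gradient F z) e = 0 := by
    intro z e hze
    have h1 := hasDerivAt_line z e hF.wc.differentiable
    have h2 := hasDerivAt_line z (-e) hF.wc.differentiable
    have h3 : (fun s : ℝ => F (z + s • e)) = fun s : ℝ => F (z + s • -e) := by
      funext s
      rw [hβ, hβ]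
      congr 1
      have h4 : ‖z + s • e‖ ^ 2 = ‖z + s • -e‖ ^ 2 := by
        rw [norm_add_sq_real, norm_add_sq_real]
        simp [real_inner_smul_right, hze]
      exact (pow_left_inj₀ (norm_nonneg _) (norm_nonneg _) two_ne_zero).1 h4
    rw [← h3] at h2
    have h4 := h1.unique h2
    rw [inner_neg_right] at h4
    linarith
  have hg0 : gradient F 0 = 0 := by
    have := horth 0 (gradient F 0) (inner_zero_left _)
    exact inner_self_eq_zero.1 this
  by_cases hx : x = 0
  · exact ⟨μ, le_rfl, hμ, by rw [hx, hg0, smul_zero]⟩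
  have hx0 : 0 < ‖x‖ := norm_pos_iff.2 hx
  set φ := inner ℝ (gradient F x) x / ‖x‖ ^ 2 with hφ
  have hφx : φ * ‖x‖ ^ 2 = inner ℝ (gradient F x) x := by
    rw [hφ]; field_simp
  have hort2 : inner ℝ x (gradient F x - φ • x) = 0 := by
    rw [inner_sub_right, real_inner_smul_right, real_inner_self_eq_norm_sq, hφx,
      real_inner_comm, sub_self]
  refine ⟨φ, ?_, ?_, ?_⟩
  · have := hF.wc.monotone x 0
    rw [hg0, sub_zero, sub_zero, ← hφx] at this
    exact le_of_mul_le_mul_right this (by positivity)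
  · have h1 := hF.wc.smooth x 0
    rw [hg0, sub_zero, sub_zero] at h1
    have h2 := real_inner_le_norm (gradient F x) x
    rw [← hφx] at h2
    refine le_trans ?_ hL
    refine le_of_mul_le_mul_right ?_ (by positivity : 0 < ‖x‖ ^ 2)
    nlinarith
  · have h1 := horth x _ hort2
    have h2 : inner ℝ (gradient F x - φ • x) (gradient F x - φ • x) = 0 := by
      rw [inner_sub_left, h1, real_inner_smul_left, hort2]; simp
    exact sub_eq_zero.1 (inner_self_eq_zero.1 h2)

end Blocks

section Operators

variable {ι κ : Type} [Fintype ι] [Fintype κ] [DecidableEq κ]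

/-- The operator of a matrix between Euclidean spaces. -/
def opOf (M : Matrix ι κ ℝ) : EuclideanSpace ℝ κ →L[ℝ] EuclideanSpace ℝ ι :=
  LinearMap.toContinuousLinearMap (Matrix.toEuclideanLin M)

theorem act_eq_opOf (M : Matrix ι κ ℝ) (x : EuclideanSpace ℝ κ) : act M x = opOf M x := rfl

theorem opOf_apply (M : Matrix ι κ ℝ) (x : EuclideanSpace ℝ κ) (i : ι) :
    opOf M x i = ∑ j, M i j * x j := rfl

theorem norm_opOf (M : Matrix ι κ ℝ) : ‖opOf M‖ = ‖M‖ := (Matrix.l2_opNorm_def M).symm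

theorem opOf_mul {l : Type} [Fintype l] [DecidableEq l] (M : Matrix ι κ ℝ) (P : Matrix κ l ℝ) :
    opOf (M * P) = opOf M ∘L opOf P := by
  ext x i
  have : WithLp.ofLp (opOf (M * P) x) = (M * P).mulVec (WithLp.ofLp x) := rfl
  rw [this, ← Matrix.mulVec_mulVec]
  rfl

theorem opOf_sub (M P : Matrix ι κ ℝ) : opOf (M - P) = opOf M - opOf P := by
  simp [opOf]

variable [DecidableEq ι]

theorem adjoint_opOf (M : Matrix ι κ ℝ) : (opOf M).adjoint = opOf M.transpose := by
  rw [eq_comm, ContinuousLinearMap.eq_adjoint_iff]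
  intro x y
  simp only [PiLp.inner_apply, opOf_apply, RCLike.inner_apply, conj_trivial, Finset.mul_sum,
    Finset.sum_mul, Matrix.transpose_apply]
  rw [Finset.sum_comm]
  refine Finset.sum_congr rfl fun _ _ => Finset.sum_congr rfl fun _ _ => ?_
  ring

theorem opOf_pow (M : Matrix ι ι ℝ) (t : ℕ) : opOf (M ^ t) = opOf M ^ t := by
  induction t with
  | zero =>
    ext x i
    have : WithLp.ofLp (opOf ((M : Matrix ι ι ℝ) ^ 0) x) = (M ^ 0).mulVec (WithLp.ofLp x) := rfl
    rw [this, pow_zero, Matrix.one_mulVec, pow_zero]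
    rfl
  | succ t ih => rw [pow_succ, opOf_mul, ih, pow_succ]; rfl

theorem Stabilizable.dualBound {A : Matrix ι ι ℝ} {B : Matrix ι κ ℝ} {L γ : ℝ}
    (hs : Stabilizable A B L γ) (h : ℕ) :
    DualBound (opOf A) (opOf B) false h (2 * L ^ 2 * (1 + L ^ 2) * (1 / (1 - γ)) ^ 2) := by
  obtain ⟨-, h0, h1, K, hK, ht⟩ := hs
  refine dualBound_of_stabilizing (K := opOf K) h0.le h1 (by rwa [norm_opOf]) (fun t => ?_) h
  rw [← opOf_mul, ← opOf_sub, ← opOf_pow, norm_opOf]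
  exact ht t

theorem MinSingularGe.dualControllable {A : Matrix ι ι ℝ} {B : Matrix ι κ ℝ} {σ : ℝ} {d : ℕ}
    (hc : MinSingularGe (ctrlMat A B d) σ) : DualControllable (opOf A) (opOf B) σ d := by
  intro z
  refine (hc z).trans ?_
  have h1 : ∀ j : ℕ, (opOf B).adjoint (((opOf A).adjoint ^ j) z) =
      opOf (A ^ j * B).transpose z := by
    intro j
    rw [adjoint_opOf, adjoint_opOf, ← opOf_pow, Matrix.transpose_mul, opOf_mul,
      Matrix.transpose_pow]
    rfl
  have h2 : ‖act (ctrlMat A B d).transpose z‖ ^ 2 =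
      ∑ j ∈ Finset.range d, ‖opOf (A ^ j * B).transpose z‖ ^ 2 := by
    rw [EuclideanSpace.norm_sq_eq, Fintype.sum_prod_type, Finset.sum_range]
    refine Finset.sum_congr rfl fun j _ => ?_
    rw [EuclideanSpace.norm_sq_eq]
    rfl
  refine le_of_sq_le_sq ?_ (Finset.sum_nonneg fun _ _ => norm_nonneg _)
  rw [h2]
  simp only [h1]
  exact Finset.sum_sq_le_sq_sum_of_nonneg fun _ _ => norm_nonneg _

end Operators

section Levels

variable {N : ℕ} {n m : Fin N → ℕ}

theorem norm_sq_blockScale (w : Fin N → ℝ) (x : Vec n) :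
    ‖blockScale w x‖ ^ 2 = ∑ j, w j ^ 2 * ‖block x j‖ ^ 2 := by
  rw [norm_sq_eq_sum_block]
  refine Finset.sum_congr rfl fun j _ => ?_
  rw [block_blockScale, norm_smul, mul_pow, Real.norm_eq_abs, sq_abs]

theorem norm_blockScale_le {w : Fin N → ℝ} {a : ℝ} (ha : 0 ≤ a) (hw : ∀ j, |w j| ≤ a)
    (x : Vec n) : ‖blockScale w x‖ ≤ a * ‖x‖ := by
  refine le_of_sq_le_sq ?_ (by positivity)
  rw [norm_sq_blockScale, mul_pow, norm_sq_eq_sum_block x, Finset.mul_sum]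
  refine Finset.sum_le_sum fun j _ => mul_le_mul_of_nonneg_right ?_ (sq_nonneg _)
  rw [← sq_abs]
  exact pow_le_pow_left₀ (abs_nonneg _) (hw j) 2

/-- The nonzero entries of `M` connect nodes whose levels differ by at most one. -/
def LevelBanded (lev : Fin N → ℕ) (M : Matrix (Idx n) (Idx m) ℝ) : Prop :=
  ∀ p q, M p q ≠ 0 → lev p.1 ≤ lev q.1 + 1 ∧ lev q.1 ≤ lev p.1 + 1

theorem LevelBanded.transpose {lev : Fin N → ℕ} {M : Matrix (Idx n) (Idx m) ℝ}
    (hM : LevelBanded lev M) : LevelBanded lev M.transpose := fun p q h =>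
  ⟨(hM q p h).2, (hM q p h).1⟩

theorem sum_norm_sq_level_le (f : ℕ → ℕ → Prop) [∀ a b, Decidable (f a b)]
    (hf : ∀ a k k', f a k → f a k' → k = k') (lev : Fin N → ℕ) (K : ℕ) (x : Vec n) :
    ∑ k ∈ Finset.range K, ‖blockScale (fun j => if f (lev j) k then 1 else 0) x‖ ^ 2 ≤ ‖x‖ ^ 2 := by
  simp only [norm_sq_blockScale]
  rw [Finset.sum_comm, norm_sq_eq_sum_block x]
  refine Finset.sum_le_sum fun j _ => ?_
  rw [← Finset.sum_mul]
  refine mul_le_of_le_one_left (sq_nonneg _) ?_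
  by_cases hk : ∃ k, f (lev j) k
  · obtain ⟨k, hk⟩ := hk
    have : ∀ k' ∈ Finset.range K, (if f (lev j) k' then (1 : ℝ) else 0) ^ 2 ≤
        if k' = k then 1 else 0 := by
      intro k' _
      split_ifs with h1 h2 h2
      · norm_num
      · exact absurd (hf _ _ _ h1 hk) h2
      · norm_num
      · norm_num
    refine (Finset.sum_le_sum this).trans ?_
    rw [Finset.sum_ite_eq']
    split_ifs <;> norm_num
  · push Not at hk
    simp [hk]

theorem norm_sq_eq_sum_level (lev : Fin N → ℕ) {K : ℕ} (hK : ∀ j, lev j < K) (x : Vec n) :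
    ‖x‖ ^ 2 = ∑ k ∈ Finset.range K, ‖blockScale (fun j => if lev j = k then 1 else 0) x‖ ^ 2 := by
  simp only [norm_sq_blockScale]
  rw [Finset.sum_comm, norm_sq_eq_sum_block x]
  refine Finset.sum_congr rfl fun j _ => ?_
  rw [← Finset.sum_mul]
  simp [hK j]

/-- A banded matrix almost commutes with geometric weights. -/
theorem LevelBanded.almostCommute {lev : Fin N → ℕ} {M : Matrix (Idx n) (Idx m) ℝ}
    (hM : LevelBanded lev M) {b : ℝ} (hb0 : 0 < b) (hb1 : b ≤ 1) {L : ℝ} (hL : ‖M‖ ≤ L) :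
    AlmostCommute (2 * (1 / b - 1) * L) (blockScale fun j => b ^ lev j)
      (blockScale fun j => b ^ lev j) (opOf M) := by
  intro z
  have hL0 : 0 ≤ L := (norm_nonneg _).trans hL
  set D₁ : Vec m →L[ℝ] Vec m := blockScale fun j => b ^ lev j
  set D₂ : Vec n →L[ℝ] Vec n := blockScale fun j => b ^ lev j
  set u := D₁ z with hu
  set c := 1 / b - 1 with hc
  have hc0 : 0 ≤ c := by
    rw [hc, sub_nonneg]; exact one_le_one_div hb0 hb1
  have hcb : (b - 1) ^ 2 ≤ c ^ 2 := by
    have h1 : 1 - b ≤ c := by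
      have : c - (1 - b) = (1 - b) ^ 2 / b := by rw [hc]; field_simp
      have h2 : 0 ≤ (1 - b) ^ 2 / b := by positivity
      linarith
    have h2 := pow_le_pow_left₀ (by linarith : 0 ≤ 1 - b) h1 2
    nlinarith
  set X := D₂ (opOf M z) - opOf M u with hX
  let P : ℕ → Vec m →L[ℝ] Vec m := fun k => blockScale fun j => if lev j = k + 1 then 1 else 0
  let Q : ℕ → Vec m →L[ℝ] Vec m := fun k => blockScale fun j => if lev j + 1 = k then 1 else 0
  let R : ℕ → Vec n →L[ℝ] Vec n := fun k => blockScale fun j => if lev j = k then 1 else 0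
  have hcoord : ∀ k, R k X = R k (opOf M (c • P k u + (b - 1) • Q k u)) := by
    intro k
    ext p
    simp only [R, blockScale_apply]
    split_ifs with hk
    swap
    · simp
    rw [one_mul, one_mul, hX]
    have e1 : (D₂ (opOf M z) - opOf M u) p = b ^ lev p.1 * opOf M z p - opOf M u p := rfl
    rw [e1, opOf_apply, opOf_apply, opOf_apply, Finset.mul_sum, ← Finset.sum_sub_distrib]
    refine Finset.sum_congr rfl fun q _ => ?_
    have e2 : u q = b ^ lev q.1 * z q := rfl
    have e3 : (c • P k u + (b - 1) • Q k u) q =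
        c * ((if lev q.1 = k + 1 then 1 else 0) * u q) +
          (b - 1) * ((if lev q.1 + 1 = k then 1 else 0) * u q) := rfl
    rw [e3, e2, hk]
    by_cases hMpq : M p q = 0
    · rw [hMpq]; ring
    have hlev := hM p q hMpq
    rw [hk] at hlev
    rcases (by omega : lev q.1 = k ∨ lev q.1 = k + 1 ∨ lev q.1 + 1 = k) with h | h | h
    · rw [if_neg (by omega), if_neg (by omega), h]; ring
    · rw [if_pos h, if_neg (by omega), h, hc]; field_simp; ring
    · rw [if_neg (by omega), if_pos h, ← h]; ring
  have hR : ∀ k (x : Vec n), ‖R k x‖ ≤ ‖x‖ := by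
    intro k x
    refine (norm_blockScale_le zero_le_one (fun j => ?_) x).trans_eq (one_mul _)
    split_ifs <;> simp
  obtain ⟨K, hK⟩ : ∃ K, ∀ j, lev j < K := by
    refine ⟨Finset.univ.sup lev + 1, fun j => Nat.lt_succ_of_le (Finset.le_sup (Finset.mem_univ j))⟩
  have hlevel : ∀ k, ‖R k X‖ ^ 2 ≤ L ^ 2 * (2 * c ^ 2 * ‖P k u‖ ^ 2 + 2 * c ^ 2 * ‖Q k u‖ ^ 2) := by
    intro k
    rw [hcoord k]
    have h1 : ‖R k (opOf M (c • P k u + (b - 1) • Q k u))‖ ≤ L * ‖c • P k u + (b - 1) • Q k u‖ := by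
      refine (hR k _).trans (((opOf M).le_opNorm _).trans ?_)
      rw [norm_opOf]
      exact mul_le_mul_of_nonneg_right hL (norm_nonneg _)
    have h2 := pow_le_pow_left₀ (norm_nonneg _) h1 2
    rw [mul_pow] at h2
    refine h2.trans (mul_le_mul_of_nonneg_left ?_ (sq_nonneg L))
    have h3 : ‖c • P k u + (b - 1) • Q k u‖ ^ 2 ≤
        2 * (c ^ 2 * ‖P k u‖ ^ 2) + 2 * ((b - 1) ^ 2 * ‖Q k u‖ ^ 2) := by
      have h4 := pow_le_pow_left₀ (norm_nonneg _) (norm_add_le (c • P k u) ((b - 1) • Q k u)) 2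
      have h5 : ‖c • P k u‖ ^ 2 = c ^ 2 * ‖P k u‖ ^ 2 := by
        rw [norm_smul, mul_pow, Real.norm_eq_abs, sq_abs]
      have h6 : ‖(b - 1) • Q k u‖ ^ 2 = (b - 1) ^ 2 * ‖Q k u‖ ^ 2 := by
        rw [norm_smul, mul_pow, Real.norm_eq_abs, sq_abs]
      rw [← h5, ← h6]
      nlinarith [sq_nonneg (‖c • P k u‖ - ‖(b - 1) • Q k u‖)]
    have h4 := mul_le_mul_of_nonneg_right hcb (sq_nonneg ‖Q k u‖)
    linarith
  refine le_of_sq_le_sq ?_ (by positivity)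
  have hsum : ‖X‖ ^ 2 ≤ L ^ 2 * (2 * c ^ 2 * ‖u‖ ^ 2 + 2 * c ^ 2 * ‖u‖ ^ 2) := by
    rw [norm_sq_eq_sum_level lev hK X]
    refine (Finset.sum_le_sum fun k _ => hlevel k).trans ?_
    rw [← Finset.mul_sum, Finset.sum_add_distrib, ← Finset.mul_sum, ← Finset.mul_sum]
    have h1 := sum_norm_sq_level_le (fun a k => a = k + 1) (fun a k k' h h' => by omega) lev K u
    have h2 := sum_norm_sq_level_le (fun a k => a + 1 = k) (fun a k k' h h' => by omega) lev K u
    refine mul_le_mul_of_nonneg_left (add_le_add ?_ ?_) (sq_nonneg L)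
    · exact mul_le_mul_of_nonneg_left h1 (by positivity)
    · exact mul_le_mul_of_nonneg_left h2 (by positivity)
  calc ‖X‖ ^ 2 ≤ _ := hsum
    _ = _ := by ring

open Classical in
/-- The operator that keeps the blocks within distance `κ` of `i`. -/
def ballProj (G : SimpleGraph (Fin N)) (i : Fin N) (κ : ℕ) : Vec n →L[ℝ] Vec n :=
  blockScale fun j => if G.edist i j ≤ (κ : ℕ∞) then 1 else 0

theorem truncVec_eq (G : SimpleGraph (Fin N)) (i : Fin N) (κ : ℕ) (x : Vec n) :
    truncVec G i κ x = ballProj G i κ x := by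
  ext p
  simp only [ballProj, blockScale_apply, truncVec]
  split_ifs <;> simp

theorem opOf_truncMat (G : SimpleGraph (Fin N)) (i : Fin N) (κ : ℕ) (M : Matrix (Idx n) (Idx m) ℝ) :
    opOf (truncMat G i κ M) = ballProj G i κ ∘L opOf M := by
  ext x p
  simp only [ContinuousLinearMap.comp_apply, ballProj, blockScale_apply, opOf_apply, truncMat,
    Matrix.of_apply]
  split_ifs <;> simp

theorem norm_ballProj_le (G : SimpleGraph (Fin N)) (i : Fin N) (κ : ℕ) (x : Vec n) :
    ‖ballProj G i κ x‖ ≤ ‖x‖ := by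
  classical
  refine (norm_blockScale_le zero_le_one (fun j => ?_) x).trans_eq (one_mul _)
  split_ifs <;> simp

theorem norm_truncMat_le (G : SimpleGraph (Fin N)) (i : Fin N) (κ : ℕ)
    (M : Matrix (Idx n) (Idx m) ℝ) : ‖truncMat G i κ M‖ ≤ ‖M‖ := by
  rw [← norm_opOf, ← norm_opOf, opOf_truncMat]
  refine ContinuousLinearMap.opNorm_le_bound _ (norm_nonneg _) fun x => ?_
  exact (norm_ballProj_le _ _ _ _).trans (ContinuousLinearMap.le_opNorm _ _)

/-- The distance to `i`, capped at `κ`. -/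
def ballLevel (G : SimpleGraph (Fin N)) (i : Fin N) (κ : ℕ) (j : Fin N) : ℕ :=
  (min (G.edist i j) κ).toNat

theorem coe_ballLevel (G : SimpleGraph (Fin N)) (i : Fin N) (κ : ℕ) (j : Fin N) :
    (ballLevel G i κ j : ℕ∞) = min (G.edist i j) κ :=
  ENat.natCast_toNat (ne_top_of_le_ne_top (ENat.natCast_ne_top κ) (min_le_right _ _))

theorem ballLevel_self (G : SimpleGraph (Fin N)) (i : Fin N) (κ : ℕ) : ballLevel G i κ i = 0 := by
  simp [ballLevel]

theorem ballLevel_of_not_le {G : SimpleGraph (Fin N)} {i : Fin N} {κ : ℕ} {j : Fin N}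
    (h : ¬ G.edist i j ≤ κ) : ballLevel G i κ j = κ := by
  rw [ballLevel, min_eq_right (le_of_not_ge h)]; rfl

theorem ballLevel_le_of_adj {G : SimpleGraph (Fin N)} (i : Fin N) (κ : ℕ) {j l : Fin N}
    (h : G.Adj j l) : ballLevel G i κ l ≤ ballLevel G i κ j + 1 := by
  have h1 : G.edist i l ≤ G.edist i j + 1 := by
    have := G.edist_triangle (u := i) (v := j) (w := l)
    rwa [SimpleGraph.edist_eq_one_iff_adj.2 h] at this
  have h2 : ((ballLevel G i κ l : ℕ) : ℕ∞) ≤ ((ballLevel G i κ j + 1 : ℕ) : ℕ∞) := by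
    rw [Nat.cast_add, Nat.cast_one, coe_ballLevel, coe_ballLevel]
    rcases le_total (G.edist i j) κ with hj | hj
    · rw [min_eq_left hj]; exact (min_le_left _ _).trans h1
    · rw [min_eq_right hj]; exact (min_le_right _ _).trans le_self_add
  exact_mod_cast h2

theorem IsNetworked.levelBanded {G : SimpleGraph (Fin N)} {M : Matrix (Idx n) (Idx m) ℝ}
    (hM : IsNetworked G M) (i : Fin N) (κ : ℕ) : LevelBanded (ballLevel G i κ) M := by
  intro p q hpq
  by_cases h : p.1 = q.1
  · rw [h]; omega
  by_cases ha : G.Adj p.1 q.1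
  · exact ⟨ballLevel_le_of_adj i κ ha.symm, ballLevel_le_of_adj i κ ha⟩
  · exact absurd (hM p q h ha) hpq

theorem LevelBanded.truncMat {lev : Fin N → ℕ} {M : Matrix (Idx n) (Idx m) ℝ}
    (hM : LevelBanded lev M) (G : SimpleGraph (Fin N)) (i : Fin N) (κ : ℕ) :
    LevelBanded lev (truncMat G i κ M) := by
  intro p q hpq
  refine hM p q fun h => hpq ?_
  simp [DTPC.truncMat, h]

/-- Geometric weights decaying away from `i`, constant outside the ball of radius `κ`. -/
def ballWeight (G : SimpleGraph (Fin N)) (i : Fin N) (κ : ℕ) (b : ℝ) : Vec n →L[ℝ] Vec n :=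
  blockScale fun j => b ^ ballLevel G i κ j

theorem ballWeight_sub_ballProj (G : SimpleGraph (Fin N)) (i : Fin N) (κ : ℕ) (b : ℝ) (x : Vec n) :
    ballWeight G i κ b (x - ballProj G i κ x) = b ^ κ • (x - ballProj G i κ x) := by
  classical
  ext p
  have e1 : (x - ballProj G i κ x) p = x p - (if G.edist i p.1 ≤ κ then 1 else 0) * x p := rfl
  have e2 : (b ^ κ • (x - ballProj G i κ x)) p = b ^ κ * (x - ballProj G i κ x) p := rfl
  rw [ballWeight, blockScale_apply, e2, e1]
  split_ifs with h
  · simp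
  · rw [ballLevel_of_not_le h]

theorem norm_sub_ballProj_le (G : SimpleGraph (Fin N)) (i : Fin N) (κ : ℕ) (x : Vec n) :
    ‖x - ballProj G i κ x‖ ≤ ‖x‖ := by
  classical
  have : x - ballProj G i κ x = blockScale (fun j => if G.edist i j ≤ (κ : ℕ∞) then 0 else 1) x := by
    ext p
    have e1 : (x - ballProj G i κ x) p = x p - (if G.edist i p.1 ≤ κ then 1 else 0) * x p := rfl
    rw [e1, blockScale_apply]
    split_ifs <;> simp
  rw [this]
  refine (norm_blockScale_le zero_le_one (fun j => ?_) x).trans_eq (one_mul _)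
  split_ifs <;> simp

theorem norm_block_le_ballWeight (G : SimpleGraph (Fin N)) (i : Fin N) (κ : ℕ) (b : ℝ) (x : Vec n) :
    ‖block x i‖ ≤ ‖ballWeight G i κ b x‖ := by
  have : block x i = block (ballWeight G i κ b x) i := by
    rw [ballWeight, block_blockScale, ballLevel_self, pow_zero, one_smul]
  rw [this]
  exact norm_block_le _ i

end Levels

section Pairs

theorem adjoint_opOf_norm_le {ι κ : Type} [Fintype ι] [DecidableEq ι] [Fintype κ] [DecidableEq κ]
    {M : Matrix ι κ ℝ} {L : ℝ} (hM : ‖M‖ ≤ L) : ‖M.transpose‖ ≤ L := by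
  rw [← norm_opOf, ← adjoint_opOf, LinearIsometryEquiv.norm_map, norm_opOf]
  exact hM

theorem AlmostCommute.mono {E F : Type} [NormedAddCommGroup E] [InnerProductSpace ℝ E]
    [NormedAddCommGroup F] [InnerProductSpace ℝ F] {η η' : ℝ} {D₁ : E →L[ℝ] E} {D₂ : F →L[ℝ] F}
    {A : E →L[ℝ] F} (hA : AlmostCommute η D₁ D₂ A) (h : η ≤ η') : AlmostCommute η' D₁ D₂ A :=
  fun z => (hA z).trans (mul_le_mul_of_nonneg_right h (norm_nonneg _))

theorem SlowWeight.mono {η η' : ℝ} {ω : ℕ → ℝ} (hω : SlowWeight η ω) (h : η ≤ η') :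
    SlowWeight η' ω :=
  ⟨hω.pos, fun τ => (hω.left τ).trans (mul_le_mul_of_nonneg_right h (hω.pos _).le),
    fun τ => (hω.right τ).trans (mul_le_mul_of_nonneg_right h (hω.pos _).le)⟩

/-- Distance of two time indices. -/
def timeDist (τ m : ℕ) : ℕ := ((τ : ℤ) - (m : ℤ)).natAbs

theorem slowWeight_pow_timeDist {b : ℝ} (hb0 : 0 < b) (hb1 : b ≤ 1) (m : ℕ) :
    SlowWeight (1 / b - 1) fun τ => b ^ timeDist τ m := by
  have key : ∀ X Y : ℝ, 0 < Y → X = b * Y →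
      |X - Y| ≤ (1 / b - 1) * Y ∧ |X - Y| ≤ (1 / b - 1) * X := by
    intro X Y hY hX
    have h1 : |X - Y| = (1 - b) * Y := by
      rw [hX, abs_of_nonpos (by nlinarith)]; ring
    have h2 : (1 / b - 1) * X = (1 - b) * Y := by rw [hX]; field_simp
    have h3 : X ≤ Y := by rw [hX]; nlinarith
    have h4 : 0 ≤ 1 / b - 1 := by rw [sub_nonneg]; exact one_le_one_div hb0 hb1
    refine ⟨?_, by rw [h1, h2]⟩
    rw [h1, ← h2]
    exact mul_le_mul_of_nonneg_left h3 h4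
  have hcase : ∀ τ, timeDist (τ + 1) m = timeDist τ m + 1 ∨ timeDist τ m = timeDist (τ + 1) m + 1 := by
    intro τ
    simp only [timeDist]
    omega
  refine ⟨fun τ => by positivity, fun τ => ?_, fun τ => ?_⟩
  · rcases hcase τ with h | h
    · exact (key _ _ (by positivity) (by rw [h, pow_succ']) ).1
    · rw [abs_sub_comm]
      exact (key _ _ (by positivity) (by rw [h, pow_succ']) ).2
  · rcases hcase τ with h | h
    · exact (key _ _ (by positivity) (by rw [h, pow_succ']) ).2
    · rw [abs_sub_comm]
      exact (key _ _ (by positivity) (by rw [h, pow_succ']) ).1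

theorem slowWeight_one {b : ℝ} (hb0 : 0 < b) (hb1 : b ≤ 1) : SlowWeight (1 / b - 1) fun _ => 1 := by
  have h4 : 0 ≤ 1 / b - 1 := by rw [sub_nonneg]; exact one_le_one_div hb0 hb1
  refine ⟨fun _ => one_pos, fun τ => ?_, fun τ => ?_⟩ <;> simpa using h4

/-- Difference of two trajectories, with prescribed endpoint values removed. -/
def interiorDiff {E : Type} [NormedAddCommGroup E] (con : Bool) (h : ℕ) (y y' : ℕ → E) (τ : ℕ) : E :=
  if τ = 0 ∨ (con = true ∧ τ = h) then 0 else y τ - y' τ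

/-- Effective disturbance of the difference of two trajectories. -/
def diffSource {E : Type} [NormedAddCommGroup E] [InnerProductSpace ℝ E] (A : E →L[ℝ] E)
    (con : Bool) (h : ℕ) (y y' ζ ζ' : ℕ → E) (τ : ℕ) : E :=
  (ζ τ - ζ' τ) + (if τ = 0 then A (y 0 - y' 0) else 0) -
    (if con = true ∧ τ + 1 = h then y h - y' h else 0)

/-- Weighted comparison of two solutions of optimality systems with the same dynamics. -/
theorem exists_pair_estimate (L μ M : ℝ) (hL : 0 ≤ L) (hμ : 0 < μ) (hM : 0 < M) :
    ∃ b C : ℝ, 1 / 2 ≤ b ∧ b < 1 ∧ 0 < C ∧ (∀ {N : ℕ} {n m : Fin N → ℕ}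
      {A : Matrix (Idx n) (Idx m) ℝ} {lev : Fin N → ℕ}, ‖A‖ ≤ L → LevelBanded lev A →
      AlmostCommute 1 (blockScale fun j => b ^ lev j) (blockScale fun j => b ^ lev j) (opOf A)) ∧
      ∀ {N : ℕ} {n m : Fin N → ℕ} {A : Matrix (Idx n) (Idx n) ℝ} {B : Matrix (Idx n) (Idx m) ℝ}
      {con : Bool} {h : ℕ} {lev : Fin N → ℕ} {ω : ℕ → ℝ} {G : ℕ → Vec n → Vec n}
      {H : ℕ → Vec m → Vec m} {x x' : Vec n} {ζ ζ' α α' y y' p p' : ℕ → Vec n}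
      {s s' v v' : ℕ → Vec m},
      ‖A‖ ≤ L → ‖B‖ ≤ L → DualBound (opOf A) (opOf B) con h M →
      LevelBanded lev A → LevelBanded lev B → SlowWeight (1 / b - 1) ω →
      (∀ τ ≤ h, BlockMonotone μ L (G τ)) → (∀ τ < h, BlockMonotone μ L (H τ)) →
      KKT (opOf A) (opOf B) con h G H x ζ α s y v p →
      KKT (opOf A) (opOf B) con h G H x' ζ' α' s' y' v' p' →
      ∑ τ ∈ Finset.range h, ω (τ + 1) ^ 2 *
          (‖blockScale (fun j => b ^ lev j) (interiorDiff con h y y' (τ + 1))‖ ^ 2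
            + ‖blockScale (fun j => b ^ lev j) (v τ - v' τ)‖ ^ 2
            + ‖blockScale (fun j => b ^ lev j) (p τ - p' τ)‖ ^ 2) ≤
        C * ∑ τ ∈ Finset.range h, ω (τ + 1) ^ 2 *
          (‖blockScale (fun j => b ^ lev j) (diffSource (opOf A) con h y y' ζ ζ' τ)‖ ^ 2
            + ‖blockScale (fun j => b ^ lev j)
                (if con = true ∧ τ + 1 = h then 0 else α τ - α' τ)‖ ^ 2
            + ‖blockScale (fun j => b ^ lev j) (s τ - s' τ)‖ ^ 2) := by
  obtain ⟨η, C, hη0, hη1, hC, key⟩ := exists_weighted_estimate L μ M hL hμ hM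
  set b : ℝ := 1 / (1 + η / (2 * L + 1)) with hb
  have hq0 : 0 < η / (2 * L + 1) := by positivity
  have hq1 : η / (2 * L + 1) ≤ 1 := by
    rw [div_le_one (by positivity)]; linarith
  have hb0 : 0 < b := by positivity
  have hbinv : 1 / b - 1 = η / (2 * L + 1) := by rw [hb, one_div_one_div]; ring
  have hb1 : b < 1 := by
    rw [hb, div_lt_one (by positivity)]; linarith
  have hbhalf : 1 / 2 ≤ b := one_div_le_one_div_of_le (by positivity) (by linarith)
  have hbL : 2 * (1 / b - 1) * L ≤ η := by
    rw [hbinv, mul_div_assoc', div_mul_eq_mul_div, div_le_iff₀ (by positivity)]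
    nlinarith
  have hbη : 1 / b - 1 ≤ η := by
    rw [hbinv, div_le_iff₀ (by positivity)]
    nlinarith
  clear_value b
  refine ⟨b, C, hbhalf, hb1, hC, fun hA hl => (hl.almostCommute hb0 hb1.le hA).mono
    (hbL.trans hη1), ?_⟩
  intro N n m A B con h lev ω G H x x' ζ ζ' α α' y y' p p' s s' v v' hA hB hdual lA lB hω hG hH K K'
  set D : Vec n →L[ℝ] Vec n := blockScale fun j => b ^ lev j with hD
  set D' : Vec m →L[ℝ] Vec m := blockScale fun j => b ^ lev j with hD'
  have cA : AlmostCommute η D D (opOf A) := (lA.almostCommute hb0 hb1.le hA).mono hbL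
  have cB : AlmostCommute η D' D (opOf B) := (lB.almostCommute hb0 hb1.le hB).mono hbL
  have cA' : AlmostCommute η D D (opOf A).adjoint := by
    rw [adjoint_opOf]
    exact (lA.transpose.almostCommute hb0 hb1.le (adjoint_opOf_norm_le hA)).mono hbL
  have cB' : AlmostCommute η D D' (opOf B).adjoint := by
    rw [adjoint_opOf]
    exact (lB.transpose.almostCommute hb0 hb1.le (adjoint_opOf_norm_le hB)).mono hbL
  refine key (opOf A) (opOf B) con h D D' ω (interiorDiff con h y y') (fun τ => p τ - p' τ)
    (fun τ => if con = true ∧ τ + 1 = h then 0 else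
      G (τ + 1) (y (τ + 1)) - G (τ + 1) (y' (τ + 1)))
    (diffSource (opOf A) con h y y' ζ ζ')
    (fun τ => if con = true ∧ τ + 1 = h then 0 else α τ - α' τ)
    (fun τ => v τ - v' τ) (fun τ => H τ (v τ) - H τ (v' τ)) (fun τ => s τ - s' τ)
    hdual (by rwa [norm_opOf]) (by rwa [norm_opOf]) (hω.mono hbη) cA cB cA' cB'
    (by simp [interiorDiff]) (fun hc => by simp [interiorDiff, hc]) (by simp [K.final, K'.final])
    ?_ ?_ ?_ ?_ ?_ ?_ ?_
  · intro τ hτ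
    have e0 : y (τ + 1) - y' (τ + 1) =
        opOf A (y τ - y' τ) + opOf B (v τ - v' τ) + (ζ τ - ζ' τ) := by
      rw [K.dyn τ hτ, K'.dyn τ hτ, map_sub, map_sub]; abel
    have e1 : opOf A (interiorDiff con h y y' τ) + (if τ = 0 then opOf A (y 0 - y' 0) else 0) =
        opOf A (y τ - y' τ) := by
      unfold interiorDiff
      by_cases h0 : τ = 0
      · simp [h0]
      · rw [if_neg (by rintro (h | ⟨-, h⟩) <;> omega), if_neg h0, add_zero]
    have e2 : interiorDiff con h y y' (τ + 1) = (y (τ + 1) - y' (τ + 1)) -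
        (if con = true ∧ τ + 1 = h then y h - y' h else 0) := by
      unfold interiorDiff
      by_cases h0 : con = true ∧ τ + 1 = h
      · rw [if_pos (Or.inr h0), if_pos h0, h0.2, sub_self]
      · rw [if_neg (by simpa using h0), if_neg h0, sub_zero]
    rw [e2, e0, ← e1, diffSource]
    abel
  · intro τ hτ
    unfold costateDefect
    split_ifs with hc
    · exact add_zero 0
    · change (G (τ + 1) (y (τ + 1)) - G (τ + 1) (y' (τ + 1))) +
        ((p τ - p' τ) - (opOf A).adjoint (p (τ + 1) - p' (τ + 1))) = _
      rw [← K.costate τ hτ hc, ← K'.costate τ hτ hc, map_sub]; abel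
  · intro τ hτ
    simp only [K.input τ hτ, K'.input τ hτ, map_sub]; abel
  · intro τ hτ
    by_cases hc : con = true ∧ τ + 1 = h
    · simp [interiorDiff, hc]
    · simp only [interiorDiff, if_neg hc, Nat.add_eq_zero_iff, one_ne_zero, and_false, false_or]
      exact (hG (τ + 1) hτ).scale_monotone _ _ _
  · intro τ hτ
    by_cases hc : con = true ∧ τ + 1 = h
    · simp [interiorDiff, hc]
    · simp only [interiorDiff, if_neg hc, Nat.add_eq_zero_iff, one_ne_zero, and_false, false_or]
      exact (hG (τ + 1) hτ).scale_lipschitz hL _ _ _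
  · intro τ hτ
    exact (hH τ hτ).scale_monotone _ _ _
  · intro τ hτ
    exact (hH τ hτ).scale_lipschitz hL _ _ _

theorem levelBanded_zero {N : ℕ} {n m : Fin N → ℕ} (M : Matrix (Idx n) (Idx m) ℝ) :
    LevelBanded (fun _ => 0) M := fun _ _ _ => ⟨Nat.zero_le _, Nat.zero_le _⟩

theorem blockScale_one {N : ℕ} {n : Fin N → ℕ} (b : ℝ) (x : Vec n) :
    blockScale (fun _ => b ^ 0) x = x := by
  ext p; simp [blockScale_apply]

theorem sqrt_weighted_sum_le (h : ℕ) (w r a c : ℕ → ℝ) (hw : ∀ τ, 0 ≤ w τ) (hr : ∀ τ, 0 ≤ r τ)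
    (ha : ∀ τ, 0 ≤ a τ) (hc : ∀ τ, 0 ≤ c τ) :
    ∑ τ ∈ Finset.range h, w τ ^ 2 * (r τ ^ 2 + a τ ^ 2 + c τ ^ 2) ≤
      (∑ τ ∈ Finset.range h, w τ * (r τ + a τ + c τ)) ^ 2 := by
  refine le_trans (Finset.sum_le_sum fun τ _ => ?_) (Finset.sum_sq_le_sq_sum_of_nonneg
    fun τ _ => mul_nonneg (hw τ) (add_nonneg (add_nonneg (hr τ) (ha τ)) (hc τ)))
  rw [mul_pow]
  refine mul_le_mul_of_nonneg_left ?_ (sq_nonneg _)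
  have h1 := mul_nonneg (hr τ) (ha τ)
  have h2 := mul_nonneg (hr τ) (hc τ)
  have h3 := mul_nonneg (ha τ) (hc τ)
  linarith [add_sq (r τ + a τ) (c τ), add_sq (r τ) (a τ), add_mul (r τ) (a τ) (c τ)]

end Pairs

/-- The conclusion of `exists_pair_estimate`, as a property of the constants. -/
structure PairConstants (L μ M b C : ℝ) : Prop where
  hL : 0 ≤ L
  hμ : 0 < μ
  half_le : 1 / 2 ≤ b
  lt_one : b < 1
  pos : 0 < C
  commute : ∀ {N : ℕ} {n m : Fin N → ℕ}
      {A : Matrix (Idx n) (Idx m) ℝ} {lev : Fin N → ℕ}, ‖A‖ ≤ L → LevelBanded lev A →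
      AlmostCommute 1 (blockScale fun j => b ^ lev j) (blockScale fun j => b ^ lev j) (opOf A)
  estimate : ∀ {N : ℕ} {n m : Fin N → ℕ} {A : Matrix (Idx n) (Idx n) ℝ}
      {B : Matrix (Idx n) (Idx m) ℝ}
      {con : Bool} {h : ℕ} {lev : Fin N → ℕ} {ω : ℕ → ℝ} {G : ℕ → Vec n → Vec n}
      {H : ℕ → Vec m → Vec m} {x x' : Vec n} {ζ ζ' α α' y y' p p' : ℕ → Vec n}
      {s s' v v' : ℕ → Vec m},
      ‖A‖ ≤ L → ‖B‖ ≤ L → DualBound (opOf A) (opOf B) con h M →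
      LevelBanded lev A → LevelBanded lev B → SlowWeight (1 / b - 1) ω →
      (∀ τ ≤ h, BlockMonotone μ L (G τ)) → (∀ τ < h, BlockMonotone μ L (H τ)) →
      KKT (opOf A) (opOf B) con h G H x ζ α s y v p →
      KKT (opOf A) (opOf B) con h G H x' ζ' α' s' y' v' p' →
      ∑ τ ∈ Finset.range h, ω (τ + 1) ^ 2 *
          (‖blockScale (fun j => b ^ lev j) (interiorDiff con h y y' (τ + 1))‖ ^ 2
            + ‖blockScale (fun j => b ^ lev j) (v τ - v' τ)‖ ^ 2
            + ‖blockScale (fun j => b ^ lev j) (p τ - p' τ)‖ ^ 2) ≤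
        C ^ 2 * ∑ τ ∈ Finset.range h, ω (τ + 1) ^ 2 *
          (‖blockScale (fun j => b ^ lev j) (diffSource (opOf A) con h y y' ζ ζ' τ)‖ ^ 2
            + ‖blockScale (fun j => b ^ lev j)
                (if con = true ∧ τ + 1 = h then 0 else α τ - α' τ)‖ ^ 2
            + ‖blockScale (fun j => b ^ lev j) (s τ - s' τ)‖ ^ 2)

theorem exists_pairConstants (L μ M : ℝ) (hL : 0 ≤ L) (hμ : 0 < μ) (hM : 0 < M) :
    ∃ b C : ℝ, PairConstants L μ M b C := by
  obtain ⟨b, C, h1, h2, h3, h4, h5⟩ := exists_pair_estimate L μ M hL hμ hM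
  refine ⟨b, Real.sqrt C, hL, hμ, h1, h2, Real.sqrt_pos.2 h3, h4, ?_⟩
  rw [Real.sq_sqrt h3.le]
  exact h5

namespace PairConstants

variable {L μ M b C : ℝ} {N : ℕ} {n m : Fin N → ℕ} {A : Matrix (Idx n) (Idx n) ℝ}
  {B : Matrix (Idx n) (Idx m) ℝ} {con : Bool} {h : ℕ} {G : ℕ → Vec n → Vec n}
  {H : ℕ → Vec m → Vec m} {x x' : Vec n} {ζ ζ' α α' y y' p p' : ℕ → Vec n} {s s' v v' : ℕ → Vec m}

theorem b_pos (hC : PairConstants L μ M b C) : 0 < b := by linarith [hC.half_le]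

/-- Pointwise comparison of two solutions with exponentially decaying influence of the sources. -/
theorem pointwise (hC : PairConstants L μ M b C) (hA : ‖A‖ ≤ L) (hB : ‖B‖ ≤ L)
    (hdual : DualBound (opOf A) (opOf B) con h M)
    (hG : ∀ τ ≤ h, BlockMonotone μ L (G τ)) (hH : ∀ τ < h, BlockMonotone μ L (H τ))
    (K : KKT (opOf A) (opOf B) con h G H x ζ α s y v p)
    (K' : KKT (opOf A) (opOf B) con h G H x' ζ' α' s' y' v' p') {k : ℕ} (hk : k < h) :
    ‖interiorDiff con h y y' (k + 1)‖ ≤ C * ∑ τ ∈ Finset.range h, b ^ timeDist τ k *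
        (‖diffSource (opOf A) con h y y' ζ ζ' τ‖ +
          ‖if con = true ∧ τ + 1 = h then 0 else α τ - α' τ‖ + ‖s τ - s' τ‖) ∧
    ‖v k - v' k‖ ≤ C * ∑ τ ∈ Finset.range h, b ^ timeDist τ k *
        (‖diffSource (opOf A) con h y y' ζ ζ' τ‖ +
          ‖if con = true ∧ τ + 1 = h then 0 else α τ - α' τ‖ + ‖s τ - s' τ‖) ∧
    ‖p k - p' k‖ ≤ C * ∑ τ ∈ Finset.range h, b ^ timeDist τ k *
        (‖diffSource (opOf A) con h y y' ζ ζ' τ‖ +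
          ‖if con = true ∧ τ + 1 = h then 0 else α τ - α' τ‖ + ‖s τ - s' τ‖) := by
  have hb := hC.b_pos
  have h1 := hC.estimate hA hB hdual (levelBanded_zero A) (levelBanded_zero B)
    (slowWeight_pow_timeDist hb hC.lt_one.le (k + 1)) hG hH K K'
  have hsucc : ∀ τ, timeDist (τ + 1) (k + 1) = timeDist τ k := by
    intro τ; simp only [timeDist]; omega
  simp only [blockScale_one, hsucc] at h1
  have h2 := sqrt_weighted_sum_le h (fun τ => b ^ timeDist τ k)
    (fun τ => ‖diffSource (opOf A) con h y y' ζ ζ' τ‖)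
    (fun τ => ‖if con = true ∧ τ + 1 = h then 0 else α τ - α' τ‖) (fun τ => ‖s τ - s' τ‖)
    (fun τ => by positivity) (fun τ => norm_nonneg _) (fun τ => norm_nonneg _)
    (fun τ => norm_nonneg _)
  set R := ∑ τ ∈ Finset.range h, b ^ timeDist τ k *
        (‖diffSource (opOf A) con h y y' ζ ζ' τ‖ +
          ‖if con = true ∧ τ + 1 = h then 0 else α τ - α' τ‖ + ‖s τ - s' τ‖) with hR
  have hR0 : 0 ≤ R := Finset.sum_nonneg fun τ _ => by positivity
  have h3 := h1.trans (mul_le_mul_of_nonneg_left h2 (sq_nonneg C))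
  rw [← mul_pow] at h3
  have h4 := (Finset.single_le_sum (f := fun τ => (b ^ timeDist τ k) ^ 2 *
    (‖interiorDiff con h y y' (τ + 1)‖ ^ 2 + ‖v τ - v' τ‖ ^ 2 + ‖p τ - p' τ‖ ^ 2))
    (fun τ _ => by positivity) (Finset.mem_range.2 hk)).trans h3
  have h5 : timeDist k k = 0 := by simp [timeDist]
  simp only [h5, pow_zero, one_pow, one_mul] at h4
  have hCR : 0 ≤ C * R := mul_nonneg hC.pos.le hR0
  refine ⟨le_of_sq_le_sq ?_ hCR, le_of_sq_le_sq ?_ hCR, le_of_sq_le_sq ?_ hCR⟩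
  · nlinarith [sq_nonneg ‖v k - v' k‖, sq_nonneg ‖p k - p' k‖]
  · nlinarith [sq_nonneg ‖interiorDiff con h y y' (k + 1)‖, sq_nonneg ‖p k - p' k‖]
  · nlinarith [sq_nonneg ‖v k - v' k‖, sq_nonneg ‖interiorDiff con h y y' (k + 1)‖]

end PairConstants

section Solutions

variable {N : ℕ} {S : Network N}

/-- State cost gradients of a finite-horizon problem with terminal gradient `g`. -/
def stageGrad (Q : Costs S) (t ℓ : ℕ) (g : Vec S.nx → Vec S.nx) (τ : ℕ) : Vec S.nx → Vec S.nx :=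
  if τ < ℓ then gradient (Q.fSum (t + τ)) else g

/-- Input cost gradients of a finite-horizon problem. -/
def inputGrad (Q : Costs S) (t τ : ℕ) : Vec S.nu → Vec S.nu := gradient (Q.cSum (t + τ + 1))

/-- State costs of a finite-horizon problem with terminal cost `F`. -/
def stageCost (Q : Costs S) (t ℓ : ℕ) (F : Vec S.nx → ℝ) (τ : ℕ) : Vec S.nx → ℝ :=
  if τ < ℓ then Q.fSum (t + τ) else F

theorem gradient_stageCost (Q : Costs S) (t ℓ : ℕ) (F : Vec S.nx → ℝ) (τ : ℕ) :
    gradient (stageCost Q t ℓ F τ) = stageGrad Q t ℓ (gradient F) τ := by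
  unfold stageCost stageGrad
  split_ifs <;> rfl

theorem objective_eq (Q : Costs S) (t ℓ : ℕ) (F : Vec S.nx → ℝ) (y : ℕ → Vec S.nx)
    (v : ℕ → Vec S.nu) :
    objective Q t ℓ F y v = ∑ τ ∈ Finset.range (ℓ + 1), stageCost Q t ℓ F τ (y τ) +
      ∑ τ ∈ Finset.range ℓ, Q.cSum (t + τ + 1) (v τ) := by
  rw [objective, Finset.sum_range_succ]
  have h1 : ∑ τ ∈ Finset.range ℓ, stageCost Q t ℓ F τ (y τ) =
      ∑ τ ∈ Finset.range ℓ, Q.fSum (t + τ) (y τ) :=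
    Finset.sum_congr rfl fun τ hτ => by rw [stageCost, if_pos (Finset.mem_range.1 hτ)]
  have h2 : stageCost Q t ℓ F ℓ = F := by rw [stageCost, if_neg (lt_irrefl _)]
  rw [h1, h2]
  ring

theorem StageCostAssumption.differentiable_stageCost {Q : Costs S} {T : ℕ} {μ L : ℝ}
    (hQ : StageCostAssumption Q T μ L) {t ℓ : ℕ} (ht : t + ℓ ≤ T) {F : Vec S.nx → ℝ}
    (hF : Differentiable ℝ F) (τ : ℕ) : Differentiable ℝ (stageCost Q t ℓ F τ) := by
  unfold stageCost
  split_ifs with h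
  · exact (hQ.wc_f (t + τ) (by omega)).differentiable
  · exact hF

theorem StageCostAssumption.differentiable_cSum {Q : Costs S} {T : ℕ} {μ L : ℝ}
    (hQ : StageCostAssumption Q T μ L) {t ℓ : ℕ} (ht : t + ℓ ≤ T) (τ : ℕ) (hτ : τ < ℓ) :
    Differentiable ℝ (Q.cSum (t + τ + 1)) :=
  (hQ.wc_c (t + τ + 1) (by omega) (by omega)).differentiable

theorem IsSolution.exists_kkt {Q : Costs S} {T : ℕ} {μ L : ℝ} (hQ : StageCostAssumption Q T μ L)
    {t ℓ : ℕ} (ht : t + ℓ ≤ T) {F : Vec S.nx → ℝ} (hF : Differentiable ℝ F)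
    {A : Matrix (Idx S.nx) (Idx S.nx) ℝ} {B : Matrix (Idx S.nx) (Idx S.nu) ℝ} {x : Vec S.nx}
    {ζ y : ℕ → Vec S.nx} {v : ℕ → Vec S.nu} (hs : IsSolution Q A B t ℓ x ζ F y v) :
    ∃ p, KKT (opOf A) (opOf B) false ℓ (stageGrad Q t ℓ (gradient F)) (inputGrad Q t) x ζ 0 0
      y v p := by
  obtain ⟨⟨h0, hdyn⟩, hmin⟩ := hs
  have h1 := stationary_of_minimizer (con := false) (A := opOf A) (B := opOf B)
    (fun τ _ => hQ.differentiable_stageCost ht hF τ) (hQ.differentiable_cSum ht) h0 hdyn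
    (fun y' v' h0' hdyn' _ => by
      rw [← objective_eq, ← objective_eq]
      exact hmin y' v' ⟨h0', hdyn'⟩)
  obtain ⟨p, hp, hc, hi⟩ := exists_multiplier_free h1
  refine ⟨p, h0, hdyn, fun τ hτ _ => ?_, fun τ hτ => ?_, hp⟩
  · rw [← gradient_stageCost]; exact hc τ hτ
  · rw [Pi.zero_apply, add_zero]; exact hi τ hτ

theorem IsTerminalSolution.exists_kkt {Q : Costs S} {T d : ℕ} {μ L σ : ℝ}
    (hQ : StageCostAssumption Q T μ L) (hσ : 0 < σ) (hd : 1 ≤ d)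
    (hc : DualControllable (opOf S.A) (opOf S.B) σ d)
    {t ℓ : ℕ} (hℓ : d ≤ ℓ) (ht : t + ℓ ≤ T) {x z : Vec S.nx}
    {ζ y : ℕ → Vec S.nx} {v : ℕ → Vec S.nu} (hs : IsTerminalSolution Q t ℓ x ζ z y v) :
    ∃ p, KKT (opOf S.A) (opOf S.B) true ℓ (stageGrad Q t ℓ (gradient (Q.fSum (t + ℓ))))
      (inputGrad Q t) x ζ 0 0 y v p := by
  obtain ⟨⟨h0, hdyn⟩, hz, hmin⟩ := hs
  have h1 := stationary_of_minimizer (con := true) (A := opOf S.A) (B := opOf S.B)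
    (fun τ _ => hQ.differentiable_stageCost ht (hQ.wc_f (t + ℓ) ht).differentiable τ)
    (hQ.differentiable_cSum ht) h0 hdyn
    (fun y' v' h0' hdyn' hz' => by
      rw [← objective_eq, ← objective_eq]
      exact hmin y' v' ⟨h0', hdyn'⟩ ((hz' rfl).trans hz))
  obtain ⟨p, hp, hcs, hi⟩ := exists_multiplier_constrained hσ hd hℓ hc h1
  refine ⟨p, h0, hdyn, fun τ hτ hne => ?_, fun τ hτ => ?_, hp⟩
  · rw [← gradient_stageCost]
    exact hcs τ hτ fun h => hne ⟨rfl, h⟩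
  · rw [Pi.zero_apply, add_zero]; exact hi τ hτ

theorem exists_isSolution {Q : Costs S} {T : ℕ} {μ L : ℝ} (hQ : StageCostAssumption Q T μ L)
    (hμ : 0 < μ) {t ℓ : ℕ} (ht : t + ℓ ≤ T) {F : Vec S.nx → ℝ} (hF : Continuous F)
    (hF0 : ∀ z, 0 ≤ F z) (A : Matrix (Idx S.nx) (Idx S.nx) ℝ) (B : Matrix (Idx S.nx) (Idx S.nu) ℝ)
    (x : Vec S.nx) (ζ : ℕ → Vec S.nx) : ∃ y v, IsSolution Q A B t ℓ x ζ F y v := by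
  have h1 : ∀ τ ≤ ℓ, Continuous (stageCost Q t ℓ F τ) := by
    intro τ _
    unfold stageCost
    split_ifs with h
    · exact (hQ.wc_f (t + τ) (by omega)).differentiable.continuous
    · exact hF
  have h2 : ∀ τ ≤ ℓ, ∀ z, 0 ≤ stageCost Q t ℓ F τ z := by
    intro τ _ z
    unfold stageCost
    split_ifs with h
    · exact hQ.nonneg_f (t + τ) (by omega) z
    · exact hF0 z
  obtain ⟨y, v, h0, hdyn, hmin⟩ := exists_minimizer (opOf A) (opOf B) ℓ
    (φ := stageCost Q t ℓ F) (ψ := fun τ => Q.cSum (t + τ + 1)) h1 h2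
    (fun τ hτ => (hQ.differentiable_cSum ht τ hτ).continuous) (half_pos hμ)
    (fun τ hτ u => (hQ.wc_c (t + τ + 1) (by omega) (by omega)).lower_bound
      (hQ.zero_c _ (by omega) (by omega)) (hQ.nonneg_c _ (by omega) (by omega)) u) x ζ
  refine ⟨y, v, ⟨h0, hdyn⟩, fun y' v' hf => ?_⟩
  rw [objective_eq, objective_eq]
  exact hmin y' v' hf.1 hf.2

theorem StageCostAssumption.blockMonotone_stageGrad {Q : Costs S} {T : ℕ} {μ L L' : ℝ}
    (hQ : StageCostAssumption Q T μ L) (hL : L ≤ L') {t ℓ : ℕ} (ht : t + ℓ ≤ T)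
    {g : Vec S.nx → Vec S.nx} (hg : BlockMonotone μ L' g) (τ : ℕ) :
    BlockMonotone μ L' (stageGrad Q t ℓ g τ) := by
  unfold stageGrad
  split_ifs with h
  · exact (blockMonotone_gradient (hQ.wc_f (t + τ) (by omega))).mono hL
  · exact hg

theorem StageCostAssumption.blockMonotone_inputGrad {Q : Costs S} {T : ℕ} {μ L L' : ℝ}
    (hQ : StageCostAssumption Q T μ L) (hL : L ≤ L') {t ℓ : ℕ} (ht : t + ℓ ≤ T) (τ : ℕ)
    (hτ : τ < ℓ) : BlockMonotone μ L' (inputGrad Q t τ) :=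
  (blockMonotone_gradient (hQ.wc_c (t + τ + 1) (by omega) (by omega))).mono hL

theorem StageCostAssumption.stageGrad_zero {Q : Costs S} {T : ℕ} {μ L : ℝ}
    (hQ : StageCostAssumption Q T μ L) {t ℓ : ℕ} (ht : t + ℓ ≤ T)
    {g : Vec S.nx → Vec S.nx} (hg : g 0 = 0) (τ : ℕ) : stageGrad Q t ℓ g τ 0 = 0 := by
  unfold stageGrad
  split_ifs with h
  · exact gradient_zero_of_nonneg (hQ.zero_f _ (by omega)) (hQ.nonneg_f _ (by omega))
  · exact hg

theorem StageCostAssumption.inputGrad_zero {Q : Costs S} {T : ℕ} {μ L : ℝ}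
    (hQ : StageCostAssumption Q T μ L) {t ℓ : ℕ} (ht : t + ℓ ≤ T) (τ : ℕ) (hτ : τ < ℓ) :
    inputGrad Q t τ 0 = 0 :=
  gradient_zero_of_nonneg (hQ.zero_c _ (by omega) (by omega)) (hQ.nonneg_c _ (by omega) (by omega))

theorem differentiable_half_norm_sq {n : Fin N → ℕ} (φ : ℝ) :
    Differentiable ℝ fun z : Vec n => φ / 2 * ‖z‖ ^ 2 :=
  (differentiable_id.norm_sq ℝ).const_mul _

theorem gradient_half_norm_sq {n : Fin N → ℕ} (φ : ℝ) :
    gradient (fun z : Vec n => φ / 2 * ‖z‖ ^ 2) = fun z => φ • z := by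
  funext z
  refine HasGradientAt.gradient ?_
  have h1 := ((hasStrictFDerivAt_norm_sq z).hasFDerivAt.const_mul (φ / 2))
  refine (hasGradientAt_iff_hasFDerivAt).2 (h1.congr_fderiv ?_)
  ext w
  simp
  ring

end Solutions

section Decay

theorem geom_sum_le_inv {b : ℝ} (hb0 : 0 ≤ b) (hb1 : b < 1) (h : ℕ) :
    ∑ τ ∈ Finset.range h, b ^ τ ≤ 1 / (1 - b) := by
  rw [le_div_iff₀ (by linarith)]
  have h1 := mul_neg_geom_sum b h
  have h2 : 0 ≤ b ^ h := by positivity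
  rw [mul_comm] at h1
  linarith

theorem sum_pow_timeDist_le {b : ℝ} (hb0 : 0 ≤ b) (hb1 : b < 1) (h k : ℕ) :
    ∑ τ ∈ Finset.range h, b ^ timeDist τ k ≤ 2 / (1 - b) := by
  have key : ∀ k h : ℕ, ∑ τ ∈ Finset.range h, b ^ timeDist τ k ≤
      1 / (1 - b) + ∑ j ∈ Finset.range k, b ^ (j + 1) := by
    intro k
    induction k with
    | zero =>
      intro h
      simpa [timeDist] using geom_sum_le_inv hb0 hb1 h
    | succ k ih =>
      intro h
      cases h with
      | zero =>
        have : 0 < 1 - b := by linarith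
        rw [Finset.sum_range_zero]
        positivity
      | succ h =>
        rw [Finset.sum_range_succ', Finset.sum_range_succ _ k]
        have e1 : ∀ τ, timeDist (τ + 1) (k + 1) = timeDist τ k := by
          intro τ; simp only [timeDist]; omega
        have e2 : timeDist 0 (k + 1) = k + 1 := by simp only [timeDist]; omega
        simp only [e1, e2]
        linarith [ih h]
  refine (key k h).trans ?_
  have h1 : ∑ j ∈ Finset.range k, b ^ (j + 1) ≤ ∑ j ∈ Finset.range k, b ^ j :=
    Finset.sum_le_sum fun j _ => pow_le_pow_of_le_one hb0 hb1.le (Nat.le_succ j)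
  have h2 := geom_sum_le_inv hb0 hb1 k
  have h3 : 2 / (1 - b) = 1 / (1 - b) + 1 / (1 - b) := by ring
  linarith

theorem kkt_zero {E U : Type} [NormedAddCommGroup E] [InnerProductSpace ℝ E] [CompleteSpace E]
    [NormedAddCommGroup U] [InnerProductSpace ℝ U] [CompleteSpace U] (A : E →L[ℝ] E)
    (B : U →L[ℝ] E) (con : Bool) {h : ℕ} {G : ℕ → E → E} {H : ℕ → U → U}
    (hG : ∀ τ ≤ h, G τ 0 = 0) (hH : ∀ τ < h, H τ 0 = 0) :
    KKT A B con h G H 0 0 0 0 0 0 0 :=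
  ⟨rfl, fun τ _ => by simp, fun τ hτ _ => by simp [hG (τ + 1) hτ], fun τ hτ => by simp [hH τ hτ],
    rfl⟩

theorem KKT.congr_grad {E U : Type} [NormedAddCommGroup E] [InnerProductSpace ℝ E]
    [CompleteSpace E] [NormedAddCommGroup U] [InnerProductSpace ℝ U] [CompleteSpace U]
    {A : E →L[ℝ] E} {B : U →L[ℝ] E} {con : Bool} {h : ℕ} {G G' : ℕ → E → E} {H : ℕ → U → U}
    {x : E} {ζ α α' y p : ℕ → E} {s v : ℕ → U} (K : KKT A B con h G H x ζ α s y v p)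
    (hG : ∀ τ < h, G' (τ + 1) (y (τ + 1)) - α' τ = G (τ + 1) (y (τ + 1)) - α τ) :
    KKT A B con h G' H x ζ α' s y v p :=
  ⟨K.init, K.dyn, fun τ hτ hc => by
    have h1 := K.costate τ hτ hc
    have h2 := hG τ hτ
    rw [← sub_eq_zero] at h1 ⊢
    rw [← h1]
    have h3 : G' (τ + 1) (y (τ + 1)) = G (τ + 1) (y (τ + 1)) - α τ + α' τ := by
      rw [← h2]; abel
    rw [h3]; abel, K.input, K.final⟩

namespace PairConstants

variable {L μ M b C : ℝ} {N : ℕ} {n m : Fin N → ℕ} {A : Matrix (Idx n) (Idx n) ℝ}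
  {B : Matrix (Idx n) (Idx m) ℝ} {con : Bool} {h : ℕ} {G : ℕ → Vec n → Vec n}
  {H : ℕ → Vec m → Vec m} {x x' : Vec n} {ζ ζ' α α' y y' p p' : ℕ → Vec n} {s s' v v' : ℕ → Vec m}

theorem norm_diffSource_le (hA : ‖A‖ ≤ L) (y y' ζ ζ' : ℕ → Vec n) (τ : ℕ) :
    ‖diffSource (opOf A) con h y y' ζ ζ' τ‖ ≤ ‖ζ τ - ζ' τ‖ +
      (if τ = 0 then L * ‖y 0 - y' 0‖ else 0) +
      (if con = true ∧ τ + 1 = h then ‖y h - y' h‖ else 0) := by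
  unfold diffSource
  refine (norm_sub_le _ _).trans (add_le_add ((norm_add_le _ _).trans (add_le_add le_rfl ?_)) ?_)
  · split_ifs
    · refine ((opOf A).le_opNorm _).trans (mul_le_mul_of_nonneg_right ?_ (norm_nonneg _))
      rwa [norm_opOf]
    · rw [norm_zero]
  · split_ifs <;> simp

/-- Size of the solutions of a problem with free terminal state. -/
theorem size (hC : PairConstants L μ M b C) (hA : ‖A‖ ≤ L) (hB : ‖B‖ ≤ L)
    (hdual : DualBound (opOf A) (opOf B) false h M)
    (hG : ∀ τ ≤ h, BlockMonotone μ L (G τ)) (hH : ∀ τ < h, BlockMonotone μ L (H τ))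
    (hG0 : ∀ τ ≤ h, G τ 0 = 0) (hH0 : ∀ τ < h, H τ 0 = 0)
    (K : KKT (opOf A) (opOf B) false h G H x ζ 0 0 y v p) {D : ℝ} (hζ : ∀ τ < h, ‖ζ τ‖ ≤ D)
    {k : ℕ} (hk : k < h) :
    ‖y (k + 1)‖ ≤ C * (L + 2 / (1 - b)) * (b ^ k * ‖x‖ + D) ∧
    ‖v k‖ ≤ C * (L + 2 / (1 - b)) * (b ^ k * ‖x‖ + D) ∧
    ‖p k‖ ≤ C * (L + 2 / (1 - b)) * (b ^ k * ‖x‖ + D) := by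
  have h1 := hC.pointwise hA hB hdual hG hH K (kkt_zero _ _ false hG0 hH0) hk
  have hb := hC.b_pos
  have hb1 : 0 < 1 - b := by linarith [hC.lt_one]
  have hL := hC.hL
  have hD : 0 ≤ D := (norm_nonneg _).trans (hζ k hk)
  have h2 : ∑ τ ∈ Finset.range h, b ^ timeDist τ k *
        (‖diffSource (opOf A) false h y 0 ζ 0 τ‖ +
          ‖if false = true ∧ τ + 1 = h then 0 else (0 : ℕ → Vec n) τ - (0 : ℕ → Vec n) τ‖ +
          ‖(0 : ℕ → Vec m) τ - (0 : ℕ → Vec m) τ‖) ≤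
      (L + 2 / (1 - b)) * (b ^ k * ‖x‖ + D) := by
    have h3 : ∀ τ ∈ Finset.range h, b ^ timeDist τ k *
        (‖diffSource (opOf A) false h y 0 ζ 0 τ‖ +
          ‖if false = true ∧ τ + 1 = h then 0 else (0 : ℕ → Vec n) τ - (0 : ℕ → Vec n) τ‖ +
          ‖(0 : ℕ → Vec m) τ - (0 : ℕ → Vec m) τ‖) ≤
        b ^ timeDist τ k * D + (if τ = 0 then b ^ k * (L * ‖x‖) else 0) := by
      intro τ hτ
      have h4 := norm_diffSource_le (con := false) (h := h) hA y 0 ζ 0 τ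
      have h5 := hζ τ (Finset.mem_range.1 hτ)
      simp only [Pi.zero_apply, sub_zero, Bool.false_eq_true, false_and, if_false, add_zero,
        norm_zero, K.init] at h4 ⊢
      have h6 := mul_le_mul_of_nonneg_left (h4.trans (add_le_add h5 le_rfl))
        (by positivity : 0 ≤ b ^ timeDist τ k)
      refine h6.trans (le_of_eq ?_)
      split_ifs with h0
      · have : timeDist τ k = k := by rw [h0]; simp only [timeDist]; omega
        rw [this]; ring
      · ring
    refine (Finset.sum_le_sum h3).trans ?_
    rw [Finset.sum_add_distrib, ← Finset.sum_mul, Finset.sum_ite_eq' (Finset.range h) 0]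
    have h7 := mul_le_mul_of_nonneg_right (sum_pow_timeDist_le hb.le hC.lt_one h k) hD
    have h8 : (if 0 ∈ Finset.range h then b ^ k * (L * ‖x‖) else 0) ≤ b ^ k * (L * ‖x‖) := by
      split_ifs
      · exact le_rfl
      · positivity
    have h9 : 0 ≤ 2 / (1 - b) * (b ^ k * ‖x‖) := by positivity
    have h10 : 0 ≤ L * D := by positivity
    linarith
  have h3 := mul_le_mul_of_nonneg_left h2 hC.pos.le
  rw [← mul_assoc] at h3
  refine ⟨?_, ?_, ?_⟩
  · have h4 := h1.1.trans h3
    simpa [interiorDiff] using h4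
  · have h4 := h1.2.1.trans h3
    simpa using h4
  · have h4 := h1.2.2.trans h3
    simpa using h4

/-- Decay of the influence of the initial state. -/
theorem initial_decay (hC : PairConstants L μ M b C) (hA : ‖A‖ ≤ L) (hB : ‖B‖ ≤ L)
    (hdual : DualBound (opOf A) (opOf B) false h M)
    (hG : ∀ τ ≤ h, BlockMonotone μ L (G τ)) (hH : ∀ τ < h, BlockMonotone μ L (H τ))
    (K : KKT (opOf A) (opOf B) false h G H x ζ 0 0 y v p)
    (K' : KKT (opOf A) (opOf B) false h G H x' ζ 0 0 y' v' p') {k : ℕ} (hk : k < h) :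
    ‖y (k + 1) - y' (k + 1)‖ ≤ C * L * b ^ k * ‖x - x'‖ ∧
    ‖v k - v' k‖ ≤ C * L * b ^ k * ‖x - x'‖ := by
  have h1 := hC.pointwise hA hB hdual hG hH K K' hk
  have hb := hC.b_pos
  have hL := hC.hL
  have h2 : ∑ τ ∈ Finset.range h, b ^ timeDist τ k *
        (‖diffSource (opOf A) false h y y' ζ ζ τ‖ +
          ‖if false = true ∧ τ + 1 = h then 0 else (0 : ℕ → Vec n) τ - (0 : ℕ → Vec n) τ‖ +
          ‖(0 : ℕ → Vec m) τ - (0 : ℕ → Vec m) τ‖) ≤ L * b ^ k * ‖x - x'‖ := by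
    have h3 : ∀ τ ∈ Finset.range h, b ^ timeDist τ k *
        (‖diffSource (opOf A) false h y y' ζ ζ τ‖ +
          ‖if false = true ∧ τ + 1 = h then 0 else (0 : ℕ → Vec n) τ - (0 : ℕ → Vec n) τ‖ +
          ‖(0 : ℕ → Vec m) τ - (0 : ℕ → Vec m) τ‖) ≤
        (if τ = 0 then b ^ k * (L * ‖x - x'‖) else 0) := by
      intro τ hτ
      have h4 := norm_diffSource_le (con := false) (h := h) hA y y' ζ ζ τ
      simp only [Pi.zero_apply, sub_self, Bool.false_eq_true, false_and, if_false, add_zero,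
        norm_zero, zero_add, K.init, K'.init] at h4 ⊢
      have h6 := mul_le_mul_of_nonneg_left h4 (by positivity : 0 ≤ b ^ timeDist τ k)
      refine h6.trans (le_of_eq ?_)
      split_ifs with h0
      · have : timeDist τ k = k := by rw [h0]; simp only [timeDist]; omega
        rw [this]
      · ring
    refine (Finset.sum_le_sum h3).trans ?_
    rw [Finset.sum_ite_eq' (Finset.range h) 0, if_pos (Finset.mem_range.2 (by omega))]
    linarith
  have h3 := mul_le_mul_of_nonneg_left h2 hC.pos.le
  have h4 : C * (L * b ^ k * ‖x - x'‖) = C * L * b ^ k * ‖x - x'‖ := by ring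
  rw [h4] at h3
  refine ⟨?_, h1.2.1.trans h3⟩
  have h5 := h1.1.trans h3
  simpa [interiorDiff] using h5

/-- Total deviation caused by a change of the initial state. -/
theorem initial_energy (hC : PairConstants L μ M b C) (hA : ‖A‖ ≤ L) (hB : ‖B‖ ≤ L)
    (hdual : DualBound (opOf A) (opOf B) false h M)
    (hG : ∀ τ ≤ h, BlockMonotone μ L (G τ)) (hH : ∀ τ < h, BlockMonotone μ L (H τ))
    (K : KKT (opOf A) (opOf B) false h G H x ζ 0 0 y v p)
    (K' : KKT (opOf A) (opOf B) false h G H x' ζ 0 0 y' v' p') :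
    ∑ τ ∈ Finset.range h, (‖y (τ + 1) - y' (τ + 1)‖ ^ 2 + ‖v τ - v' τ‖ ^ 2) ≤
      C ^ 2 * L ^ 2 * ‖x - x'‖ ^ 2 := by
  have h1 := hC.estimate hA hB hdual (levelBanded_zero A) (levelBanded_zero B)
    (slowWeight_one hC.b_pos hC.lt_one.le) hG hH K K'
  simp only [blockScale_one, one_pow, one_mul] at h1
  have h2 : ∑ τ ∈ Finset.range h, (‖y (τ + 1) - y' (τ + 1)‖ ^ 2 + ‖v τ - v' τ‖ ^ 2) ≤
      ∑ τ ∈ Finset.range h, (‖interiorDiff false h y y' (τ + 1)‖ ^ 2 + ‖v τ - v' τ‖ ^ 2 +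
        ‖p τ - p' τ‖ ^ 2) := by
    refine Finset.sum_le_sum fun τ _ => ?_
    have e : interiorDiff false h y y' (τ + 1) = y (τ + 1) - y' (τ + 1) := by simp [interiorDiff]
    rw [e]
    linarith [sq_nonneg ‖p τ - p' τ‖]
  have h3 : ∑ τ ∈ Finset.range h, (‖diffSource (opOf A) false h y y' ζ ζ τ‖ ^ 2 +
      ‖if false = true ∧ τ + 1 = h then 0 else (0 : ℕ → Vec n) τ - (0 : ℕ → Vec n) τ‖ ^ 2 +
      ‖(0 : ℕ → Vec m) τ - (0 : ℕ → Vec m) τ‖ ^ 2) ≤ L ^ 2 * ‖x - x'‖ ^ 2 := by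
    have h4 : ∀ τ ∈ Finset.range h, (‖diffSource (opOf A) false h y y' ζ ζ τ‖ ^ 2 +
      ‖if false = true ∧ τ + 1 = h then 0 else (0 : ℕ → Vec n) τ - (0 : ℕ → Vec n) τ‖ ^ 2 +
      ‖(0 : ℕ → Vec m) τ - (0 : ℕ → Vec m) τ‖ ^ 2) ≤
        if τ = 0 then L ^ 2 * ‖x - x'‖ ^ 2 else 0 := by
      intro τ _
      have h5 := norm_diffSource_le (con := false) (h := h) hA y y' ζ ζ τ
      simp only [Pi.zero_apply, sub_self, Bool.false_eq_true, false_and, if_false, add_zero,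
        norm_zero, zero_add, K.init, K'.init] at h5 ⊢
      have h6 := pow_le_pow_left₀ (norm_nonneg _) h5 2
      refine (le_of_eq (by norm_num)).trans (h6.trans (le_of_eq ?_))
      split_ifs <;> ring
    refine (Finset.sum_le_sum h4).trans ?_
    rw [Finset.sum_ite_eq' (Finset.range h) 0]
    split_ifs
    · exact le_rfl
    · positivity
  have h4 := mul_le_mul_of_nonneg_left h3 (sq_nonneg C)
  rw [← mul_assoc] at h4
  exact h2.trans (h1.trans h4)

/-- Decay of the influence of the terminal stationarity condition on the first input. -/
theorem terminal_decay (hC : PairConstants L μ M b C) (hA : ‖A‖ ≤ L) (hB : ‖B‖ ≤ L)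
    (hdual : DualBound (opOf A) (opOf B) false h M)
    (hG : ∀ τ ≤ h, BlockMonotone μ L (G τ)) (hH : ∀ τ < h, BlockMonotone μ L (H τ))
    (K : KKT (opOf A) (opOf B) false h G H x ζ α 0 y v p)
    (K' : KKT (opOf A) (opOf B) false h G H x ζ 0 0 y' v' p') (hh : 0 < h)
    (hα : ∀ τ, τ + 1 < h → α τ = 0) :
    ‖v 0 - v' 0‖ ≤ C * (b ^ (h - 1) * ‖α (h - 1)‖) := by
  refine (hC.pointwise hA hB hdual hG hH K K' hh).2.1.trans
    (mul_le_mul_of_nonneg_left ?_ hC.pos.le)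
  rw [Finset.sum_eq_single (h - 1)]
  · have h4 := norm_diffSource_le (con := false) (h := h) hA y y' ζ ζ (h - 1)
    simp only [Pi.zero_apply, sub_self, Bool.false_eq_true, false_and, if_false, add_zero,
      norm_zero, K.init, K'.init, sub_zero, mul_zero, ite_self] at h4 ⊢
    have e : timeDist (h - 1) 0 = h - 1 := by simp [timeDist]
    rw [e]
    refine mul_le_mul_of_nonneg_left ?_ (pow_nonneg hC.b_pos.le _)
    linarith
  · intro τ hτ hne
    have hτ := Finset.mem_range.1 hτ
    have h4 := norm_diffSource_le (con := false) (h := h) hA y y' ζ ζ τ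
    simp only [Pi.zero_apply, sub_self, Bool.false_eq_true, false_and, if_false, add_zero,
      norm_zero, K.init, K'.init, sub_zero, mul_zero, ite_self] at h4 ⊢
    rw [hα τ (by omega), norm_zero, le_antisymm h4 (norm_nonneg _)]
    simp
  · intro hn
    exact absurd (Finset.mem_range.2 (by omega)) hn

end PairConstants

end Decay

/-- Temporal decay for controllable systems. -/
theorem PairConstants.temporalDecay {L L' μ σ M b C : ℝ} {d : ℕ} (hC : PairConstants L' μ M b C)
    (hL : 1 ≤ L) (hLL : L ≤ L') (hσ : 0 < σ) (hd : 1 ≤ d) (hM : ctrlDualConst L σ d ≤ M) {N : ℕ}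
    {S : Network N} (hA : ‖S.A‖ ≤ L) (hB : ‖S.B‖ ≤ L)
    (hctrl : MinSingularGe (ctrlMat S.A S.B d) σ) {T : ℕ} {Q : Costs S}
    (hQ : StageCostAssumption Q T μ L) {Ω : ℝ} (hΩ : 2 * C * L' ≤ Ω) (hΩ1 : 1 ≤ Ω) :
    TemporalDecay Q T d Ω b := by
  intro t k hdk htk x x' z z' ζ ζ' y y' v v' hs hs' m hm
  have hb := hC.b_pos
  have hx : y 0 = x := hs.1.1
  have hx' : y' 0 = x' := hs'.1.1
  have hz : y k = z := hs.2.1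
  have hz' : y' k = z' := hs'.2.1
  set Rζ := ∑ l ∈ Finset.range k, b ^ ((m : ℤ) - (l : ℤ)).natAbs * ‖ζ l - ζ' l‖ with hR
  have hR0 : 0 ≤ Rζ := Finset.sum_nonneg fun _ _ => by positivity
  have hx0 : 0 ≤ b ^ m * ‖x - x'‖ := by positivity
  have hz0 : 0 ≤ b ^ (k - m) * ‖z - z'‖ := by positivity
  rcases Nat.eq_zero_or_pos m with rfl | hm0
  · rw [hx, hx']
    rw [pow_zero, one_mul] at hx0 ⊢
    nlinarith
  rcases Nat.lt_or_ge m k with hmk | hmk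
  swap
  · obtain rfl : m = k := le_antisymm hm hmk
    rw [hz, hz']
    rw [Nat.sub_self, pow_zero, one_mul] at hz0 ⊢
    nlinarith
  obtain ⟨j, rfl⟩ : ∃ j, m = j + 1 := ⟨m - 1, by omega⟩
  have hcd := hctrl.dualControllable
  obtain ⟨p, K⟩ := hs.exists_kkt hQ hσ hd hcd hdk htk
  obtain ⟨p', K'⟩ := hs'.exists_kkt hQ hσ hd hcd hdk htk
  have hdual := (dualBound_of_controllable hL (by rwa [norm_opOf]) (by rwa [norm_opOf]) hσ hd hcd
    hdk).mono hM
  have h1 := (hC.pointwise (hA.trans hLL) (hB.trans hLL) hdual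
    (fun τ _ => hQ.blockMonotone_stageGrad hLL htk
      ((blockMonotone_gradient (hQ.wc_f (t + k) htk)).mono hLL) τ)
    (hQ.blockMonotone_inputGrad hLL htk) K K' (by omega : j < k)).1
  have e1 : interiorDiff true k y y' (j + 1) = y (j + 1) - y' (j + 1) := by
    have : ¬ j + 1 = k := by omega
    simp [interiorDiff, this]
  rw [e1] at h1
  have hL'1 : 1 ≤ L' := hL.trans hLL
  have h2 : ∑ τ ∈ Finset.range k, b ^ timeDist τ j *
        (‖diffSource (opOf S.A) true k y y' ζ ζ' τ‖ +
          ‖if true = true ∧ τ + 1 = k then 0 else (0 : ℕ → Vec S.nx) τ - (0 : ℕ → Vec S.nx) τ‖ +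
          ‖(0 : ℕ → Vec S.nu) τ - (0 : ℕ → Vec S.nu) τ‖) ≤
      2 * L' * (b ^ (j + 1) * ‖x - x'‖ + b ^ (k - (j + 1)) * ‖z - z'‖ + Rζ) := by
    have h3 : ∀ τ ∈ Finset.range k, b ^ timeDist τ j *
        (‖diffSource (opOf S.A) true k y y' ζ ζ' τ‖ +
          ‖if true = true ∧ τ + 1 = k then 0 else (0 : ℕ → Vec S.nx) τ - (0 : ℕ → Vec S.nx) τ‖ +
          ‖(0 : ℕ → Vec S.nu) τ - (0 : ℕ → Vec S.nu) τ‖) ≤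
        2 * L' * (b ^ (((j + 1 : ℕ) : ℤ) - (τ : ℤ)).natAbs * ‖ζ τ - ζ' τ‖) +
          (if τ = 0 then 2 * L' * (b ^ (j + 1) * ‖x - x'‖) else 0) +
          (if τ = k - 1 then 2 * L' * (b ^ (k - (j + 1)) * ‖z - z'‖) else 0) := by
      intro τ hτ
      have hτ := Finset.mem_range.1 hτ
      have h4 := PairConstants.norm_diffSource_le (con := true) (h := k) (hA.trans hLL) y y' ζ ζ' τ
      rw [hx, hx', hz, hz'] at h4
      simp only [Pi.zero_apply, sub_self, ite_self, norm_zero, add_zero]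
      refine (mul_le_mul_of_nonneg_left h4 (by positivity)).trans ?_
      rw [mul_add, mul_add]
      have hhalf := hC.half_le
      refine add_le_add (add_le_add ?_ ?_) ?_
      · have h5 : timeDist τ j + 1 ≥ (((j + 1 : ℕ) : ℤ) - (τ : ℤ)).natAbs := by
          simp only [timeDist]; omega
        have h6 : b ^ (timeDist τ j + 1) ≤ b ^ (((j + 1 : ℕ) : ℤ) - (τ : ℤ)).natAbs :=
          pow_le_pow_of_le_one hb.le hC.lt_one.le h5
        have h7 : b ^ timeDist τ j ≤ 2 * b ^ (timeDist τ j + 1) := by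
          rw [pow_succ]
          nlinarith [pow_pos hb (timeDist τ j)]
        have h8 : b ^ timeDist τ j ≤ 2 * L' * b ^ (((j + 1 : ℕ) : ℤ) - (τ : ℤ)).natAbs := by
          have h9 : 0 ≤ b ^ (((j + 1 : ℕ) : ℤ) - (τ : ℤ)).natAbs := by positivity
          nlinarith
        rw [← mul_assoc]
        exact mul_le_mul_of_nonneg_right h8 (norm_nonneg _)
      · split_ifs with h0
        · have h5 : timeDist τ j = j := by rw [h0]; simp only [timeDist]; omega
          rw [h5]
          have h7 : b ^ j ≤ 2 * b ^ (j + 1) := by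
            rw [pow_succ]
            nlinarith [pow_pos hb j]
          have h8 := mul_le_mul_of_nonneg_right h7 (by positivity : 0 ≤ L' * ‖x - x'‖)
          linarith
        · rw [mul_zero]
      · by_cases h0 : τ + 1 = k
        · rw [if_pos ⟨rfl, h0⟩, if_pos (by omega)]
          have h5 : timeDist τ j = k - (j + 1) := by simp only [timeDist]; omega
          rw [h5]
          nlinarith
        · rw [if_neg (fun h => h0 h.2), if_neg (by omega), mul_zero]
    refine (Finset.sum_le_sum h3).trans ?_
    rw [Finset.sum_add_distrib, Finset.sum_add_distrib, Finset.sum_ite_eq' (Finset.range k) 0,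
      Finset.sum_ite_eq' (Finset.range k) (k - 1), if_pos (Finset.mem_range.2 (by omega)),
      if_pos (Finset.mem_range.2 (by omega)), ← Finset.mul_sum, ← hR]
    linarith
  refine h1.trans ((mul_le_mul_of_nonneg_left h2 hC.pos.le).trans ?_)
  rw [← mul_assoc, ← mul_assoc, mul_comm C 2]
  exact mul_le_mul_of_nonneg_right hΩ (by linarith)

section Spatial

variable {N : ℕ} {n m : Fin N → ℕ}

theorem adjoint_opOf_truncMat (Gr : SimpleGraph (Fin N)) (i : Fin N) (κ : ℕ)
    (M : Matrix (Idx n) (Idx m) ℝ) (z : Vec n) :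
    (opOf (truncMat Gr i κ M)).adjoint z = (opOf M).adjoint (ballProj Gr i κ z) := by
  rw [adjoint_opOf, adjoint_opOf]
  ext q
  simp only [ballProj, blockScale_apply, opOf_apply, truncMat, Matrix.transpose_apply,
    Matrix.of_apply]
  refine Finset.sum_congr rfl fun p _ => ?_
  split_ifs <;> simp

namespace PairConstants

variable {L μ M b C : ℝ} {Gr : SimpleGraph (Fin N)} {i : Fin N} {κ : ℕ}

theorem norm_ballWeight_opOf_le (hC : PairConstants L μ M b C) {A : Matrix (Idx n) (Idx m) ℝ}
    (hA : ‖A‖ ≤ L) (hN : LevelBanded (ballLevel Gr i κ) A) (z : Vec m) :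
    ‖ballWeight Gr i κ b (opOf A z)‖ ≤ (L + 1) * ‖ballWeight Gr i κ b z‖ := by
  have h1 := hC.commute hA hN z
  have h2 : ‖opOf A (ballWeight Gr i κ b z)‖ ≤ L * ‖ballWeight Gr i κ b z‖ := by
    refine ((opOf A).le_opNorm _).trans (mul_le_mul_of_nonneg_right ?_ (norm_nonneg _))
    rwa [norm_opOf]
  have h3 := norm_le_norm_add_norm_sub (opOf A (ballWeight Gr i κ b z))
    (ballWeight Gr i κ b (opOf A z))
  have h4 : ‖ballWeight Gr i κ b (opOf A z) - opOf A (ballWeight Gr i κ b z)‖ ≤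
    1 * ‖ballWeight Gr i κ b z‖ := h1
  rw [norm_sub_rev] at h4
  linarith [norm_sub_rev (opOf A (ballWeight Gr i κ b z)) (ballWeight Gr i κ b (opOf A z))]

theorem norm_ballWeight_sub_le (hC : PairConstants L μ M b C) (x : Vec n) :
    ‖ballWeight Gr i κ b (x - ballProj Gr i κ x)‖ ≤ b ^ κ * ‖x‖ := by
  have hb := hC.b_pos
  rw [ballWeight_sub_ballProj, norm_smul, Real.norm_of_nonneg (by positivity)]
  exact mul_le_mul_of_nonneg_left (norm_sub_ballProj_le _ _ _ _) (by positivity)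

theorem norm_ballWeight_trunc_le (hC : PairConstants L μ M b C) {A : Matrix (Idx n) (Idx m) ℝ}
    (hA : ‖A‖ ≤ L) (z : Vec m) :
    ‖ballWeight Gr i κ b (opOf A z - opOf (truncMat Gr i κ A) z)‖ ≤ b ^ κ * (L * ‖z‖) := by
  have hb := hC.b_pos
  rw [opOf_truncMat, ContinuousLinearMap.comp_apply]
  refine (hC.norm_ballWeight_sub_le _).trans (mul_le_mul_of_nonneg_left ?_ (by positivity))
  refine ((opOf A).le_opNorm _).trans (mul_le_mul_of_nonneg_right ?_ (norm_nonneg _))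
  rwa [norm_opOf]

theorem norm_ballWeight_adjoint_trunc_le (hC : PairConstants L μ M b C)
    {A : Matrix (Idx n) (Idx m) ℝ} (hA : ‖A‖ ≤ L) (hN : LevelBanded (ballLevel Gr i κ) A)
    (z : Vec n) :
    ‖ballWeight Gr i κ b ((opOf A).adjoint z - (opOf (truncMat Gr i κ A)).adjoint z)‖ ≤
      (L + 1) * (b ^ κ * ‖z‖) := by
  rw [adjoint_opOf_truncMat, ← map_sub, adjoint_opOf]
  refine (hC.norm_ballWeight_opOf_le (adjoint_opOf_norm_le hA) hN.transpose _).trans ?_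
  exact mul_le_mul_of_nonneg_left (hC.norm_ballWeight_sub_le _) (by linarith [hC.hL])

/-- The first input of the problem truncated around a node is, at that node, close to the first
input of the untruncated problem. -/
theorem spatial (hC : PairConstants L μ M b C) {A : Matrix (Idx n) (Idx n) ℝ}
    {B : Matrix (Idx n) (Idx m) ℝ} (hA : ‖A‖ ≤ L) (hB : ‖B‖ ≤ L) (nA : IsNetworked Gr A)
    (nB : IsNetworked Gr B) {h : ℕ} (hdual : DualBound (opOf A) (opOf B) false h M)
    (hdual' : DualBound (opOf (truncMat Gr i κ A)) (opOf (truncMat Gr i κ B)) false h M)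
    {G : ℕ → Vec n → Vec n} {H : ℕ → Vec m → Vec m}
    (hG : ∀ τ ≤ h, BlockMonotone μ L (G τ)) (hH : ∀ τ < h, BlockMonotone μ L (H τ))
    (hG0 : ∀ τ ≤ h, G τ 0 = 0) (hH0 : ∀ τ < h, H τ 0 = 0) {x : Vec n}
    {ζ y y' p p' : ℕ → Vec n} {v v' : ℕ → Vec m}
    (K : KKT (opOf A) (opOf B) false h G H x ζ 0 0 y v p)
    (K' : KKT (opOf (truncMat Gr i κ A)) (opOf (truncMat Gr i κ B)) false h G H
      (truncVec Gr i κ x) (fun τ => truncVec Gr i κ (ζ τ)) 0 0 y' v' p') {D : ℝ}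
    (hζ : ∀ τ < h, ‖ζ τ‖ ≤ D) (hh : 0 < h) :
    ‖block (v 0 - v' 0) i‖ ≤
      C * (5 * L + 5) * (C * (L + 2 / (1 - b)) + 1) / (1 - b) * b ^ κ * (‖x‖ + D) := by
  have hb := hC.b_pos
  have hb1 : 0 < 1 - b := by linarith [hC.lt_one]
  have hL := hC.hL
  have hCp := hC.pos
  have hD : 0 ≤ D := (norm_nonneg _).trans (hζ 0 hh)
  have lA := nA.levelBanded i κ
  have lB := nB.levelBanded i κ
  set R : ℝ := (C * (L + 2 / (1 - b)) + 1) * (‖x‖ + D) with hR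
  have hsz : ∀ k < h, ‖y (k + 1)‖ ≤ R ∧ ‖v k‖ ≤ R ∧ ‖p k‖ ≤ R := by
    intro k hk
    have h1 := hC.size hA hB hdual hG hH hG0 hH0 K hζ hk
    have h2 : C * (L + 2 / (1 - b)) * (b ^ k * ‖x‖ + D) ≤ R := by
      have h3 : b ^ k * ‖x‖ + D ≤ ‖x‖ + D :=
        add_le_add (mul_le_of_le_one_left (norm_nonneg _) (pow_le_one₀ hb.le hC.lt_one.le)) le_rfl
      have h4 := mul_le_mul_of_nonneg_left h3
        (by positivity : 0 ≤ C * (L + 2 / (1 - b)))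
      rw [hR, add_mul, one_mul]
      linarith [norm_nonneg x]
    exact ⟨h1.1.trans h2, h1.2.1.trans h2, h1.2.2.trans h2⟩
  have hq : 0 ≤ C * (L + 2 / (1 - b)) * (‖x‖ + D) := by positivity
  have hxR : ‖x‖ ≤ R := by rw [hR, add_mul, one_mul]; linarith
  have hDR : D ≤ R := by rw [hR, add_mul, one_mul]; linarith [norm_nonneg x]
  have hR0 : 0 ≤ R := (norm_nonneg _).trans hxR
  have hy : ∀ k < h, ‖y k‖ ≤ R := by
    intro k hk
    cases k with
    | zero => rw [K.init]; exact hxR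
    | succ k => exact (hsz k (by omega)).1
  have hp : ∀ k < h, ‖p (k + 1)‖ ≤ R := by
    intro k hk
    rcases Nat.lt_or_ge (k + 1) h with h1 | h1
    · exact (hsz (k + 1) h1).2.2
    · rw [(by omega : k + 1 = h), K.final, norm_zero]; exact hR0
  let ζ₁ : ℕ → Vec n := fun τ => ζ τ + (opOf A (y τ) - opOf (truncMat Gr i κ A) (y τ)) +
    (opOf B (v τ) - opOf (truncMat Gr i κ B) (v τ))
  let α₁ : ℕ → Vec n := fun τ =>
    (opOf A).adjoint (p (τ + 1)) - (opOf (truncMat Gr i κ A)).adjoint (p (τ + 1))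
  let s₁ : ℕ → Vec m := fun τ =>
    (opOf B).adjoint (p τ) - (opOf (truncMat Gr i κ B)).adjoint (p τ)
  have K₁ : KKT (opOf (truncMat Gr i κ A)) (opOf (truncMat Gr i κ B)) false h G H x ζ₁ α₁ s₁
      y v p := by
    refine ⟨K.init, fun τ hτ => ?_, fun τ hτ hc => ?_, fun τ hτ => ?_, K.final⟩
    · rw [K.dyn τ hτ]; simp only [ζ₁]; abel
    · have h1 := K.costate τ hτ hc
      have h2 : G (τ + 1) (y (τ + 1)) = (opOf A).adjoint (p (τ + 1)) - p τ := by
        rw [Pi.zero_apply] at h1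
        rw [← sub_eq_zero, ← h1]; abel
      rw [h2]; simp only [α₁]; abel
    · have h1 := K.input τ hτ
      rw [Pi.zero_apply, add_zero] at h1
      rw [h1]; simp only [s₁]; abel
  have h1 := hC.estimate ((norm_truncMat_le Gr i κ A).trans hA)
    ((norm_truncMat_le Gr i κ B).trans hB) hdual' (lA.truncMat Gr i κ) (lB.truncMat Gr i κ)
    (slowWeight_pow_timeDist hb hC.lt_one.le 1) hG hH K₁ K'
  have hsucc : ∀ τ, timeDist (τ + 1) 1 = τ := by
    intro τ; simp only [timeDist]; omega
  simp only [hsucc] at h1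
  have h2 : ∑ τ ∈ Finset.range h, (b ^ τ) ^ 2 *
      (‖blockScale (fun j => b ^ ballLevel Gr i κ j) (diffSource (opOf (truncMat Gr i κ A)) false h
          y y' ζ₁ (fun τ => truncVec Gr i κ (ζ τ)) τ)‖ ^ 2
        + ‖blockScale (fun j => b ^ ballLevel Gr i κ j)
            (if false = true ∧ τ + 1 = h then 0 else α₁ τ - (0 : ℕ → Vec n) τ)‖ ^ 2
        + ‖blockScale (fun j => b ^ ballLevel Gr i κ j) (s₁ τ - (0 : ℕ → Vec m) τ)‖ ^ 2) ≤
      ((5 * L + 5) * (b ^ κ * R) / (1 - b)) ^ 2 := by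
    have hterm : ∀ τ ∈ Finset.range h, (b ^ τ) ^ 2 *
      (‖blockScale (fun j => b ^ ballLevel Gr i κ j) (diffSource (opOf (truncMat Gr i κ A)) false h
          y y' ζ₁ (fun τ => truncVec Gr i κ (ζ τ)) τ)‖ ^ 2
        + ‖blockScale (fun j => b ^ ballLevel Gr i κ j)
            (if false = true ∧ τ + 1 = h then 0 else α₁ τ - (0 : ℕ → Vec n) τ)‖ ^ 2
        + ‖blockScale (fun j => b ^ ballLevel Gr i κ j) (s₁ τ - (0 : ℕ → Vec m) τ)‖ ^ 2) ≤
        b ^ τ * ((5 * L + 5) * (b ^ κ * R)) ^ 2 := by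
      intro τ hτ
      have hτ := Finset.mem_range.1 hτ
      have hα : ‖ballWeight Gr i κ b (α₁ τ)‖ ≤ (L + 1) * (b ^ κ * R) :=
        (hC.norm_ballWeight_adjoint_trunc_le hA lA _).trans (mul_le_mul_of_nonneg_left
          (mul_le_mul_of_nonneg_left (hp τ hτ) (by positivity)) (by positivity))
      have hs : ‖ballWeight Gr i κ b (s₁ τ)‖ ≤ (L + 1) * (b ^ κ * R) :=
        (hC.norm_ballWeight_adjoint_trunc_le hB lB _).trans (mul_le_mul_of_nonneg_left
          (mul_le_mul_of_nonneg_left (hsz τ hτ).2.2 (by positivity)) (by positivity))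
      have hr : ‖ballWeight Gr i κ b (diffSource (opOf (truncMat Gr i κ A)) false h
          y y' ζ₁ (fun τ => truncVec Gr i κ (ζ τ)) τ)‖ ≤ (3 * L + 2) * (b ^ κ * R) := by
        have e : diffSource (opOf (truncMat Gr i κ A)) false h
            y y' ζ₁ (fun τ => truncVec Gr i κ (ζ τ)) τ =
            (ζ τ - ballProj Gr i κ (ζ τ)) + (opOf A (y τ) - opOf (truncMat Gr i κ A) (y τ)) +
            (opOf B (v τ) - opOf (truncMat Gr i κ B) (v τ)) +
            (if τ = 0 then opOf (truncMat Gr i κ A) (x - ballProj Gr i κ x) else 0) := by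
          simp only [diffSource, ζ₁, truncVec_eq, K.init, K'.init, Bool.false_eq_true, false_and,
            if_false, sub_zero]
          abel
        rw [e, map_add, map_add, map_add]
        have b1 : ‖ballWeight Gr i κ b (ζ τ - ballProj Gr i κ (ζ τ))‖ ≤ b ^ κ * R :=
          (hC.norm_ballWeight_sub_le _).trans (mul_le_mul_of_nonneg_left ((hζ τ hτ).trans hDR)
            (by positivity))
        have b2 : ‖ballWeight Gr i κ b (opOf A (y τ) - opOf (truncMat Gr i κ A) (y τ))‖ ≤
            b ^ κ * (L * R) :=
          (hC.norm_ballWeight_trunc_le hA _).trans (mul_le_mul_of_nonneg_left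
            (mul_le_mul_of_nonneg_left (hy τ hτ) hL) (by positivity))
        have b3 : ‖ballWeight Gr i κ b (opOf B (v τ) - opOf (truncMat Gr i κ B) (v τ))‖ ≤
            b ^ κ * (L * R) :=
          (hC.norm_ballWeight_trunc_le hB _).trans (mul_le_mul_of_nonneg_left
            (mul_le_mul_of_nonneg_left (hsz τ hτ).2.1 hL) (by positivity))
        have b4 : ‖ballWeight Gr i κ b
            (if τ = 0 then opOf (truncMat Gr i κ A) (x - ballProj Gr i κ x) else 0)‖ ≤
            (L + 1) * (b ^ κ * R) := by
          split_ifs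
          · refine (hC.norm_ballWeight_opOf_le ((norm_truncMat_le Gr i κ A).trans hA)
              (lA.truncMat Gr i κ) _).trans (mul_le_mul_of_nonneg_left ?_ (by positivity))
            exact (hC.norm_ballWeight_sub_le _).trans (mul_le_mul_of_nonneg_left hxR
              (by positivity))
          · rw [map_zero, norm_zero]; positivity
        refine (norm_add_le _ _).trans ?_
        refine (add_le_add ((norm_add_le _ _).trans (add_le_add (norm_add_le _ _) le_rfl))
          le_rfl).trans ?_
        linarith
      simp only [Bool.false_eq_true, false_and, if_false, Pi.zero_apply, sub_zero]
      change (b ^ τ) ^ 2 * (‖ballWeight Gr i κ b _‖ ^ 2 + ‖ballWeight Gr i κ b _‖ ^ 2 +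
        ‖ballWeight Gr i κ b _‖ ^ 2) ≤ _
      have q1 := pow_le_pow_left₀ (norm_nonneg _) hr 2
      have q2 := pow_le_pow_left₀ (norm_nonneg _) hα 2
      have q3 := pow_le_pow_left₀ (norm_nonneg _) hs 2
      have q4 : (b ^ τ) ^ 2 ≤ b ^ τ := by
        rw [sq]
        exact mul_le_of_le_one_left (by positivity) (pow_le_one₀ hb.le hC.lt_one.le)
      refine mul_le_mul q4 ?_ (by positivity) (by positivity)
      refine (add_le_add (add_le_add q1 q2) q3).trans ?_
      have q5 : 0 ≤ (b ^ κ * R) ^ 2 := sq_nonneg _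
      have q6 : (3 * L + 2) ^ 2 + (L + 1) ^ 2 + (L + 1) ^ 2 ≤ (5 * L + 5) ^ 2 := by nlinarith
      have q7 := mul_le_mul_of_nonneg_right q6 q5
      simp only [mul_pow] at q7 ⊢
      linarith
    refine (Finset.sum_le_sum hterm).trans ?_
    rw [← Finset.sum_mul, div_pow]
    have h3 := geom_sum_le_inv hb.le hC.lt_one h
    refine (mul_le_mul_of_nonneg_right h3 (sq_nonneg _)).trans ?_
    rw [one_div, inv_mul_eq_div]
    refine div_le_div_of_nonneg_left (sq_nonneg _) (by positivity) ?_
    nlinarith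
  have h3 := h1.trans (mul_le_mul_of_nonneg_left h2 (sq_nonneg C))
  rw [← mul_pow] at h3
  have h4 := (Finset.single_le_sum (f := fun τ => (b ^ τ) ^ 2 *
      (‖blockScale (fun j => b ^ ballLevel Gr i κ j) (interiorDiff false h y y' (τ + 1))‖ ^ 2
        + ‖blockScale (fun j => b ^ ballLevel Gr i κ j) (v τ - v' τ)‖ ^ 2
        + ‖blockScale (fun j => b ^ ballLevel Gr i κ j) (p τ - p' τ)‖ ^ 2))
    (fun τ _ => by positivity) (Finset.mem_range.2 hh)).trans h3
  simp only [pow_zero, one_pow, one_mul] at h4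
  have h5 : ‖ballWeight Gr i κ b (v 0 - v' 0)‖ ≤ C * ((5 * L + 5) * (b ^ κ * R) / (1 - b)) := by
    refine le_of_sq_le_sq ?_ (by positivity)
    change ‖blockScale (fun j => b ^ ballLevel Gr i κ j) (v 0 - v' 0)‖ ^ 2 ≤ _
    nlinarith [sq_nonneg ‖blockScale (fun j => b ^ ballLevel Gr i κ j) (p 0 - p' 0)‖,
      sq_nonneg ‖blockScale (fun j => b ^ ballLevel Gr i κ j) (interiorDiff false h y y' (0 + 1))‖]
  refine (norm_block_le_ballWeight Gr i κ b _).trans (h5.trans (le_of_eq ?_))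
  rw [hR]; ring

end PairConstants

end Spatial

section InputError

theorem WellConditioned.mono {ι : Type} [Fintype ι] {f : EuclideanSpace ℝ ι → ℝ} {μ L L' : ℝ}
    (hf : WellConditioned f μ L) (h : L ≤ L') : WellConditioned f μ L' :=
  ⟨hf.strongConvex, hf.contDiff, fun x y => (hf.smooth x y).trans
    (mul_le_mul_of_nonneg_right h (norm_nonneg _))⟩

theorem StageCostAssumption.mono {N : ℕ} {S : Network N} {Q : Costs S} {T : ℕ} {μ L L' : ℝ}
    (hQ : StageCostAssumption Q T μ L) (h : L ≤ L') : StageCostAssumption Q T μ L' :=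
  ⟨fun t ht => (hQ.wc_f t ht).mono h, fun t h1 ht => (hQ.wc_c t h1 ht).mono h, hQ.nonneg_f,
    hQ.nonneg_c, hQ.zero_f, hQ.zero_c⟩

variable {N : ℕ}

theorem norm_le_sum_norm_block {n : Fin N → ℕ} (x : Vec n) : ‖x‖ ≤ ∑ i, ‖block x i‖ := by
  refine le_of_sq_le_sq ?_ (Finset.sum_nonneg fun _ _ => norm_nonneg _)
  rw [norm_sq_eq_sum_block]
  exact Finset.sum_sq_le_sq_sum_of_nonneg fun _ _ => norm_nonneg _

/-- Evaluating a Lipschitz family of vectors at a different parameter in each block costs only a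
universal constant. -/
theorem sum_norm_sq_block_family_le {n : Fin N → ℕ} {V : ℝ → Vec n} {a c Λ : ℝ} (hac : a ≤ c)
    (hΛ : 0 ≤ Λ)
    (hV : ∀ φ φ', a ≤ φ → φ ≤ c → a ≤ φ' → φ' ≤ c → ‖V φ - V φ'‖ ≤ Λ * |φ - φ'|)
    {φ : Fin N → ℝ} (hφ : ∀ i, a ≤ φ i ∧ φ i ≤ c) :
    ∑ i, ‖block (V (φ i) - V a) i‖ ^ 2 ≤ (2 * (Λ * (c - a))) ^ 2 := by
  rcases Nat.eq_zero_or_pos N with rfl | hN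
  · rw [Finset.univ_eq_empty, Finset.sum_empty]; positivity
  have hN0 : (0 : ℝ) < N := Nat.cast_pos.2 hN
  have hN1 : (1 : ℝ) ≤ N := Nat.one_le_cast.2 hN
  set e : ℝ := (c - a) / N with he
  have he0 : 0 ≤ e := div_nonneg (by linarith) hN0.le
  have heN : e * N = c - a := by rw [he]; field_simp
  let g : ℕ → ℝ := fun j => a + j * e
  have hg0 : g 0 = a := by simp [g]
  have hga : ∀ j, a ≤ g j := fun j => by
    have : 0 ≤ (j : ℝ) * e := by positivity
    simp only [g]; linarith
  have hgc : ∀ j ≤ N, g j ≤ c := fun j hj => by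
    have h1 : (j : ℝ) * e ≤ N * e := mul_le_mul_of_nonneg_right (Nat.cast_le.2 hj) he0
    simp only [g]; linarith
  have hgrid : ∀ i, ∃ j ≤ N, |φ i - g j| ≤ e := by
    intro i
    rcases he0.eq_or_lt with h0 | h0
    · refine ⟨0, Nat.zero_le _, ?_⟩
      rw [← h0, zero_mul] at heN
      have h1 := hφ i
      rw [hg0, ← h0, abs_nonpos_iff]
      linarith
    · refine ⟨⌊(φ i - a) / e⌋₊, ?_, ?_⟩
      · refine Nat.floor_le_of_le ?_
        rw [div_le_iff₀ h0, mul_comm, heN]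
        linarith [(hφ i).2]
      · have h1 := Nat.floor_le (div_nonneg (sub_nonneg.2 (hφ i).1) h0.le)
        have h2 := (Nat.lt_floor_add_one ((φ i - a) / e)).le
        rw [le_div_iff₀ h0] at h1
        rw [div_le_iff₀ h0, add_mul, one_mul] at h2
        simp only [g]
        rw [abs_le]
        constructor <;> linarith
  choose j hjN hj using hgrid
  let Δ : ℕ → Vec n := fun l => V (g (l + 1)) - V (g l)
  have hΔ : ∀ l < N, ‖Δ l‖ ^ 2 ≤ (Λ * e) ^ 2 := by
    intro l hl
    refine pow_le_pow_left₀ (norm_nonneg _) ((hV _ _ (hga _) (hgc _ hl) (hga _) (hgc _ hl.le)).trans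
      (le_of_eq ?_)) 2
    have : g (l + 1) - g l = e := by simp only [g]; push_cast; ring
    rw [this, abs_of_nonneg he0]
  have hblock : ∀ i, ‖block (V (φ i) - V a) i‖ ^ 2 ≤
      2 * (Λ * e) ^ 2 + 2 * (N * ∑ l ∈ Finset.range N, ‖block (Δ l) i‖ ^ 2) := by
    intro i
    have h1 : block (V (φ i) - V a) i =
        block (V (φ i) - V (g (j i))) i + ∑ l ∈ Finset.range (j i), block (Δ l) i := by
      have h2 : ∀ J : ℕ, ∑ l ∈ Finset.range J, block (Δ l) i = block (V (g J)) i - block (V (g 0)) i := by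
        intro J
        induction J with
        | zero => simp
        | succ J ih => rw [Finset.sum_range_succ, ih]; simp only [Δ, block_sub]; abel
      rw [h2, hg0, block_sub, block_sub]; abel
    have h2 : ‖block (V (φ i) - V (g (j i))) i‖ ≤ Λ * e :=
      (norm_block_le _ _).trans ((hV _ _ (hφ i).1 (hφ i).2 (hga _) (hgc _ (hjN i))).trans
        (mul_le_mul_of_nonneg_left (hj i) hΛ))
    have h3 : ‖∑ l ∈ Finset.range (j i), block (Δ l) i‖ ^ 2 ≤
        N * ∑ l ∈ Finset.range N, ‖block (Δ l) i‖ ^ 2 := by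
      have h4 : ‖∑ l ∈ Finset.range (j i), block (Δ l) i‖ ≤
          ∑ l ∈ Finset.range N, ‖block (Δ l) i‖ :=
        (norm_sum_le _ _).trans (Finset.sum_le_sum_of_subset_of_nonneg
          (Finset.range_mono (hjN i)) fun _ _ _ => norm_nonneg _)
      refine (pow_le_pow_left₀ (norm_nonneg _) h4 2).trans ?_
      have h5 := sq_sum_le_card_mul_sum_sq (s := Finset.range N) (f := fun l => ‖block (Δ l) i‖)
      rwa [Finset.card_range] at h5
    rw [h1]
    have h4 := pow_le_pow_left₀ (norm_nonneg _) (norm_add_le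
      (block (V (φ i) - V (g (j i))) i) (∑ l ∈ Finset.range (j i), block (Δ l) i)) 2
    have h5 := pow_le_pow_left₀ (norm_nonneg _) h2 2
    have h6 := add_pow_le (norm_nonneg (block (V (φ i) - V (g (j i))) i))
      (norm_nonneg (∑ l ∈ Finset.range (j i), block (Δ l) i)) 2
    norm_num at h6
    linarith
  refine (Finset.sum_le_sum fun i _ => hblock i).trans ?_
  rw [Finset.sum_add_distrib, Finset.sum_const, Finset.card_univ, Fintype.card_fin,
    ← Finset.mul_sum, ← Finset.mul_sum, Finset.sum_comm]
  have h1 : ∑ l ∈ Finset.range N, ∑ i, ‖block (Δ l) i‖ ^ 2 ≤ N * (Λ * e) ^ 2 := by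
    have h2 : ∑ l ∈ Finset.range N, ∑ i, ‖block (Δ l) i‖ ^ 2 ≤
        ∑ l ∈ Finset.range N, (Λ * e) ^ 2 := by
      refine Finset.sum_le_sum fun l hl => ?_
      rw [← norm_sq_eq_sum_block]
      exact hΔ l (Finset.mem_range.1 hl)
    rwa [Finset.sum_const, Finset.card_range, nsmul_eq_mul] at h2
  have h2 := mul_le_mul_of_nonneg_left h1 hN0.le
  have h3 : (N : ℝ) * (Λ * e) ^ 2 ≤ N * (N * (Λ * e) ^ 2) := by
    refine mul_le_mul_of_nonneg_left ?_ hN0.le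
    nlinarith [sq_nonneg (Λ * e)]
  rw [nsmul_eq_mul, ← heN]
  calc _ ≤ 4 * (N * (N * (Λ * e) ^ 2)) := by linarith
    _ = _ := by ring

end InputError

/-- A networked control problem to which the decay estimates apply. -/
structure Regular {N : ℕ} (S : Network N) (Q : Costs S) (T κ : ℕ) (L μ M b C : ℝ) : Prop where
  consts : PairConstants L μ M b C
  mu_le : μ ≤ L
  norm_A : ‖S.A‖ ≤ L
  norm_B : ‖S.B‖ ≤ L
  dual : ∀ h, DualBound (opOf S.A) (opOf S.B) false h M
  dual_trunc : ∀ i h, DualBound (opOf (truncMat S.graph i κ S.A))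
    (opOf (truncMat S.graph i κ S.B)) false h M
  costs : StageCostAssumption Q T μ L

/-- The constant in the comparison of distributed and centralized inputs. -/
def inputConst (L b C : ℝ) : ℝ :=
  C * (5 * L + 5) * (C * (L + 2 / (1 - b)) + 1) / (1 - b) +
    4 * C * (C * (L + 2 / (1 - b))) * (3 * L + 1)

namespace Regular

variable {N : ℕ} {S : Network N} {Q : Costs S} {T κ : ℕ} {L μ M b C : ℝ}

theorem sizeConst_pos (R : Regular S Q T κ L μ M b C) : 0 < C * (L + 2 / (1 - b)) := by
  have h1 : 0 < 1 - b := by linarith [R.consts.lt_one]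
  have h2 := R.consts.hL
  have h3 := R.consts.pos
  positivity

theorem spatialConst_nonneg (R : Regular S Q T κ L μ M b C) :
    0 ≤ C * (5 * L + 5) * (C * (L + 2 / (1 - b)) + 1) / (1 - b) := by
  have h1 : 0 < 1 - b := by linarith [R.consts.lt_one]
  have h2 := R.consts.hL
  have h3 := R.consts.pos
  positivity

theorem inputConst_nonneg (R : Regular S Q T κ L μ M b C) : 0 ≤ inputConst L b C := by
  have h1 := R.spatialConst_nonneg
  have h2 := R.sizeConst_pos
  have h3 := R.consts.hL
  have h4 := R.consts.pos
  unfold inputConst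
  positivity

theorem blockMonotone_gradient_fSum (R : Regular S Q T κ L μ M b C) {t : ℕ} (ht : t ≤ T) :
    BlockMonotone μ L (gradient (Q.fSum t)) := blockMonotone_gradient (R.costs.wc_f t ht)

theorem gradient_fSum_zero (R : Regular S Q T κ L μ M b C) {t : ℕ} (ht : t ≤ T) :
    gradient (Q.fSum t) 0 = 0 :=
  gradient_zero_of_nonneg (R.costs.zero_f _ ht) (R.costs.nonneg_f _ ht)

/-- Centralized problems and truncated problems with the same radial terminal gradient. -/
theorem norm_block_input_sub_le (R : Regular S Q T κ L μ M b C) {t ℓ : ℕ} (ht : t + ℓ ≤ T)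
    (hℓ : 0 < ℓ) {g : Vec S.nx → Vec S.nx} (hg : BlockMonotone μ L g) (hg0 : g 0 = 0)
    {x : Vec S.nx} {ζ y y' p p' : ℕ → Vec S.nx} {v v' : ℕ → Vec S.nu} {i : Fin N} {D : ℝ}
    (K : KKT (opOf S.A) (opOf S.B) false ℓ (stageGrad Q t ℓ g) (inputGrad Q t) x ζ 0 0 y v p)
    (K' : KKT (opOf (truncMat S.graph i κ S.A)) (opOf (truncMat S.graph i κ S.B)) false ℓ
      (stageGrad Q t ℓ g) (inputGrad Q t) (truncVec S.graph i κ x)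
      (fun τ => truncVec S.graph i κ (ζ τ)) 0 0 y' v' p') (hζ : ∀ τ < ℓ, ‖ζ τ‖ ≤ D) :
    ‖block (v 0 - v' 0) i‖ ≤
      C * (5 * L + 5) * (C * (L + 2 / (1 - b)) + 1) / (1 - b) * b ^ κ * (‖x‖ + D) :=
  R.consts.spatial R.norm_A R.norm_B S.networked_A S.networked_B (R.dual ℓ) (R.dual_trunc i ℓ)
    (fun τ _ => R.costs.blockMonotone_stageGrad le_rfl ht hg τ)
    (R.costs.blockMonotone_inputGrad le_rfl ht) (fun τ _ => R.costs.stageGrad_zero ht hg0 τ)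
    (R.costs.inputGrad_zero ht) K K' hζ hℓ

theorem input_error_terminal (R : Regular S Q T κ L μ M b C) {t : ℕ} (ht : t < T)
    {x : Vec S.nx} {ζ : ℕ → Vec S.nx} {D : ℝ} (hζ : ∀ τ < T - t, ‖ζ τ‖ ≤ D) {u : Vec S.nu}
    (hu : ∀ i, ∃ y v, IsLocalSolution Q i κ t (T - t) x ζ (Q.fSum T) y v ∧
      block u i = block (v 0) i)
    {y : ℕ → Vec S.nx} {v : ℕ → Vec S.nu}
    (hs : IsSolution Q S.A S.B t (T - t) x ζ (Q.fSum T) y v) :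
    ‖u - v 0‖ ≤ N * (C * (5 * L + 5) * (C * (L + 2 / (1 - b)) + 1) / (1 - b) * b ^ κ *
      (‖x‖ + D)) := by
  have hd := (R.costs.wc_f T le_rfl).differentiable
  have htT : t + (T - t) ≤ T := by omega
  obtain ⟨p, K⟩ := hs.exists_kkt R.costs htT hd
  refine (norm_le_sum_norm_block _).trans ?_
  have h1 : ∀ i ∈ (Finset.univ : Finset (Fin N)), ‖block (u - v 0) i‖ ≤
      C * (5 * L + 5) * (C * (L + 2 / (1 - b)) + 1) / (1 - b) * b ^ κ * (‖x‖ + D) := by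
    intro i _
    obtain ⟨y', v', hs', hu'⟩ := hu i
    obtain ⟨p', K'⟩ := hs'.exists_kkt R.costs htT hd
    have h2 := R.norm_block_input_sub_le htT (by omega) (R.blockMonotone_gradient_fSum le_rfl)
      (R.gradient_fSum_zero le_rfl) K K' hζ
    rwa [block_sub, hu', norm_sub_rev, ← block_sub]
  refine (Finset.sum_le_sum h1).trans (le_of_eq ?_)
  rw [Finset.sum_const, Finset.card_univ, Fintype.card_fin, nsmul_eq_mul]

/-- Centralized problems with quadratic terminal costs: dependence of the first input on the
weight of the terminal cost. -/
theorem input_error_weight (R : Regular S Q T κ L μ M b C) {t k : ℕ} (ht : t + k ≤ T) (hk : 0 < k)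
    {x : Vec S.nx} {ζ y y' p p' : ℕ → Vec S.nx} {v v' : ℕ → Vec S.nu} {D : ℝ}
    (hζ : ∀ τ < k, ‖ζ τ‖ ≤ D) {φ φ' : ℝ} (h1 : μ ≤ φ) (h2 : φ ≤ L) (h1' : μ ≤ φ') (h2' : φ' ≤ L)
    (K : KKT (opOf S.A) (opOf S.B) false k (stageGrad Q t k fun z => φ • z) (inputGrad Q t)
      x ζ 0 0 y v p)
    (K' : KKT (opOf S.A) (opOf S.B) false k (stageGrad Q t k fun z => φ' • z) (inputGrad Q t)
      x ζ 0 0 y' v' p') :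
    ‖v 0 - v' 0‖ ≤
      C * (C * (L + 2 / (1 - b))) * b ^ (k - 1) * (b ^ (k - 1) * ‖x‖ + D) * |φ - φ'| := by
  have hμ := R.consts.hμ.le
  have hb := R.consts.b_pos
  have hsz := (R.consts.size R.norm_A R.norm_B (R.dual k)
    (fun τ _ => R.costs.blockMonotone_stageGrad le_rfl ht (blockMonotone_smul hμ h1 h2) τ)
    (R.costs.blockMonotone_inputGrad le_rfl ht)
    (fun τ _ => R.costs.stageGrad_zero ht (smul_zero _) τ) (R.costs.inputGrad_zero ht) K hζ
    (by omega : k - 1 < k)).1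
  rw [Nat.sub_add_cancel hk] at hsz
  have K₁ := K.congr_grad (G' := stageGrad Q t k fun z => φ' • z)
    (α' := fun τ => if τ + 1 = k then (φ' - φ) • y k else 0) (fun τ hτ => by
      simp only [stageGrad, Pi.zero_apply, sub_zero]
      by_cases h : τ + 1 = k
      · subst h; simp [sub_smul]
      · rw [if_pos (by omega), if_neg h, if_pos (by omega), sub_zero])
  have h3 := R.consts.terminal_decay R.norm_A R.norm_B (R.dual k)
    (fun τ _ => R.costs.blockMonotone_stageGrad le_rfl ht (blockMonotone_smul hμ h1' h2') τ)
    (R.costs.blockMonotone_inputGrad le_rfl ht) K₁ K' hk (fun τ hτ => by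
      rw [if_neg (by omega)])
  rw [Nat.sub_add_cancel hk, if_pos rfl, norm_smul, Real.norm_eq_abs, abs_sub_comm] at h3
  refine h3.trans ?_
  have h4 := mul_le_mul_of_nonneg_left hsz (abs_nonneg (φ - φ'))
  have h5 := mul_le_mul_of_nonneg_left h4 (mul_nonneg R.consts.pos.le (pow_nonneg hb.le (k - 1)))
  calc _ ≤ _ := le_of_eq_of_le (by ring) h5
    _ = _ := by ring

/-- A problem with a quadratic terminal cost and the restriction of a longer problem. -/
theorem input_error_restrict (R : Regular S Q T κ L μ M b C) {t k h : ℕ} (hk : 0 < k) (hkh : k < h)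
    (hh : t + h ≤ T) {g : Vec S.nx → Vec S.nx} (hg : BlockMonotone μ L g) (hg0 : g 0 = 0)
    {x : Vec S.nx} {ζ y y' p p' : ℕ → Vec S.nx} {v v' : ℕ → Vec S.nu} {D : ℝ}
    (hζ : ∀ τ < h, ‖ζ τ‖ ≤ D) {φ : ℝ} (h1 : μ ≤ φ) (h2 : φ ≤ L)
    (K : KKT (opOf S.A) (opOf S.B) false h (stageGrad Q t h g) (inputGrad Q t) x ζ 0 0 y v p)
    (K' : KKT (opOf S.A) (opOf S.B) false k (stageGrad Q t k fun z => φ • z) (inputGrad Q t)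
      x ζ 0 0 y' v' p') :
    ‖v 0 - v' 0‖ ≤
      C * (C * (L + 2 / (1 - b))) * b ^ (k - 1) * (b ^ (k - 1) * ‖x‖ + D) * (L + 1) := by
  have hμ := R.consts.hμ.le
  have hb := R.consts.b_pos
  have ht : t + k ≤ T := by omega
  have hsz := R.consts.size R.norm_A R.norm_B (R.dual h)
    (fun τ _ => R.costs.blockMonotone_stageGrad le_rfl hh hg τ)
    (R.costs.blockMonotone_inputGrad le_rfl hh)
    (fun τ _ => R.costs.stageGrad_zero hh hg0 τ) (R.costs.inputGrad_zero hh) K hζ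
    (by omega : k - 1 < h)
  rw [Nat.sub_add_cancel hk] at hsz
  have K₁ : KKT (opOf S.A) (opOf S.B) false k (stageGrad Q t k fun z => φ • z) (inputGrad Q t)
      x ζ (fun τ => if τ + 1 = k then φ • y k + p (k - 1) else 0) 0 y v
      (fun τ => if τ < k then p τ else 0) := by
    refine ⟨K.init, fun τ hτ => K.dyn τ (by omega), fun τ hτ hc => ?_, fun τ hτ => ?_, by simp⟩
    · have h3 := K.costate τ (by omega) (by simp)
      simp only [stageGrad] at h3 ⊢
      by_cases h : τ + 1 = k
      · subst h; simp
      · rw [if_pos (by omega)] at h3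
        rw [if_pos (by omega), if_pos hτ, if_pos (by omega), if_neg h, h3, Pi.zero_apply]
    · rw [K.input τ (by omega), if_pos hτ]
  have h3 := R.consts.terminal_decay R.norm_A R.norm_B (R.dual k)
    (fun τ _ => R.costs.blockMonotone_stageGrad le_rfl ht (blockMonotone_smul hμ h1 h2) τ)
    (R.costs.blockMonotone_inputGrad le_rfl ht) K₁ K' hk (fun τ hτ => by
      rw [if_neg (by omega)])
  rw [Nat.sub_add_cancel hk, if_pos rfl] at h3
  refine h3.trans ?_
  have h4 : ‖φ • y k + p (k - 1)‖ ≤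
      (L + 1) * (C * (L + 2 / (1 - b)) * (b ^ (k - 1) * ‖x‖ + D)) := by
    refine (norm_add_le _ _).trans ?_
    rw [norm_smul, Real.norm_of_nonneg (hμ.trans h1), add_mul, one_mul]
    exact add_le_add (mul_le_mul h2 hsz.1 (norm_nonneg _) R.consts.hL) hsz.2.2
  have h5 := mul_le_mul_of_nonneg_left h4 (mul_nonneg R.consts.pos.le (pow_nonneg hb.le (k - 1)))
  calc _ ≤ _ := le_of_eq_of_le (by ring) h5
    _ = _ := by ring

theorem input_error_interior (R : Regular S Q T κ L μ M b C) {t k : ℕ} (hk : 0 < k)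
    (ht : t + k < T) {F : Vec S.nx → ℝ} (hF : TerminalCostAssumption F μ L)
    {x : Vec S.nx} {ζ : ℕ → Vec S.nx} {D : ℝ} (hζ : ∀ τ < T - t, ‖ζ τ‖ ≤ D) {u : Vec S.nu}
    (hu : ∀ i, ∃ y v, IsLocalSolution Q i κ t k x ζ F y v ∧ block u i = block (v 0) i)
    {y : ℕ → Vec S.nx} {v : ℕ → Vec S.nu}
    (hs : IsSolution Q S.A S.B t (T - t) x ζ (Q.fSum T) y v) :
    ‖u - v 0‖ ≤ N * (C * (5 * L + 5) * (C * (L + 2 / (1 - b)) + 1) / (1 - b) * b ^ κ *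
      (‖x‖ + D)) + C * (C * (L + 2 / (1 - b))) * b ^ (k - 1) * (b ^ (k - 1) * ‖x‖ + D) *
        (3 * L + 1) := by
  have hμ := R.consts.hμ.le
  have hb := R.consts.b_pos
  have hL := R.consts.hL
  have htk : t + k ≤ T := ht.le
  have htT : t + (T - t) ≤ T := by omega
  have hD : 0 ≤ D := (norm_nonneg _).trans (hζ 0 (by omega))
  set Λ : ℝ := C * (C * (L + 2 / (1 - b))) * b ^ (k - 1) * (b ^ (k - 1) * ‖x‖ + D) with hΛ
  have hΛ0 : 0 ≤ Λ := by
    have := R.sizeConst_pos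
    have := R.consts.pos
    positivity
  obtain ⟨p, K⟩ := hs.exists_kkt R.costs htT (R.costs.wc_f T le_rfl).differentiable
  have hcent : ∀ φ : ℝ, ∃ y v p, μ ≤ φ → KKT (opOf S.A) (opOf S.B) false k
      (stageGrad Q t k fun z => φ • z) (inputGrad Q t) x ζ 0 0 y v p := by
    intro φ
    by_cases h : μ ≤ φ
    · obtain ⟨y', v', hs'⟩ := exists_isSolution R.costs R.consts.hμ htk
        (F := fun z => φ / 2 * ‖z‖ ^ 2) (differentiable_half_norm_sq φ).continuous
        (fun z => mul_nonneg (by linarith) (sq_nonneg _)) S.A S.B x ζ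
      obtain ⟨p', K'⟩ := hs'.exists_kkt R.costs htk (differentiable_half_norm_sq φ)
      rw [gradient_half_norm_sq] at K'
      exact ⟨y', v', p', fun _ => K'⟩
    · exact ⟨0, 0, 0, fun h' => absurd h' h⟩
  choose Y V P hKV using hcent
  have hlocal : ∀ i, ∃ φ, (μ ≤ φ ∧ φ ≤ L) ∧ ‖block (u - V φ 0) i‖ ≤
      C * (5 * L + 5) * (C * (L + 2 / (1 - b)) + 1) / (1 - b) * b ^ κ * (‖x‖ + D) := by
    intro i
    obtain ⟨y', v', hs', hu'⟩ := hu i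
    obtain ⟨p', K'⟩ := hs'.exists_kkt R.costs htk hF.wc.differentiable
    obtain ⟨φ, h1, h2, h3⟩ := hF.gradient_eq_smul le_rfl R.mu_le (y' k)
    have K₁ := K'.congr_grad (G' := stageGrad Q t k fun z => φ • z) (α' := 0) (fun τ hτ => by
      simp only [stageGrad]
      by_cases h : τ + 1 = k
      · subst h; simp [h3]
      · rw [if_pos (by omega), if_pos (by omega)])
    have h4 := R.norm_block_input_sub_le htk hk (blockMonotone_smul hμ h1 h2) (smul_zero _)
      (hKV φ h1) K₁ (fun τ hτ => hζ τ (by omega))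
    refine ⟨φ, ⟨h1, h2⟩, ?_⟩
    rwa [block_sub, hu', norm_sub_rev, ← block_sub]
  choose φ hφ hloc using hlocal
  have hlip : ∀ φ φ', μ ≤ φ → φ ≤ L → μ ≤ φ' → φ' ≤ L → ‖V φ 0 - V φ' 0‖ ≤ Λ * |φ - φ'| :=
    fun φ φ' h1 h2 h3 h4 => R.input_error_weight htk hk (fun τ hτ => hζ τ (by omega)) h1 h2 h3 h4
      (hKV φ h1) (hKV φ' h3)
  let a : Vec S.nu := WithLp.toLp 2 fun q => V (φ q.1) 0 q
  have ha : ∀ i, block a i = block (V (φ i) 0) i := fun i => rfl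
  have e1 : ‖u - a‖ ≤ N * (C * (5 * L + 5) * (C * (L + 2 / (1 - b)) + 1) / (1 - b) * b ^ κ *
      (‖x‖ + D)) := by
    have h1 : ∀ i ∈ (Finset.univ : Finset (Fin N)), ‖block (u - a) i‖ ≤
        C * (5 * L + 5) * (C * (L + 2 / (1 - b)) + 1) / (1 - b) * b ^ κ * (‖x‖ + D) := by
      intro i _
      rw [block_sub, ha, ← block_sub]
      exact hloc i
    refine (norm_le_sum_norm_block _).trans ((Finset.sum_le_sum h1).trans (le_of_eq ?_))
    rw [Finset.sum_const, Finset.card_univ, Fintype.card_fin, nsmul_eq_mul]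
  have e2 : ‖a - V μ 0‖ ≤ 2 * (Λ * L) := by
    refine le_of_sq_le_sq ?_ (by positivity)
    rw [norm_sq_eq_sum_block]
    have h1 := sum_norm_sq_block_family_le (V := fun φ => V φ 0) R.mu_le hΛ0 hlip hφ
    refine le_trans (le_of_eq ?_) (h1.trans (pow_le_pow_left₀ ?_ ?_ 2))
    · refine Finset.sum_congr rfl fun i _ => ?_
      rw [block_sub, ha, ← block_sub]
    · have := R.mu_le
      have : 0 ≤ L - μ := by linarith
      positivity
    · have h2 : Λ * (L - μ) ≤ Λ * L := mul_le_mul_of_nonneg_left (by linarith) hΛ0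
      linarith
  have e3 : ‖V μ 0 - v 0‖ ≤ Λ * (L + 1) := by
    rw [norm_sub_rev]
    exact R.input_error_restrict hk (by omega) htT (R.blockMonotone_gradient_fSum le_rfl)
      (R.gradient_fSum_zero le_rfl) hζ le_rfl R.mu_le K (hKV μ le_rfl)
  have e4 : u - v 0 = (u - a) + (a - V μ 0) + (V μ 0 - v 0) := by abel
  rw [e4]
  refine (norm_add_le _ _).trans ((add_le_add ((norm_add_le _ _).trans (add_le_add e1 e2)) e3).trans
    (le_of_eq ?_))
  ring

/-- Distance of the distributed input from the first input of the remaining offline problem. -/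
theorem input_error (R : Regular S Q T κ L μ M b C) {t k : ℕ} (hk : 0 < k) (ht : t < T)
    {F : Vec S.nx → ℝ} (hF : TerminalCostAssumption F μ L)
    {x : Vec S.nx} {ζ : ℕ → Vec S.nx} {D : ℝ} (hζ : ∀ τ < T - t, ‖ζ τ‖ ≤ D) {u : Vec S.nu}
    (hu : ∀ i, ∃ y v, (if t + k < T then IsLocalSolution Q i κ t k x ζ F y v
        else IsLocalSolution Q i κ t (T - t) x ζ (Q.fSum T) y v) ∧ block u i = block (v 0) i)
    {y : ℕ → Vec S.nx} {v : ℕ → Vec S.nu}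
    (hs : IsSolution Q S.A S.B t (T - t) x ζ (Q.fSum T) y v) :
    ‖u - v 0‖ ≤ inputConst L b C *
      (N * b ^ κ * (‖x‖ + D) + b ^ k * (b ^ k * ‖x‖ + D)) := by
  have hb := R.consts.b_pos
  have hL := R.consts.hL
  have hC := R.consts.pos
  have hD : 0 ≤ D := (norm_nonneg _).trans (hζ 0 (by omega))
  have hs1 := R.sizeConst_pos
  have hs2 := R.spatialConst_nonneg
  unfold inputConst
  set C₁ := C * (5 * L + 5) * (C * (L + 2 / (1 - b)) + 1) / (1 - b)
  set C₂ := C * (L + 2 / (1 - b))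
  have hk0 : 0 ≤ b ^ k * (b ^ k * ‖x‖ + D) := by positivity
  have hκ0 : 0 ≤ N * b ^ κ * (‖x‖ + D) := by positivity
  have hX : (0 : ℝ) ≤ 4 * C * C₂ * (3 * L + 1) := by positivity
  have hg : N * (C₁ * b ^ κ * (‖x‖ + D)) + 4 * C * C₂ * (3 * L + 1) * (b ^ k * (b ^ k * ‖x‖ + D)) ≤
      (C₁ + 4 * C * C₂ * (3 * L + 1)) *
        (N * b ^ κ * (‖x‖ + D) + b ^ k * (b ^ k * ‖x‖ + D)) := by
    have h1 := mul_nonneg hs2 hk0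
    have h2 := mul_nonneg hX hκ0
    linarith
  by_cases hc : t + k < T
  · simp only [if_pos hc] at hu
    have h1 := R.input_error_interior hk hc hF hζ hu hs
    refine h1.trans (le_trans (add_le_add le_rfl ?_) hg)
    have h2 : b ^ (k - 1) ≤ 2 * b ^ k := by
      obtain ⟨j, rfl⟩ : ∃ j, k = j + 1 := ⟨k - 1, by omega⟩
      rw [Nat.add_sub_cancel, pow_succ]
      nlinarith [pow_pos hb j, R.consts.half_le]
    have h3 : b ^ (k - 1) * (b ^ (k - 1) * ‖x‖ + D) ≤ 2 * b ^ k * (2 * (b ^ k * ‖x‖ + D)) := by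
      refine mul_le_mul h2 ?_ (by positivity) (by positivity)
      have := mul_le_mul_of_nonneg_right h2 (norm_nonneg x)
      linarith
    have h4 := mul_le_mul_of_nonneg_left h3 (by positivity : 0 ≤ C * C₂ * (3 * L + 1))
    calc _ ≤ _ := le_of_eq_of_le (by ring) h4
      _ = _ := by ring
  · simp only [if_neg hc] at hu
    have h1 := R.input_error_terminal ht hζ hu hs
    refine h1.trans (le_trans ?_ hg)
    exact le_add_of_nonneg_right (mul_nonneg hX hk0)

end Regular

section ClosedLoop

theorem KKT.tail {E U : Type} [NormedAddCommGroup E] [InnerProductSpace ℝ E] [CompleteSpace E]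
    [NormedAddCommGroup U] [InnerProductSpace ℝ U] [CompleteSpace U] {A : E →L[ℝ] E}
    {B : U →L[ℝ] E} {h : ℕ} {G : ℕ → E → E} {H : ℕ → U → U} {x : E} {ζ y p : ℕ → E} {v : ℕ → U}
    (K : KKT A B false (h + 1) G H x ζ 0 0 y v p) :
    KKT A B false h (fun τ => G (τ + 1)) (fun τ => H (τ + 1)) (y 1) (fun τ => ζ (τ + 1)) 0 0
      (fun τ => y (τ + 1)) (fun τ => v (τ + 1)) (fun τ => p (τ + 1)) :=
  ⟨rfl, fun τ hτ => K.dyn (τ + 1) (by omega), fun τ hτ _ => K.costate (τ + 1) (by omega) (by simp),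
    fun τ hτ => K.input (τ + 1) (by omega), K.final⟩

/-- Optimality of a solution of the optimality system, quantitatively. -/
theorem KKT.sum_inner_eq_zero {E U : Type} [NormedAddCommGroup E] [InnerProductSpace ℝ E]
    [CompleteSpace E] [NormedAddCommGroup U] [InnerProductSpace ℝ U] [CompleteSpace U]
    {A : E →L[ℝ] E} {B : U →L[ℝ] E} {h : ℕ} {G : ℕ → E → E} {H : ℕ → U → U} {x : E}
    {ζ y p z : ℕ → E} {v q : ℕ → U} (K : KKT A B false h G H x ζ 0 0 y v p) (hz0 : z 0 = x)
    (hz : ∀ τ < h, z (τ + 1) = A (z τ) + B (q τ) + ζ τ) :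
    ∑ τ ∈ Finset.range h, (inner ℝ (G (τ + 1) (y (τ + 1))) (z (τ + 1) - y (τ + 1)) +
      inner ℝ (H τ (v τ)) (q τ - v τ)) = 0 := by
  have h1 := sum_costate_pairing A B h (fun τ => z τ - y τ) p (fun τ => q τ - v τ)
  have h2 : ∑ τ ∈ Finset.range h, inner ℝ (p τ)
      ((z (τ + 1) - y (τ + 1)) - A (z τ - y τ) - B (q τ - v τ)) = 0 := by
    refine Finset.sum_eq_zero fun τ hτ => ?_
    have hτ := Finset.mem_range.1 hτ
    rw [hz τ hτ, K.dyn τ hτ, map_sub, map_sub]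
    convert inner_zero_right (𝕜 := ℝ) (p τ) using 2
    abel
  rw [h2, K.final, hz0, K.init, sub_self, map_zero, inner_zero_left, inner_zero_right, sub_self,
    add_zero] at h1
  rw [← neg_eq_zero, ← Finset.sum_neg_distrib, h1]
  refine Finset.sum_congr rfl fun τ hτ => ?_
  have hτ := Finset.mem_range.1 hτ
  have h3 := K.costate τ hτ (by simp)
  have h4 := K.input τ hτ
  rw [Pi.zero_apply] at h3 h4
  rw [h4, eq_neg_of_add_eq_zero_left h3, inner_neg_left, add_zero]
  ring

variable {N : ℕ} {S : Network N} {Q : Costs S} {T κ : ℕ} {L μ M b C : ℝ}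

theorem stageGrad_succ (Q : Costs S) (t h : ℕ) (g : Vec S.nx → Vec S.nx) (τ : ℕ) :
    stageGrad Q t (h + 1) g (τ + 1) = stageGrad Q (t + 1) h g τ := by
  unfold stageGrad
  rw [show t + (τ + 1) = t + 1 + τ by omega]
  simp only [Nat.add_lt_add_iff_right]

theorem inputGrad_succ (Q : Costs S) (t τ : ℕ) : inputGrad Q t (τ + 1) = inputGrad Q (t + 1) τ := by
  unfold inputGrad
  rw [show t + (τ + 1) + 1 = t + 1 + τ + 1 by omega]

theorem objective_succ (Q : Costs S) (t h : ℕ) (F : Vec S.nx → ℝ) (y : ℕ → Vec S.nx)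
    (v : ℕ → Vec S.nu) :
    objective Q t (h + 1) F y v = Q.fSum t (y 0) + Q.cSum (t + 1) (v 0) +
      objective Q (t + 1) h F (fun τ => y (τ + 1)) (fun τ => v (τ + 1)) := by
  unfold objective
  rw [Finset.sum_range_succ', Finset.sum_range_succ']
  have h1 : ∀ τ, t + (τ + 1) = t + 1 + τ := fun τ => by omega
  have h2 : ∑ τ ∈ Finset.range h, Q.fSum (t + (τ + 1)) (y (τ + 1)) =
      ∑ τ ∈ Finset.range h, Q.fSum (t + 1 + τ) (y (τ + 1)) :=
    Finset.sum_congr rfl fun τ _ => by rw [h1]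
  have h3 : ∑ τ ∈ Finset.range h, Q.cSum (t + (τ + 1) + 1) (v (τ + 1)) =
      ∑ τ ∈ Finset.range h, Q.cSum (t + 1 + τ + 1) (v (τ + 1)) :=
    Finset.sum_congr rfl fun τ _ => by rw [h1]
  rw [h2, h3, add_zero]
  ring

namespace Regular

theorem objective_le (R : Regular S Q T κ L μ M b C) {t ℓ : ℕ} (ht : t + ℓ ≤ T)
    {x : Vec S.nx} {ζ y p z : ℕ → Vec S.nx} {v q : ℕ → Vec S.nu}
    (K : KKT (opOf S.A) (opOf S.B) false ℓ (stageGrad Q t ℓ (gradient (Q.fSum T))) (inputGrad Q t)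
      x ζ 0 0 y v p) (hz : Feasible S.A S.B ℓ x ζ z q) :
    objective Q t ℓ (Q.fSum T) z q ≤ objective Q t ℓ (Q.fSum T) y v +
      L * ∑ τ ∈ Finset.range ℓ, (‖z (τ + 1) - y (τ + 1)‖ ^ 2 + ‖q τ - v τ‖ ^ 2) := by
  have hμ := R.consts.hμ.le
  have h1 := K.sum_inner_eq_zero hz.1 hz.2
  rw [objective_eq, objective_eq, Finset.sum_range_succ', Finset.sum_range_succ', hz.1, K.init]
  have h2 : ∀ τ ∈ Finset.range ℓ, stageCost Q t ℓ (Q.fSum T) (τ + 1) (z (τ + 1)) +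
      Q.cSum (t + τ + 1) (q τ) ≤ stageCost Q t ℓ (Q.fSum T) (τ + 1) (y (τ + 1)) +
      Q.cSum (t + τ + 1) (v τ) +
      (inner ℝ (stageGrad Q t ℓ (gradient (Q.fSum T)) (τ + 1) (y (τ + 1))) (z (τ + 1) - y (τ + 1)) +
      inner ℝ (inputGrad Q t τ (v τ)) (q τ - v τ)) +
      L * (‖z (τ + 1) - y (τ + 1)‖ ^ 2 + ‖q τ - v τ‖ ^ 2) := by
    intro τ hτ
    have hτ := Finset.mem_range.1 hτ
    have h3 : stageCost Q t ℓ (Q.fSum T) (τ + 1) (z (τ + 1)) ≤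
        stageCost Q t ℓ (Q.fSum T) (τ + 1) (y (τ + 1)) +
        inner ℝ (stageGrad Q t ℓ (gradient (Q.fSum T)) (τ + 1) (y (τ + 1)))
          (z (τ + 1) - y (τ + 1)) + L * ‖z (τ + 1) - y (τ + 1)‖ ^ 2 := by
      unfold stageCost stageGrad
      split_ifs with h
      · exact (R.costs.wc_f _ (by omega)).upper_bound hμ _ _
      · exact (R.costs.wc_f _ le_rfl).upper_bound hμ _ _
    have h4 := (R.costs.wc_c (t + τ + 1) (by omega) (by omega)).upper_bound hμ (v τ) (q τ)
    change _ ≤ _ + inner ℝ (inputGrad Q t τ (v τ)) (q τ - v τ) + _ at h4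
    linarith
  have h3 := Finset.sum_le_sum h2
  rw [Finset.sum_add_distrib, Finset.sum_add_distrib, Finset.sum_add_distrib,
    Finset.sum_add_distrib, h1, ← Finset.mul_sum] at h3
  linarith

/-- Comparison of a solution with the solution of the remaining problem from a perturbed state. -/
theorem tail_decay (R : Regular S Q T κ L μ M b C) {t h : ℕ} (ht : t + (h + 1) ≤ T)
    {g : Vec S.nx → Vec S.nx} (hg : BlockMonotone μ L g)
    {x x' : Vec S.nx} {ζ y p y' p' : ℕ → Vec S.nx} {v v' : ℕ → Vec S.nu}
    (K : KKT (opOf S.A) (opOf S.B) false (h + 1) (stageGrad Q t (h + 1) g) (inputGrad Q t)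
      x ζ 0 0 y v p)
    (K' : KKT (opOf S.A) (opOf S.B) false h (stageGrad Q (t + 1) h g) (inputGrad Q (t + 1))
      x' (fun τ => ζ (τ + 1)) 0 0 y' v' p') :
    (∀ m ≤ h, ‖y' m - y (m + 1)‖ ≤ (2 * C * L + 1) * b ^ m * ‖x' - y 1‖) ∧
    ∑ τ ∈ Finset.range h, (‖y' (τ + 1) - y (τ + 1 + 1)‖ ^ 2 + ‖v' τ - v (τ + 1)‖ ^ 2) ≤
      C ^ 2 * L ^ 2 * ‖x' - y 1‖ ^ 2 := by
  have ht' : t + 1 + h ≤ T := by omega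
  have hb := R.consts.b_pos
  have hL := R.consts.hL
  have hC := R.consts.pos
  have e1 : (fun τ => stageGrad Q t (h + 1) g (τ + 1)) = stageGrad Q (t + 1) h g :=
    funext fun τ => stageGrad_succ Q t h g τ
  have e2 : (fun τ => inputGrad Q t (τ + 1)) = inputGrad Q (t + 1) :=
    funext fun τ => inputGrad_succ Q t τ
  have K₁ := K.tail
  rw [e1, e2] at K₁
  have hG : ∀ τ ≤ h, BlockMonotone μ L (stageGrad Q (t + 1) h g τ) :=
    fun τ _ => R.costs.blockMonotone_stageGrad le_rfl ht' hg τ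
  have hH := R.costs.blockMonotone_inputGrad le_rfl ht'
  have hen := R.consts.initial_energy R.norm_A R.norm_B (R.dual h) hG hH K' K₁
  refine ⟨fun m hm => ?_, hen⟩
  cases m with
  | zero =>
    rw [K'.init, pow_zero, mul_one, add_mul, one_mul]
    exact le_add_of_nonneg_left (by positivity)
  | succ m =>
    have h1 := (R.consts.initial_decay R.norm_A R.norm_B (R.dual h) hG hH K' K₁ hm).1
    refine h1.trans (mul_le_mul_of_nonneg_right ?_ (norm_nonneg _))
    rw [pow_succ]
    have h2 := mul_le_mul_of_nonneg_left R.consts.half_le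
      (by positivity : 0 ≤ 2 * C * L * b ^ m)
    have h3 : 0 ≤ b ^ m * b := by positivity
    linarith

theorem exists_offline (R : Regular S Q T κ L μ M b C) (t : ℕ) (ht : t ≤ T) (x : Vec S.nx)
    (ζ : ℕ → Vec S.nx) : ∃ y v p, IsSolution Q S.A S.B t (T - t) x ζ (Q.fSum T) y v ∧
      KKT (opOf S.A) (opOf S.B) false (T - t) (stageGrad Q t (T - t) (gradient (Q.fSum T)))
        (inputGrad Q t) x ζ 0 0 y v p := by
  have hd := (R.costs.wc_f T le_rfl).differentiable
  obtain ⟨y, v, hs⟩ := exists_isSolution R.costs R.consts.hμ (by omega : t + (T - t) ≤ T)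
    hd.continuous (R.costs.nonneg_f T le_rfl) S.A S.B x ζ
  obtain ⟨p, K⟩ := hs.exists_kkt R.costs (by omega) hd
  exact ⟨y, v, p, hs, K⟩

/-- A trajectory whose inputs are close to the inputs of the remaining offline problems: size and
cost. -/
theorem trajectory_bounds (R : Regular S Q T κ L μ M b C) {x₀ : Vec S.nx} {w x : ℕ → Vec S.nx}
    {u : ℕ → Vec S.nu} (hx : Feasible S.A S.B T x₀ w x u) {E : ℕ → ℝ}
    (hE : ∀ t < T, ∀ y v, IsSolution Q S.A S.B t (T - t) (x t) (fun τ => w (t + τ)) (Q.fSum T) y v →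
      ‖u t - v 0‖ ≤ E t) {D : ℝ} (hD : 0 ≤ D) (hw : ∀ s < T, ‖w s‖ ≤ D) :
    (∀ t ≤ T, ‖x t‖ ≤ (2 * (C * (L + 2 / (1 - b))) + 1) * (b ^ t * ‖x₀‖ + D) +
      ∑ s ∈ Finset.range t, (2 * C * L + 1) * b ^ (t - 1 - s) * (L * E s)) ∧
    ∀ xopt uopt, IsOfflineOptimal Q w T x₀ xopt uopt →
      cost Q T x u ≤ cost Q T xopt uopt +
        ∑ t ∈ Finset.range T, L * (1 + L ^ 2 + C ^ 2 * L ^ 4) * E t ^ 2 := by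
  have hb := R.consts.b_pos
  have hL := R.consts.hL
  have hC := R.consts.pos
  have hC₂ := R.sizeConst_pos
  have hex : ∀ t, ∃ y v p, t ≤ T → IsSolution Q S.A S.B t (T - t) (x t) (fun τ => w (t + τ))
      (Q.fSum T) y v ∧ KKT (opOf S.A) (opOf S.B) false (T - t)
        (stageGrad Q t (T - t) (gradient (Q.fSum T))) (inputGrad Q t) (x t) (fun τ => w (t + τ)) 0 0
        y v p := by
    intro t
    by_cases h : t ≤ T
    · obtain ⟨y, v, p, h1⟩ := R.exists_offline t h (x t) fun τ => w (t + τ)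
      exact ⟨y, v, p, fun _ => h1⟩
    · exact ⟨0, 0, 0, fun h' => absurd h' h⟩
  choose Y V P hYV using hex
  have hgT := R.blockMonotone_gradient_fSum (le_refl T)
  have hstep : ∀ t < T, (∀ m ≤ T - (t + 1), ‖Y (t + 1) m - Y t (m + 1)‖ ≤
      (2 * C * L + 1) * b ^ m * (L * E t)) ∧
      ‖x (t + 1) - Y t 1‖ ≤ L * E t ∧
      ∑ τ ∈ Finset.range (T - (t + 1)), (‖Y (t + 1) (τ + 1) - Y t (τ + 1 + 1)‖ ^ 2 +
        ‖V (t + 1) τ - V t (τ + 1)‖ ^ 2) ≤ C ^ 2 * L ^ 2 * (L * E t) ^ 2 := by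
    intro t ht
    obtain ⟨hs, K⟩ := hYV t ht.le
    obtain ⟨hs', K'⟩ := hYV (t + 1) ht
    have e1 : T - t = T - (t + 1) + 1 := by omega
    rw [e1] at K
    have hd : ‖x (t + 1) - Y t 1‖ ≤ L * E t := by
      have h1 := K.dyn 0 (by omega)
      rw [zero_add, K.init, add_zero] at h1
      have h2 : x (t + 1) - Y t 1 = opOf S.B (u t - V t 0) := by
        rw [hx.2 t ht, h1, map_sub, act_eq_opOf, act_eq_opOf]; abel
      rw [h2]
      refine ((opOf S.B).le_opNorm _).trans ?_
      rw [norm_opOf]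
      exact mul_le_mul R.norm_B (hE t ht _ _ hs) (norm_nonneg _) hL
    have e2 : (fun τ => w (t + 1 + τ)) = fun τ => w (t + (τ + 1)) :=
      funext fun τ => by rw [show t + 1 + τ = t + (τ + 1) by omega]
    rw [e2] at K'
    have h1 := R.tail_decay (by omega) hgT K K'
    refine ⟨fun m hm => (h1.1 m hm).trans (mul_le_mul_of_nonneg_left hd (by positivity)), hd,
      h1.2.trans (mul_le_mul_of_nonneg_left (pow_le_pow_left₀ (norm_nonneg _) hd 2)
        (by positivity))⟩
  constructor
  · intro t ht
    have h1 : ∀ s ≤ t, ‖Y s (t - s) - Y 0 t‖ ≤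
        ∑ s' ∈ Finset.range s, (2 * C * L + 1) * b ^ (t - 1 - s') * (L * E s') := by
      intro s
      induction s with
      | zero => intro _; simp
      | succ s ih =>
        intro hs
        have h2 := (hstep s (by omega)).1 (t - (s + 1)) (by omega)
        have h3 := ih (by omega)
        rw [show t - (s + 1) + 1 = t - s by omega, show t - (s + 1) = t - 1 - s by omega] at h2
        rw [Finset.sum_range_succ, show t - (s + 1) = t - 1 - s by omega]
        have h4 : Y (s + 1) (t - 1 - s) - Y 0 t =
            (Y s (t - s) - Y 0 t) + (Y (s + 1) (t - 1 - s) - Y s (t - s)) := by abel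
        rw [h4]
        exact (norm_add_le _ _).trans (add_le_add h3 h2)
    have h2 : ‖Y 0 t‖ ≤ (2 * (C * (L + 2 / (1 - b))) + 1) * (b ^ t * ‖x₀‖ + D) := by
      have K := (hYV 0 (Nat.zero_le _)).2
      cases t with
      | zero =>
        rw [K.init, hx.1, pow_zero, one_mul]
        have : 0 ≤ 2 * (C * (L + 2 / (1 - b))) * (‖x₀‖ + D) := by positivity
        linarith
      | succ t =>
        have h3 := (R.consts.size R.norm_A R.norm_B (R.dual _)
          (fun τ _ => R.costs.blockMonotone_stageGrad le_rfl (by omega) hgT τ)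
          (R.costs.blockMonotone_inputGrad le_rfl (by omega))
          (fun τ _ => R.costs.stageGrad_zero (by omega) (R.gradient_fSum_zero le_rfl) τ)
          (R.costs.inputGrad_zero (by omega)) K (D := D) (fun τ hτ => hw _ (by omega))
          (by omega : t < T - 0)).1
        rw [hx.1] at h3
        refine h3.trans ?_
        rw [pow_succ]
        have h4 := mul_le_mul_of_nonneg_left R.consts.half_le
          (by positivity : 0 ≤ C * (L + 2 / (1 - b)) * (b ^ t * ‖x₀‖))
        have h5 : 0 ≤ C * (L + 2 / (1 - b)) * D := by positivity
        have h6 : 0 ≤ b ^ t * b * ‖x₀‖ := by positivity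
        linarith
    have h3 := h1 t le_rfl
    rw [Nat.sub_self, (hYV t ht).2.init] at h3
    have h4 := norm_add_le (Y 0 t) (x t - Y 0 t)
    rw [add_sub_cancel] at h4
    linarith
  · intro xopt uopt hopt
    have hgap : ∀ t ∈ Finset.range T, (Q.fSum t (x t) + Q.cSum (t + 1) (u t)) ≤
        (objective Q t (T - t) (Q.fSum T) (Y t) (V t) -
          objective Q (t + 1) (T - (t + 1)) (Q.fSum T) (Y (t + 1)) (V (t + 1))) +
        L * (1 + L ^ 2 + C ^ 2 * L ^ 4) * E t ^ 2 := by
      intro t ht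
      have ht := Finset.mem_range.1 ht
      obtain ⟨hs, K⟩ := hYV t ht.le
      obtain ⟨hs', K'⟩ := hYV (t + 1) ht
      have hEt := hE t ht _ _ hs
      obtain ⟨-, hd, hen⟩ := hstep t ht
      obtain ⟨h, hh⟩ : ∃ h, T = t + (h + 1) := ⟨T - (t + 1), by omega⟩
      have e1 : T - t = h + 1 := by omega
      have e2 : T - (t + 1) = h := by omega
      rw [e1] at K ⊢
      rw [e2] at K' hen ⊢
      let z : ℕ → Vec S.nx := fun τ => Nat.casesOn τ (x t) fun τ => Y (t + 1) τ
      let q : ℕ → Vec S.nu := fun τ => Nat.casesOn τ (u t) fun τ => V (t + 1) τ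
      have hzq : Feasible S.A S.B (h + 1) (x t) (fun τ => w (t + τ)) z q := by
        refine ⟨rfl, fun τ hτ => ?_⟩
        cases τ with
        | zero => exact K'.init.trans (hx.2 t ht)
        | succ τ =>
          have h1 := K'.dyn τ (by omega)
          rw [show t + 1 + τ = t + (τ + 1) by omega] at h1
          exact h1
      have h1 := R.objective_le (by omega) K hzq
      rw [objective_succ] at h1
      have h2 : ∑ τ ∈ Finset.range (h + 1), (‖z (τ + 1) - Y t (τ + 1)‖ ^ 2 + ‖q τ - V t τ‖ ^ 2) ≤
          (L * E t) ^ 2 + E t ^ 2 + C ^ 2 * L ^ 2 * (L * E t) ^ 2 := by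
        rw [Finset.sum_add_distrib, Finset.sum_range_succ', Finset.sum_range_succ']
        have h3 : ‖z (0 + 1) - Y t (0 + 1)‖ ^ 2 ≤ (L * E t) ^ 2 := by
          have : z (0 + 1) = x (t + 1) := K'.init
          rw [this]
          exact pow_le_pow_left₀ (norm_nonneg _) hd 2
        have h4 : ‖q 0 - V t 0‖ ^ 2 ≤ E t ^ 2 := pow_le_pow_left₀ (norm_nonneg _) hEt 2
        rw [Finset.sum_add_distrib] at hen
        change ∑ τ ∈ Finset.range h, ‖Y (t + 1) (τ + 1) - Y t (τ + 1 + 1)‖ ^ 2 + _ +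
          (∑ τ ∈ Finset.range h, ‖V (t + 1) τ - V t (τ + 1)‖ ^ 2 + _) ≤ _
        linarith
      have h3 := mul_le_mul_of_nonneg_left h2 hL
      change Q.fSum t (x t) + Q.cSum (t + 1) (u t) +
        objective Q (t + 1) h (Q.fSum T) (Y (t + 1)) (V (t + 1)) ≤ _ at h1
      have h4 : L * ((L * E t) ^ 2 + E t ^ 2 + C ^ 2 * L ^ 2 * (L * E t) ^ 2) =
        L * (1 + L ^ 2 + C ^ 2 * L ^ 4) * E t ^ 2 := by ring
      linarith
    have h1 := Finset.sum_le_sum hgap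
    rw [Finset.sum_add_distrib, Finset.sum_add_distrib] at h1
    have h2 := Finset.sum_range_sub' (fun t => objective Q t (T - t) (Q.fSum T) (Y t) (V t)) T
    rw [h2, Nat.sub_self, Nat.sub_zero] at h1
    have h3 : objective Q T 0 (Q.fSum T) (Y T) (V T) = Q.fSum T (x T) := by
      have := (hYV T le_rfl).2.init
      simp [objective, this]
    have h4 := (hYV 0 (Nat.zero_le _)).1.2 xopt uopt (by
      have h5 := hopt.1
      simpa only [hx.1, Nat.sub_zero, zero_add] using h5)
    rw [Nat.sub_zero] at h4
    have h5 : objective Q 0 T (Q.fSum T) xopt uopt = cost Q T xopt uopt := by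
      simp only [objective, cost, zero_add, Finset.sum_range_succ]; ring
    have h6 : cost Q T x u = ∑ t ∈ Finset.range T, Q.fSum t (x t) +
        ∑ t ∈ Finset.range T, Q.cSum (t + 1) (u t) + Q.fSum T (x T) := by
      simp only [cost, Finset.sum_range_succ]; ring
    rw [h3] at h1
    rw [h5] at h4
    rw [h6]
    linarith

end Regular

end ClosedLoop

section Performance

/-- Gronwall inequality with a geometric kernel. -/
theorem gronwall_geometric {a : ℕ → ℝ} {T : ℕ} {b r c q X D : ℝ} (hb0 : 0 ≤ b) (hbr : b ≤ r ^ 2)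
    (hr0 : 0 < r) (hr1 : r < 1) (hc : 0 ≤ c) (hX : 0 ≤ X) (hD : 0 ≤ D) (hq0 : 0 ≤ q)
    (hq : q ≤ r * (1 - r) / 2)
    (ha : ∀ t ≤ T, a t ≤ c * (b ^ t * X + D) +
      ∑ s ∈ Finset.range t, q * b ^ (t - 1 - s) * (a s + D)) :
    ∀ t ≤ T, a t ≤ 2 * c * r ^ t * X + (2 * c + 1) * D := by
  intro t
  induction t using Nat.strong_induction_on with
  | _ t ih =>
    intro ht
    have hbr' : ∀ j : ℕ, b ^ j ≤ r ^ j * r ^ j := fun j => by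
      rw [← mul_pow, ← sq]; exact pow_le_pow_left₀ hb0 hbr j
    have hrj : ∀ j : ℕ, r ^ j ≤ 1 := fun j => pow_le_one₀ hr0.le hr1.le
    have h1 : ∀ s ∈ Finset.range t, q * b ^ (t - 1 - s) * (a s + D) ≤
        r ^ (t - 1 - s) * (q * (2 * c * r ^ (t - 1) * X + (2 * c + 2) * D)) := by
      intro s hs
      have hs := Finset.mem_range.1 hs
      have h2 := ih s hs (by omega)
      have h3 : b ^ (t - 1 - s) * (a s + D) ≤
          (r ^ (t - 1 - s) * r ^ (t - 1 - s)) * (2 * c * r ^ s * X + (2 * c + 2) * D) := by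
        refine (mul_le_mul_of_nonneg_left (by linarith) (by positivity)).trans
          (mul_le_mul_of_nonneg_right (hbr' _) (by positivity))
      have h4 : r ^ (t - 1) = r ^ (t - 1 - s) * r ^ s := by rw [← pow_add]; congr 1; omega
      have h5 : r ^ (t - 1 - s) * ((2 * c + 2) * D) ≤ (2 * c + 2) * D :=
        mul_le_of_le_one_left (by positivity) (hrj _)
      have h6 := mul_le_mul_of_nonneg_left h5 (by positivity : 0 ≤ r ^ (t - 1 - s))
      have h7 : b ^ (t - 1 - s) * (a s + D) ≤
          r ^ (t - 1 - s) * (2 * c * r ^ (t - 1) * X + (2 * c + 2) * D) := by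
        rw [h4]; linarith
      have h8 := mul_le_mul_of_nonneg_left h7 hq0
      linarith
    have h2 := Finset.sum_le_sum h1
    rw [← Finset.sum_mul, Finset.sum_range_reflect (fun j => r ^ j) t] at h2
    have h3 := geom_sum_le_inv hr0.le hr1 t
    have h4 := ha t ht
    have h5 : b ^ t ≤ r ^ t := (hbr' t).trans (mul_le_of_le_one_left (by positivity) (hrj t))
    have h6 := mul_le_mul_of_nonneg_left (mul_le_mul_of_nonneg_right h5 hX) hc
    rcases Nat.eq_zero_or_pos t with rfl | ht0
    · simp only [Finset.range_zero, Finset.sum_empty, pow_zero, one_mul, mul_one, add_zero] at h4 ⊢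
      have : 0 ≤ c * X := by positivity
      have : 0 ≤ c * D := by positivity
      linarith
    have h7 : (∑ j ∈ Finset.range t, r ^ j) * q ≤ r / 2 := by
      have h8 : 0 < 1 - r := by linarith
      have h9 : 0 ≤ ∑ j ∈ Finset.range t, r ^ j := Finset.sum_nonneg fun _ _ => by positivity
      refine (mul_le_mul h3 hq hq0 (by positivity)).trans (le_of_eq ?_)
      field_simp
    have h8 := mul_le_mul_of_nonneg_right h7
      (by positivity : 0 ≤ 2 * c * r ^ (t - 1) * X + (2 * c + 2) * D)
    have h9 : r * r ^ (t - 1) = r ^ t := by rw [← pow_succ']; congr 1; omega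
    have h10 : r / 2 * (2 * c * r ^ (t - 1) * X + (2 * c + 2) * D) =
        c * (r * r ^ (t - 1)) * X + r * ((c + 1) * D) := by ring
    rw [h10, h9] at h8
    have h11 : r * ((c + 1) * D) ≤ (c + 1) * D := mul_le_of_le_one_left (by positivity) hr1.le
    linarith

variable {N : ℕ} {S : Network N} {Q : Costs S} {T κ : ℕ} {L μ M b C : ℝ}

theorem Regular.performance (R : Regular S Q T κ L μ M b C) {F : Vec S.nx → ℝ}
    (hF : TerminalCostAssumption F μ L) {w x : ℕ → Vec S.nx} {u : ℕ → Vec S.nu} {x₀ : Vec S.nx}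
    {k : ℕ} (hk : 0 < k) (hx : IsDTPCTrajectory Q F w T k κ x₀ x u) {D : ℝ} (hD : 0 ≤ D)
    (hw : ∀ s < T, ‖w s‖ ≤ D) {r : ℝ} (hbr : b ≤ r ^ 2) (hr0 : 0 < r) (hr1 : r < 1)
    (hsmall : (2 * C * L + 1) * L * inputConst L b C * (N * b ^ κ + b ^ k) ≤ r * (1 - r) / 2) :
    (∀ t ≤ T, ‖x t‖ ≤ 2 * (2 * (C * (L + 2 / (1 - b))) + 1) * r ^ t * ‖x₀‖ +
      (2 * (2 * (C * (L + 2 / (1 - b))) + 1) + 1) * D) ∧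
    ∀ xopt uopt, IsOfflineOptimal Q w T x₀ xopt uopt →
      cost Q T x u ≤ cost Q T xopt uopt + ∑ t ∈ Finset.range T, L * (1 + L ^ 2 + C ^ 2 * L ^ 4) *
        (inputConst L b C * (N * b ^ κ + b ^ k) * (‖x t‖ + D)) ^ 2 := by
  have hb := R.consts.b_pos
  have hL := R.consts.hL
  have hC := R.consts.pos
  have hC₂ := R.sizeConst_pos
  have hI := R.inputConst_nonneg
  have h1 := R.trajectory_bounds hx.1
    (E := fun t => inputConst L b C * (N * b ^ κ + b ^ k) * (‖x t‖ + D)) (fun t ht y v hs => by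
      have h2 := R.input_error hk ht hF (fun τ hτ => hw (t + τ) (by omega)) (hx.2 t ht) hs
      refine h2.trans ?_
      rw [mul_assoc (inputConst L b C)]
      refine mul_le_mul_of_nonneg_left ?_ hI
      have h3 : b ^ k * (b ^ k * ‖x t‖) ≤ b ^ k * ‖x t‖ :=
        mul_le_mul_of_nonneg_left (mul_le_of_le_one_left (norm_nonneg _)
          (pow_le_one₀ hb.le R.consts.lt_one.le)) (by positivity)
      linarith) hD hw
  refine ⟨?_, h1.2⟩
  refine gronwall_geometric hb.le hbr hr0 hr1 (by positivity) (norm_nonneg _) hD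
    (by positivity) hsmall fun t ht => ?_
  refine (h1.1 t ht).trans (le_of_eq ?_)
  congr 1
  refine Finset.sum_congr rfl fun s _ => ?_
  ring

/-- Summation of the squared input errors. -/
theorem sum_sq_le_of_geometric {a : ℕ → ℝ} {T : ℕ} {r c X D m A B : ℝ} (hr0 : 0 < r) (hr1 : r < 1)
    (hX : 0 ≤ X) (hD : 0 ≤ D) (hc : 0 ≤ c) (ha0 : ∀ t, 0 ≤ a t) (hA0 : 0 ≤ A)
    (hA1 : A ≤ 1) (hB0 : 0 ≤ B) (hB1 : B ≤ 1)
    (ha : ∀ t ≤ T, a t ≤ c * (r ^ t * X + D)) :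
    ∑ t ∈ Finset.range T, ((m * A + B) * (a t + D)) ^ 2 ≤
      4 * (c + 1) ^ 2 * (m ^ 2 + 1) / (1 - r ^ 2) *
        ((A * D ^ 2 + B * D ^ 2) * T + max B A * X ^ 2) := by
  have hr2 : 0 < 1 - r ^ 2 := by nlinarith
  have h1 : ∀ t ∈ Finset.range T, ((m * A + B) * (a t + D)) ^ 2 ≤
      4 * (c + 1) ^ 2 * (m ^ 2 + 1) *
        ((r ^ 2) ^ t * (max B A * X ^ 2) + (A * D ^ 2 + B * D ^ 2)) := by
    intro t ht
    have h2 : (m * A + B) ^ 2 ≤ (m ^ 2 + 1) * (A + B) := by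
      have : (m * A + B) ^ 2 ≤ (m ^ 2 + 1) * (A ^ 2 + B ^ 2) := by nlinarith [sq_nonneg (m * B - A)]
      refine this.trans (mul_le_mul_of_nonneg_left ?_ (by positivity))
      nlinarith
    have h3 : (a t + D) ^ 2 ≤ 2 * (c + 1) ^ 2 * ((r ^ 2) ^ t * X ^ 2 + D ^ 2) := by
      have h4 : a t + D ≤ (c + 1) * (r ^ t * X + D) := by
        have : 0 ≤ r ^ t * X := by positivity
        linarith [ha t (Finset.mem_range.1 ht).le]
      have h5 := pow_le_pow_left₀ (add_nonneg (ha0 t) hD) h4 2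
      have h6 : (r ^ 2) ^ t = (r ^ t) ^ 2 := by rw [← pow_mul, ← pow_mul, mul_comm]
      rw [h6]
      refine h5.trans ?_
      rw [mul_pow, mul_comm 2, mul_assoc]
      refine mul_le_mul_of_nonneg_left ?_ (sq_nonneg _)
      nlinarith [sq_nonneg (r ^ t * X - D)]
    have h4 : (A + B) * ((r ^ 2) ^ t * X ^ 2 + D ^ 2) ≤
        2 * ((r ^ 2) ^ t * (max B A * X ^ 2) + (A * D ^ 2 + B * D ^ 2)) := by
      have h5 : A + B ≤ 2 * max B A := by linarith [le_max_left B A, le_max_right B A]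
      have h6 := mul_le_mul_of_nonneg_right h5 (by positivity : 0 ≤ (r ^ 2) ^ t * X ^ 2)
      have h7 : 0 ≤ (A + B) * D ^ 2 := by positivity
      linarith
    rw [mul_pow]
    calc _ ≤ ((m ^ 2 + 1) * (A + B)) * (2 * (c + 1) ^ 2 * ((r ^ 2) ^ t * X ^ 2 + D ^ 2)) :=
          mul_le_mul h2 h3 (sq_nonneg _) (by positivity)
      _ = (2 * (c + 1) ^ 2 * (m ^ 2 + 1)) * ((A + B) * ((r ^ 2) ^ t * X ^ 2 + D ^ 2)) := by ring
      _ ≤ (2 * (c + 1) ^ 2 * (m ^ 2 + 1)) *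
          (2 * ((r ^ 2) ^ t * (max B A * X ^ 2) + (A * D ^ 2 + B * D ^ 2))) :=
          mul_le_mul_of_nonneg_left h4 (by positivity)
      _ = _ := by ring
  have hmax : 0 ≤ max B A := hB0.trans (le_max_left _ _)
  refine (Finset.sum_le_sum h1).trans ?_
  rw [← Finset.mul_sum, Finset.sum_add_distrib, ← Finset.sum_mul, Finset.sum_const,
    Finset.card_range, nsmul_eq_mul, div_mul_eq_mul_div, mul_div_assoc]
  refine mul_le_mul_of_nonneg_left ?_ (by positivity)
  rw [add_div, add_comm, div_eq_mul_one_div (max B A * X ^ 2), mul_comm (max B A * X ^ 2)]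
  refine add_le_add ?_ (mul_le_mul_of_nonneg_right
    (geom_sum_le_inv (sq_nonneg r) (by linarith) T) (by positivity))
  rw [le_div_iff₀ hr2, mul_comm (T : ℝ)]
  refine mul_le_of_le_one_right (by positivity) (by nlinarith)

end Performance

section Constants

/-- Uniform constants for all systems satisfying the assumptions. -/
theorem exists_regular_constants (L μ γ σ : ℝ) (d : ℕ) (hL : 1 < L) (hμ : 0 < μ)
    (hγ1 : γ < 1) (hσ : 0 < σ) (hd : 1 ≤ d) :
    ∃ L' M b C : ℝ, L ≤ L' ∧ ctrlDualConst L σ d ≤ M ∧ PairConstants L' μ M b C ∧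
      ∀ (N : ℕ) (S : Network N) (Q : Costs S) (T κ κ₀ : ℕ), SystemAssumption S L γ σ d κ₀ →
        StageCostAssumption Q T μ L → κ₀ ≤ κ → Regular S Q T κ L' μ M b C := by
  set M := max (2 * L ^ 2 * (1 + L ^ 2) * (1 / (1 - γ)) ^ 2) (ctrlDualConst L σ d) with hM
  have hM0 : 0 < M := by
    have : 0 < 1 - γ := by linarith
    exact lt_max_of_lt_left (by positivity)
  obtain ⟨b, C, hC⟩ := exists_pairConstants (max L μ) μ M
    (le_max_of_le_left (by linarith)) hμ hM0
  refine ⟨max L μ, M, b, C, le_max_left _ _, le_max_right _ _, hC, ?_⟩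
  intro N S Q T κ κ₀ hS hQ hκ
  have hA : ‖opOf S.A‖ ≤ L := by rw [norm_opOf]; exact hS.norm_A
  have hB : ‖opOf S.B‖ ≤ L := by rw [norm_opOf]; exact hS.norm_B
  exact {
    consts := hC
    mu_le := le_max_right _ _
    norm_A := hS.norm_A.trans (le_max_left _ _)
    norm_B := hS.norm_B.trans (le_max_left _ _)
    dual := fun h => ((dualBound_of_controllable hL.le hA hB hσ hd
      hS.controllable.dualControllable (by omega : d ≤ h + d)).free_of_constrained hd).mono
        (le_max_right _ _)
    dual_trunc := fun i h => ((hS.stabilizable i κ hκ).dualBound h).mono (le_max_left _ _)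
    costs := hQ.mono (le_max_left _ _) }

theorem deltaS_lt_one {L μ γ : ℝ} (hL : 1 < L) (hμ : 0 < μ) (hγ : γ < 1) : deltaS L μ γ < 1 := by
  have h1 : 0 < LH L := by unfold LH; linarith
  have h2 : 0 < muJ L γ := by
    have : 0 < 1 - γ := by linarith
    unfold muJ; positivity
  have h3 : 0 < muH L μ γ := by unfold muH; positivity
  have h4 : rho L μ γ < 1 := by
    unfold rho
    rw [Real.sqrt_lt' one_pos, one_pow, div_lt_one (by positivity)]
    have := pow_pos h3 2
    linarith
  unfold deltaS
  linarith

theorem pow_le_of_log_div_le {δ q : ℝ} (hδ0 : 0 < δ) (hδ1 : δ < 1) (hq : 0 < q) {k : ℕ}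
    (h : Real.log q / Real.log δ ≤ k) : δ ^ k ≤ q := by
  rw [div_le_iff_of_neg (Real.log_neg hδ0 hδ1)] at h
  rwa [← Real.log_le_log_iff (by positivity) hq, Real.log_pow]

theorem norm_le_of_window_sums_le {E : Type} [SeminormedAddCommGroup E] {w : ℕ → E} {T k : ℕ}
    {D : ℝ} (hk0 : 0 < k) (hk : k ≤ T)
    (hw : ∀ t, t + k ≤ T → ∑ τ ∈ Finset.range k, ‖w (t + τ)‖ ≤ D) {s : ℕ} (hs : s < T) :
    ‖w s‖ ≤ D := by
  have h1 : s = min s (T - k) + (s - min s (T - k)) := by omega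
  have h2 := Finset.single_le_sum (f := fun τ => ‖w (min s (T - k) + τ)‖)
    (fun τ _ => norm_nonneg _) (Finset.mem_range.2 (by omega : s - min s (T - k) < k))
  simp only [← h1] at h2
  exact h2.trans (hw _ (by omega))

end Constants

section Final

theorem SystemAssumption.one_le_card {N : ℕ} {S : Network N} {L γ σ : ℝ} {d κ₀ : ℕ}
    (hS : SystemAssumption S L γ σ d κ₀) : 1 ≤ N := by
  rcases Nat.eq_zero_or_pos N with rfl | h
  · have h1 := hS.kappa_lt_diam
    rw [SimpleGraph.ediam_eq_zero_of_subsingleton] at h1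
    simp at h1
  · exact h

/-- The prediction horizon and the truncation radius make the input errors small. -/
theorem input_errors_small {b δ C L X : ℝ} {N κ k : ℕ} (hb : 1 / 2 ≤ b) (hbδ : b ≤ δ)
    (hδ : δ < 1) (hL : 1 < L) (hN : 1 ≤ N) (hC : 1 ≤ C) (hX0 : 0 ≤ X) (hX : 8 * X ≤ C)
    (hκ : Real.log ((1 - Real.sqrt δ) * (1 - δ) / (2 * C ^ 2 * L * N)) / Real.log δ ≤ κ)
    (hk : 2 * Real.log (δ ^ (5 / 2 : ℝ) * (1 - δ) / (4 * C ^ 3)) / Real.log δ ≤ k) :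
    0 < k ∧ X * (N * b ^ κ + b ^ k) ≤ Real.sqrt δ * (1 - Real.sqrt δ) / 2 := by
  have hδ0 : 0 < δ := by linarith
  have hr0 : 0 < Real.sqrt δ := Real.sqrt_pos.2 hδ0
  have hrr : Real.sqrt δ * Real.sqrt δ = δ := Real.mul_self_sqrt hδ0.le
  have hr1 : Real.sqrt δ < 1 := by rw [Real.sqrt_lt' one_pos]; linarith
  set r := Real.sqrt δ with hr
  have hrhalf : 1 / 2 ≤ r := by nlinarith
  have h1δ : 0 < 1 - δ := by linarith
  have h1r : 0 < 1 - r := by linarith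
  have hδr : 1 - δ ≤ 2 * (1 - r) := by nlinarith
  have hN1 : (1 : ℝ) ≤ N := Nat.one_le_cast.2 hN
  have hC2 : C ≤ C ^ 2 := by nlinarith
  have hC3 : C ≤ C ^ 3 := by nlinarith [pow_pos (by linarith : 0 < C) 2]
  set q := δ ^ (5 / 2 : ℝ) * (1 - δ) / (4 * C ^ 3) with hq
  have hpow0 : 0 < δ ^ (5 / 2 : ℝ) := Real.rpow_pos_of_pos hδ0 _
  have hpow1 : δ ^ (5 / 2 : ℝ) ≤ 1 := Real.rpow_le_one hδ0.le hδ.le (by norm_num)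
  have hq0 : 0 < q := by positivity
  have hq1 : q ≤ (1 - r) / (2 * C) := by
    rw [hq, div_le_div_iff₀ (by positivity) (by positivity)]
    have h1 : δ ^ (5 / 2 : ℝ) * (1 - δ) ≤ 2 * (1 - r) :=
      (mul_le_of_le_one_left h1δ.le hpow1).trans hδr
    have h2 := mul_le_mul h1 (by linarith : 2 * C ≤ 2 * C ^ 3) (by positivity) (by positivity)
    linarith
  have hq2 : q < 1 := by
    refine hq1.trans_lt ?_
    rw [div_lt_one (by positivity)]
    linarith
  have hlog : Real.log δ < 0 := Real.log_neg hδ0 hδ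
  have hlogq : Real.log q < 0 := Real.log_neg hq0 hq2
  have hkpos : 0 < k := by
    have h1 : 0 < 2 * Real.log q / Real.log δ := div_pos_of_neg_of_neg (by linarith) hlog
    exact_mod_cast h1.trans_le hk
  refine ⟨hkpos, ?_⟩
  have hδk : δ ^ k ≤ q := by
    refine pow_le_of_log_div_le hδ0 hδ hq0 (le_trans ?_ hk)
    refine div_le_div_of_nonpos_of_le hlog.le ?_
    linarith
  have hδκ := pow_le_of_log_div_le hδ0 hδ (by positivity) hκ
  have hb0 : 0 ≤ b := by linarith
  have e1 : X * (N * b ^ κ) ≤ (1 - r) / 16 := by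
    have h1 : N * b ^ κ ≤ (1 - r) / (2 * C) := by
      have h2 := mul_le_mul_of_nonneg_left ((pow_le_pow_left₀ hb0 hbδ κ).trans hδκ)
        (by linarith : (0 : ℝ) ≤ N)
      refine h2.trans ?_
      rw [mul_div_assoc', div_le_div_iff₀ (by positivity) (by positivity)]
      have h3 : C ≤ C ^ 2 * L := by nlinarith
      have h4 := mul_le_mul_of_nonneg_left h3 (by positivity : 0 ≤ 2 * (N * (1 - r)))
      have h5 : 2 * (N * (1 - r)) * C * (1 - δ) ≤ 2 * (N * (1 - r)) * C :=
        mul_le_of_le_one_right (by positivity) (by linarith)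
      linarith
    refine (mul_le_mul_of_nonneg_left h1 hX0).trans ?_
    rw [mul_div_assoc', div_le_div_iff₀ (by positivity) (by norm_num)]
    nlinarith
  have e2 : X * b ^ k ≤ (1 - r) / 16 := by
    refine (mul_le_mul_of_nonneg_left (((pow_le_pow_left₀ hb0 hbδ k).trans hδk).trans hq1)
      hX0).trans ?_
    rw [mul_div_assoc', div_le_div_iff₀ (by positivity) (by norm_num)]
    nlinarith
  nlinarith

/-- The state bounds in terms of the rate `1 - ξ` and the bias `W`. -/
theorem state_bounds {C δ L X D c y : ℝ} {N T k t : ℕ} (hδ0 : 0 < δ) (hδ : δ < 1) (hL : 1 < L)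
    (hN : 1 ≤ N) (hX : 0 ≤ X) (hD : 0 ≤ D) (hc : 0 ≤ c) (hcC : c + 1 ≤ C) (ht : t ≤ T)
    (hy : y ≤ c * Real.sqrt δ ^ t * X + (c + 1) * D) :
    (t + k ≤ T → y ≤ C / (1 - Real.sqrt δ) * (1 - (1 - Real.sqrt δ)) ^ (t - k) * X +
      10 * C ^ 3 * L * N / (1 - δ) ^ 2 * D / (1 - Real.sqrt δ)) ∧
    (T < t + k → y ≤ C ^ 2 / (1 - Real.sqrt δ) ^ 2 *
      (1 - (1 - Real.sqrt δ)) ^ ((T : ℤ) - 2 * (k : ℤ)) * δ ^ (t + k - T) * X +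
      2 * C * (10 * C ^ 3 * L * N / (1 - δ) ^ 2 * D) / (1 - Real.sqrt δ) ^ 2) := by
  have hr0 : 0 < Real.sqrt δ := Real.sqrt_pos.2 hδ0
  have hrr : Real.sqrt δ ^ 2 = δ := Real.sq_sqrt hδ0.le
  have hr1 : Real.sqrt δ < 1 := by rw [Real.sqrt_lt' one_pos]; linarith
  rw [sub_sub_cancel]
  set r := Real.sqrt δ with hr
  have hN1 : (1 : ℝ) ≤ N := Nat.one_le_cast.2 hN
  have hC : 1 ≤ C := by linarith
  have h1r : 0 < 1 - r := by linarith
  have h1δ : 0 < 1 - δ := by linarith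
  have hC3 : C ≤ C ^ 3 := by nlinarith [pow_pos (by linarith : 0 < C) 2]
  have hW : C * D ≤ 10 * C ^ 3 * L * N / (1 - δ) ^ 2 * D := by
    refine mul_le_mul_of_nonneg_right ?_ hD
    rw [le_div_iff₀ (by positivity)]
    have h1 : (1 - δ) ^ 2 ≤ 1 := pow_le_one₀ h1δ.le (by linarith)
    have h2 : C * (1 - δ) ^ 2 ≤ C := mul_le_of_le_one_right (by linarith) h1
    have h3 : 1 ≤ L * N := by nlinarith
    have h4 := mul_le_mul_of_nonneg_left h3 (by positivity : 0 ≤ C ^ 3)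
    linarith
  set W := 10 * C ^ 3 * L * N / (1 - δ) ^ 2 * D with hWdef
  have hDW : (c + 1) * D ≤ W := (mul_le_mul_of_nonneg_right hcC hD).trans hW
  have hW0 : 0 ≤ W := by positivity
  have hξ : 1 ≤ 1 / (1 - r) := by rw [le_div_iff₀ h1r]; linarith
  constructor
  · intro _
    refine hy.trans (add_le_add ?_ ?_)
    · refine mul_le_mul_of_nonneg_right ?_ hX
      refine mul_le_mul ?_ (pow_le_pow_of_le_one hr0.le hr1.le (Nat.sub_le _ _)) (by positivity)
        (by positivity)
      rw [div_eq_mul_one_div]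
      nlinarith
    · rw [div_eq_mul_one_div]
      nlinarith
  · intro htk
    have hzp : r ^ t ≤ r ^ ((T : ℤ) - 2 * (k : ℤ)) * δ ^ (t + k - T) := by
      rw [← hrr, ← pow_mul, ← zpow_natCast r (2 * (t + k - T)), ← zpow_add₀ hr0.ne',
        ← zpow_natCast r t]
      exact zpow_le_zpow_right_of_le_one₀ hr0 hr1.le (by omega)
    have hξ2 : 1 ≤ 1 / (1 - r) ^ 2 := by
      rw [le_div_iff₀ (by positivity), one_mul]
      exact pow_le_one₀ h1r.le (by linarith)
    refine hy.trans (add_le_add ?_ ?_)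
    · refine mul_le_mul_of_nonneg_right ?_ hX
      rw [mul_assoc]
      refine mul_le_mul ?_ hzp (by positivity) (by positivity)
      rw [div_eq_mul_one_div]
      nlinarith
    · rw [div_eq_mul_one_div]
      have h1 : W ≤ 2 * C * W := by nlinarith
      nlinarith

end Final

end DTPC

end

theorem theorem1 (L μ γ σ : ℝ) (d : ℕ) (hL : 1 < L) (hμ : 0 < μ) (hγ0 : 0 < γ) (hγ1 : γ < 1)
    (hσ : 0 < σ) (hd : 1 ≤ d) :
    ∃ Ω δT : ℝ, 0 < Ω ∧ 0 < δT ∧ δT < 1 ∧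
      (∀ (N : ℕ) (S : DTPC.Network N) (κ₀ T : ℕ) (Q : DTPC.Costs S),
        DTPC.SystemAssumption S L γ σ d κ₀ → DTPC.StageCostAssumption Q T μ L →
        DTPC.TemporalDecay Q T d Ω δT) ∧
      ∀ p : ℕ → ℝ, DTPC.Subexponential p → ∀ C δ ξ : ℝ,
        C = max Ω (DTPC.Gam L μ γ p) → δ = max (DTPC.deltaS L μ γ) δT → ξ = 1 - Real.sqrt δ →
        0 < ξ ∧
        ∀ N : ℕ, ∃ K c₁ c₂ : ℝ, 0 < K ∧ 0 < c₁ ∧ 0 < c₂ ∧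
          ∀ (S : DTPC.Network N) (Q : DTPC.Costs S) (F : DTPC.Vec S.nx → ℝ)
            (w : ℕ → DTPC.Vec S.nx) (T k κ κ₀ : ℕ) (D W : ℝ) (x₀ : DTPC.Vec S.nx)
            (x xopt : ℕ → DTPC.Vec S.nx) (u uopt : ℕ → DTPC.Vec S.nu),
            DTPC.SystemAssumption S L γ σ d κ₀ →
            DTPC.StageCostAssumption Q T μ L →
            DTPC.TerminalCostAssumption F μ L →
            DTPC.ShellBound S.graph p →
            k ≤ T →
            (∀ t, t + k ≤ T → ∑ τ ∈ Finset.range k, ‖w (t + τ)‖ ≤ D) →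
            max (κ₀ : ℝ)
              (Real.log ((1 - Real.sqrt δ) * (1 - δ) / (2 * C ^ 2 * L * N)) / Real.log δ) ≤ κ →
            2 * Real.log (δ ^ (5 / 2 : ℝ) * (1 - δ) / (4 * C ^ 3)) / Real.log δ ≤ k →
            W = 10 * C ^ 3 * L * N / (1 - δ) ^ 2 * D →
            DTPC.IsDTPCTrajectory Q F w T k κ x₀ x u →
            DTPC.IsOfflineOptimal Q w T x₀ xopt uopt →
            (∀ t ≤ T,
              (t + k ≤ T →
                ‖x t‖ ≤ C / ξ * (1 - ξ) ^ (t - k) * ‖x₀‖ + W / ξ) ∧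
              (T < t + k →
                ‖x t‖ ≤ C ^ 2 / ξ ^ 2 * (1 - ξ) ^ ((T : ℤ) - 2 * (k : ℤ)) * δ ^ (t + k - T) * ‖x₀‖
                  + 2 * C * W / ξ ^ 2)) ∧
            ∃ η : ℝ, c₁ * max (δ ^ k) (δ ^ κ) ≤ η ∧ η ≤ c₂ * max (δ ^ k) (δ ^ κ) ∧
              DTPC.cost Q T x u - DTPC.cost Q T xopt uopt ≤
                K * (((D + (‖x₀‖ + D) / ξ ^ 2) ^ 2 * δ ^ κ
                  + (D + δ ^ k * (‖x₀‖ + D) / ξ) ^ 2 * δ ^ k) * T + η * ‖x₀‖ ^ 2) := by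
  obtain ⟨L', M, b, Cb, hLL, hM, hC, hreg⟩ :=
    DTPC.exists_regular_constants L μ γ σ d hL hμ hγ1 hσ hd
  have hb := hC.b_pos
  have hL' := hC.hL
  have hCb := hC.pos
  have h1b : 0 < 1 - b := by linarith [hC.lt_one]
  set cs : ℝ := 2 * (2 * (Cb * (L' + 2 / (1 - b))) + 1) with hcs
  have hcs0 : 0 ≤ cs := by positivity
  set X : ℝ := (2 * Cb * L' + 1) * L' * DTPC.inputConst L' b Cb with hX
  have hI0 : 0 ≤ DTPC.inputConst L' b Cb := by unfold DTPC.inputConst; positivity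
  have hX0 : 0 ≤ X := by positivity
  have hCL : 0 ≤ 2 * Cb * L' := by positivity
  refine ⟨1 + 2 * Cb * L' + cs + 8 * X, b, by positivity, hb, hC.lt_one, ?_, ?_⟩
  · intro N S κ₀ T Q hS hQ
    exact hC.temporalDecay hL.le hLL hσ hd hM hS.norm_A hS.norm_B hS.controllable hQ
      (by linarith) (by linarith)
  intro p _ C δ ξ hCdef hδdef hξdef
  have hCΩ : 1 + 2 * Cb * L' + cs + 8 * X ≤ C := hCdef ▸ le_max_left _ _
  have hbδ : b ≤ δ := hδdef ▸ le_max_right _ _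
  have hδ1 : δ < 1 := hδdef ▸ max_lt (DTPC.deltaS_lt_one hL hμ hγ1) hC.lt_one
  have hδ0 : 0 < δ := hb.trans_le hbδ
  have hr0 : 0 < Real.sqrt δ := Real.sqrt_pos.2 hδ0
  have hrr : Real.sqrt δ ^ 2 = δ := Real.sq_sqrt hδ0.le
  have hr1 : Real.sqrt δ < 1 := by rw [Real.sqrt_lt' one_pos]; linarith
  have hξ : 0 < ξ := by linarith
  refine ⟨hξ, fun N => ?_⟩
  set K₀ : ℝ := L' * (1 + L' ^ 2 + Cb ^ 2 * L' ^ 4) * DTPC.inputConst L' b Cb ^ 2 *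
    (4 * (cs + 1 + 1) ^ 2 * ((N : ℝ) ^ 2 + 1) / (1 - δ)) with hK₀
  have hK₀0 : 0 ≤ K₀ := by
    have : 0 < 1 - δ := by linarith
    positivity
  refine ⟨K₀ + 1, 1, 1, by linarith, one_pos, one_pos, ?_⟩
  intro S Q F w T k κ κ₀ D W x₀ x xopt u uopt hS hQ hF _ hkT hw hκ hk hW hx hopt
  have hN := hS.one_le_card
  have hκ₀ : κ₀ ≤ κ := by exact_mod_cast (le_max_left _ _).trans hκ
  have R := hreg N S Q T κ κ₀ hS hQ hκ₀
  obtain ⟨hk0, hsmall⟩ := DTPC.input_errors_small hC.half_le hbδ hδ1 hL hN (by linarith) hX0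
    (by linarith) ((le_max_right _ _).trans hκ) hk
  have hD : 0 ≤ D := (Finset.sum_nonneg fun _ _ => norm_nonneg _).trans (hw 0 (by omega))
  have hwD : ∀ s < T, ‖w s‖ ≤ D := fun s hs => DTPC.norm_le_of_window_sums_le hk0 hkT hw hs
  obtain ⟨hst, hcost⟩ := R.performance ⟨hF.wc.mono hLL, hF.kFun⟩ hk0 hx hD hwD
    (hrr.symm ▸ hbδ) hr0 hr1 hsmall
  refine ⟨fun t ht => ?_, max (δ ^ k) (δ ^ κ), by rw [one_mul], by rw [one_mul], ?_⟩
  · rw [hW, hξdef]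
    exact DTPC.state_bounds hδ0 hδ1 hL hN (norm_nonneg _) hD hcs0 (by linarith) ht (hst t ht)
  have h1 := hcost xopt uopt hopt
  have hsum := DTPC.sum_sq_le_of_geometric (a := fun t => ‖x t‖) (T := T) (c := cs + 1)
    (m := (N : ℝ)) hr0 hr1 (norm_nonneg x₀) hD (by linarith) (fun t => norm_nonneg _)
    (pow_nonneg hδ0.le κ) (pow_le_one₀ hδ0.le hδ1.le) (pow_nonneg hδ0.le k)
    (pow_le_one₀ hδ0.le hδ1.le) (fun t ht => by
      refine (hst t ht).trans ?_
      have : 0 ≤ Real.sqrt δ ^ t * ‖x₀‖ := by positivity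
      linarith)
  rw [hrr] at hsum
  have h2 : ∑ t ∈ Finset.range T, L' * (1 + L' ^ 2 + Cb ^ 2 * L' ^ 4) *
      (DTPC.inputConst L' b Cb * (N * b ^ κ + b ^ k) * (‖x t‖ + D)) ^ 2 ≤
      L' * (1 + L' ^ 2 + Cb ^ 2 * L' ^ 4) * DTPC.inputConst L' b Cb ^ 2 *
        ∑ t ∈ Finset.range T, ((N * δ ^ κ + δ ^ k) * (‖x t‖ + D)) ^ 2 := by
    rw [Finset.mul_sum]
    refine Finset.sum_le_sum fun t _ => ?_
    rw [mul_assoc (L' * _), mul_assoc (DTPC.inputConst _ _ _), mul_pow (DTPC.inputConst _ _ _)]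
    refine mul_le_mul_of_nonneg_left (mul_le_mul_of_nonneg_left ?_ (by positivity)) (by positivity)
    refine pow_le_pow_left₀ (by positivity) (mul_le_mul_of_nonneg_right ?_ (by positivity)) 2
    exact add_le_add (mul_le_mul_of_nonneg_left (pow_le_pow_left₀ hb.le hbδ κ) (by positivity))
      (pow_le_pow_left₀ hb.le hbδ k)
  have h3 := h2.trans (mul_le_mul_of_nonneg_left hsum (by positivity))
  rw [← mul_assoc, ← hK₀] at h3
  have hE1 : δ ^ κ * D ^ 2 ≤ (D + (‖x₀‖ + D) / ξ ^ 2) ^ 2 * δ ^ κ := by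
    rw [mul_comm]
    refine mul_le_mul_of_nonneg_right (pow_le_pow_left₀ hD ?_ 2) (by positivity)
    exact le_add_of_nonneg_right (by positivity)
  have hE2 : δ ^ k * D ^ 2 ≤ (D + δ ^ k * (‖x₀‖ + D) / ξ) ^ 2 * δ ^ k := by
    rw [mul_comm]
    refine mul_le_mul_of_nonneg_right (pow_le_pow_left₀ hD ?_ 2) (by positivity)
    exact le_add_of_nonneg_right (by positivity)
  have hE3 := mul_le_mul_of_nonneg_right (add_le_add hE1 hE2) (Nat.cast_nonneg T : (0 : ℝ) ≤ T)
  have hmax : 0 ≤ max (δ ^ k) (δ ^ κ) * ‖x₀‖ ^ 2 :=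
    mul_nonneg (le_max_of_le_left (by positivity)) (sq_nonneg _)
  have h4 := mul_le_mul_of_nonneg_left
    (add_le_add hE3 (le_refl (max (δ ^ k) (δ ^ κ) * ‖x₀‖ ^ 2))) hK₀0
  have h5 : 0 ≤ ((D + (‖x₀‖ + D) / ξ ^ 2) ^ 2 * δ ^ κ
      + (D + δ ^ k * (‖x₀‖ + D) / ξ) ^ 2 * δ ^ k) * T + max (δ ^ k) (δ ^ κ) * ‖x₀‖ ^ 2 :=
    add_nonneg (by positivity) hmax
  rw [add_mul, one_mul]
  linarith
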